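/- Let $V\subset H\subset V'$ be a Gelfand triple of separable real Hilbert spaces ($V$ continuously and densely embedded in $H$, $H$ identified with its dual), $U$ a finite-dimensional Hilbert space, $T>0$, $B\in\mathcal L(U,H)$, $Q,P\in\mathcal L(H)$, $y_\circ\in H$. Let $\mathfrak S=[-1/2,1/2]^{\mathbb N}$ carry the uniform product probability measure $\mathrm d\sigma$, and let $\mathcal A_\sigma\in\mathcal L(V,V')$, $\sigma\in\mathfrak S$, satisfy the following. (i) There are $\rho\in\mathbb R$, $\theta>0$ with $-\langle\mathcal A_\sigma v,v\rangle_{V',V}+\rho\|v\|_H^2\ge\theta\|v\|_V^2$ for all $v\in V$, $\sigma\in\mathfrak S$, and $\|\mathcal A_\sigma\|_{\mathcal L(V,V')}\le C_{\mathcal A}$ for all $\sigma\in\mathfrak S$. (ii) The domains $D(\mathcal A_\sigma)=\{v\in V:\mathcal A_\sigma v\in H\}$ are independent of $\sigma$, and $D(\mathcal A_\sigma)=D(\mathcal A_\sigma^*)=:D(\mathcal A)$, which is normed by the graph norm of $\mathcal A_{0}$. (iii) $\|\mathcal A_\sigma\|_{\mathcal L(D(\mathcal A),H)}\le\widetilde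 C_{\mathcal A}$ for all $\sigma\in\mathfrak S$; for every $x\in D(\mathcal A)$ the map $\sigma\mapsto\mathcal A_\sigma x\in H$ is continuous for the product topology of $\mathfrak S$; all mixed partial derivatives $\partial^\nu_\sigma\mathcal A_\sigma$ exist in $\mathcal L(D(\mathcal A),H)$, and for some $0<p\le1$ and some nonnegative $\tilde b\in\ell^p(\mathbb N)$ one has $\|\partial_\sigma^\nu\mathcal A_\sigma\|_{\mathcal L(D(\mathcal A),H)}\le\prod_j\tilde b_j^{\nu_j}$ for all finitely supported multi-indices $\nu\ne0$ and all $\sigma\in\mathfrak S$. Let $f\in L^2(0,T;H)$ and $g\in W^{1,2}(0,T;H)\cap L^2(0,T;D(\mathcal A))$. For $\sigma\in\mathfrak S$ let $\Pi_\sigma$ be the self-adjoint nonnegative, strongly continuous solution on $[0,T]$ of $$\dot\Pi_\sigma=\Pi_\sigma\mathcal A_\sigma+\mathcal A_\sigma^*\Pi_\sigma-\Pi_\sigma BB^*\Pi_\sigma+Q^*Q,\qquad\Pi_\sigma(0)=P^*P$$ (tested with pairs of elements of $D(\mathcal A)$), and let $h_\sigma\in W(0,T;V,V')=\{v\in L^2(0,T;V):\dot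 v\in L^2(0,T;V')\}$ solve $$-\dot h_\sigma(t)=(\mathcal A_\sigma^*-\Pi_\sigma(T-t)BB^*)h_\sigma(t)+\Pi_\sigma(T-t)\,(f+\mathcal A_\sigma g-\dot g)(t),\qquad h_\sigma(T)=0 .$$ Let $K_\sigma(t,x)=-B^*\Pi_\sigma(T-t)x-B^*h_\sigma(t)$ be the optimal feedback for the parameter $\sigma$, put $B^*\Pi:=\int_{\mathfrak S}B^*\Pi_\sigma\,\mathrm d\sigma$ and $B^*h:=\int_{\mathfrak S}B^*h_\sigma\,\mathrm d\sigma$, and let $K(t,x)=-B^*\Pi(T-t)x-B^*h(t)$ be the mean-based feedback. Let $z=0$ or $z=g$ (the feedback acts on the state, or on the tracking error $y-g$). Then the integrals $\int_{\mathfrak S}B^*\Pi_\sigma(T-t)\,\mathrm d\sigma$ and $\int_{\mathfrak S}B^*h_\sigma(t)\,\mathrm d\sigma$ exist as Bochner integrals for every $t\in[0,T]$, and there are constants $\bar C_y,\bar C_u>0$, independent of $\bar\sigma$, such that for every (true) parameter $\bar\sigma\in\mathfrak S$ the maximum $$M_{\bar\sigma}=\max_{t\in[0,T]}\Big(\|B^*(\Pi_{\bar\sigma}-\Pi)(T-t)\|_{\mathcal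 L(H,U)}+\|B^*(h_{\bar\sigma}-h)(t)\|_U\Big)$$ exists, and the following holds. If $y_{\bar\sigma},y\in W(0,T;V,V')$ (identified with their continuous representatives $[0,T]\to H$) solve the closed-loop systems $$\dot y_{\bar\sigma}=\mathcal A_{\bar\sigma}y_{\bar\sigma}+BK_{\bar\sigma}(t,y_{\bar\sigma}-z)+f,\qquad \dot y=\mathcal A_{\bar\sigma}y+BK(t,y-z)+f,\qquad y_{\bar\sigma}(0)=y(0)=y_\circ,$$ with controls $u_{\bar\sigma}(t)=K_{\bar\sigma}(t,y_{\bar\sigma}(t)-z(t))$ and $u(t)=K(t,y(t)-z(t))$, then for all $t\in[0,T]$ $$\|y_{\bar\sigma}(t)-y(t)\|_H\le\bar C_yM_{\bar\sigma},\qquad\|u_{\bar\sigma}(t)-u(t)\|_U\le\bar C_uM_{\bar\sigma}.$$ -/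

import Mathlib

open MeasureTheory Set

noncomputable section

namespace MeanFeedback

/-- The parameter set `[-1/2, 1/2]^ℕ`. -/
def paramSet : Set (ℕ → ℝ) := {σ | ∀ j, σ j ∈ Icc (-1 / 2 : ℝ) (1 / 2)}

/-- The uniform distribution on `[-1/2, 1/2]`. -/
def unif : Measure ℝ := volume.restrict (Icc (-1 / 2 : ℝ) (1 / 2))

instance : IsProbabilityMeasure unif := ⟨by
  simp only [unif, Measure.restrict_apply MeasurableSet.univ, univ_inter, Real.volume_Icc]
  norm_num⟩

/-- The uniform product probability measure, carried by `paramSet`. -/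
def paramMeasure : Measure (ℕ → ℝ) := Measure.infinitePi fun _ : ℕ => unif

/-- Lebesgue measure on the time interval `(0, T)`. -/
def timeMeasure (T : ℝ) : Measure ℝ := volume.restrict (Ioo 0 T)

section Spaces

variable {V H U : Type*}
  [NormedAddCommGroup V] [InnerProductSpace ℝ V]
  [NormedAddCommGroup H] [InnerProductSpace ℝ H]
  [NormedAddCommGroup U] [InnerProductSpace ℝ U] [CompleteSpace U]

/-- The embedding `H ⊂ V'` of the Gelfand triple `V ⊂ H ⊂ V'` given by `ι : V → H`, with `H`
identified with its dual: `⟨x, v⟩_{V',V} = ⟨x, ι v⟩_H`. -/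
def toDualV (ι : V →L[ℝ] H) (x : H) : StrongDual ℝ V := (innerSL ℝ x).comp ι

/-- The domain `{v ∈ V | 𝒜 v ∈ H}` of the part in `H` of an operator `𝒜 : V → V'`. -/
def domainH (ι : V →L[ℝ] H) (𝒜 : V →L[ℝ] StrongDual ℝ V) : Set V :=
  {v | ∃ x : H, 𝒜 v = toDualV ι x}

/-- The domain of the part of `𝒜` in `H`, as a normed space with the graph norm
`(‖x‖_H ^ 2 + ‖𝒜 x‖_H ^ 2) ^ (1/2)`: an element `v` of the domain is represented by the pair
`(v, 𝒜 v)` in the Hilbert space `H × H`. -/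
def graphDomain (ι : V →L[ℝ] H) (𝒜 : V →L[ℝ] StrongDual ℝ V) :
    Submodule ℝ (WithLp 2 (H × H)) where
  carrier := {p | ∃ v : V, ι v = p.fst ∧ 𝒜 v = toDualV ι p.snd}
  zero_mem' := ⟨0, by simp, by ext; simp [toDualV]⟩
  add_mem' := by
    rintro p q ⟨v, hv, hv'⟩ ⟨w, hw, hw'⟩
    exact ⟨v + w, by simp [hv, hw], by
      rw [map_add, hv', hw']; ext u; simp [toDualV]⟩
  smul_mem' := by
    rintro c p ⟨v, hv, hv'⟩
    exact ⟨c • v, by simp [hv], by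
      rw [map_smul, hv']; ext u; simp [toDualV]⟩

/-- `L ∈ ℒ(D(𝒜₀), H)` is the restriction of `𝒜 : V → V'` to `D(𝒜₀)`. -/
def IsRestriction (ι : V →L[ℝ] H) (𝒜₀ 𝒜 : V →L[ℝ] StrongDual ℝ V)
    (L : graphDomain ι 𝒜₀ →L[ℝ] H) : Prop :=
  ∀ (v : V) (p : graphDomain ι 𝒜₀), ι v = (p : WithLp 2 (H × H)).fst → 𝒜 v = toDualV ι (L p)

/-- `F ν` is the mixed partial derivative `∂^ν F₀` on the cube `paramSet`, for every finitely
supported multi-index `ν` (one-sided derivatives on the faces of the cube). -/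
structure IsPartialDerivs {E : Type*} [NormedAddCommGroup E] [NormedSpace ℝ E]
    (F₀ : (ℕ → ℝ) → E) (F : (ℕ →₀ ℕ) → (ℕ → ℝ) → E) : Prop where
  zero : ∀ σ ∈ paramSet, F 0 σ = F₀ σ
  succ : ∀ (ν : ℕ →₀ ℕ) (j : ℕ), ∀ σ ∈ paramSet,
    HasDerivWithinAt (fun s : ℝ => F ν (Function.update σ j s)) (F (ν + Finsupp.single j 1) σ)
      (Icc (-1 / 2) (1 / 2)) (σ j)

/-- The function `y : [0, T] → H` is (the continuous representative of) an element of
`W(0,T; V, V') = {v ∈ L²(0,T; V) | v' ∈ L²(0,T; V')}`, where `yV` is `y` regarded as a `V`-valued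
function and `dy` is its weak time derivative. -/
structure MemW (ι : V →L[ℝ] H) (T : ℝ) (y : ℝ → H) (yV : ℝ → V) (dy : ℝ → StrongDual ℝ V) :
    Prop where
  continuousOn : ContinuousOn y (Icc 0 T)
  memLp_V : MemLp yV 2 (timeMeasure T)
  memLp_dual : MemLp dy 2 (timeMeasure T)
  coe_eq : ∀ᵐ t ∂timeMeasure T, ι (yV t) = y t
  deriv_eq : ∀ t ∈ Icc 0 T, toDualV ι (y t) = toDualV ι (y 0) + ∫ s in (0 : ℝ)..t, dy s

/-- `Π` is a self-adjoint nonnegative, strongly continuous solution on `[0, T]` of the Riccati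
equation `Π' = Π 𝒜 + 𝒜* Π - Π B B* Π + Q* Q`, `Π(0) = P* P`, which is tested with pairs of
elements of the domain of (the part in `H` of) `𝒜`. -/
structure IsRiccatiSolution [CompleteSpace H] (ι : V →L[ℝ] H) (𝒜 : V →L[ℝ] StrongDual ℝ V)
    (B : U →L[ℝ] H) (Q P : H →L[ℝ] H) (T : ℝ) (Pi : ℝ → H →L[ℝ] H) : Prop where
  continuousOn : ∀ x : H, ContinuousOn (fun t => Pi t x) (Icc 0 T)
  isPositive : ∀ t ∈ Icc 0 T, (Pi t).IsPositive
  initial : Pi 0 = P.adjoint ∘L P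
  equation : ∀ (v w : V) (a b : H), 𝒜 v = toDualV ι a → 𝒜 w = toDualV ι b → ∀ t ∈ Icc 0 T,
    HasDerivWithinAt (fun s => inner ℝ (Pi s (ι v)) (ι w))
      (inner ℝ (Pi t a) (ι w) + inner ℝ (Pi t (ι v)) b
        - inner ℝ (B.adjoint (Pi t (ι v))) (B.adjoint (Pi t (ι w)))
        + inner ℝ (Q (ι v)) (Q (ι w)))
      (Icc 0 T) t

/-- `h ∈ W(0,T; V, V')` solves `-h' = (𝒜* - Π(T - ·) B B*) h + Π(T - ·) r`, `h(T) = 0`. -/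
def IsOffsetSolution [CompleteSpace H] (ι : V →L[ℝ] H) (𝒜 : V →L[ℝ] StrongDual ℝ V)
    (B : U →L[ℝ] H) (T : ℝ) (Pi : ℝ → H →L[ℝ] H) (r : ℝ → H) (h : ℝ → H) : Prop :=
  ∃ (hV : ℝ → V) (dh : ℝ → StrongDual ℝ V), MemW ι T h hV dh ∧ h T = 0 ∧
    ∀ᵐ t ∂timeMeasure T, -dh t =
      𝒜.flip (hV t) + toDualV ι (Pi (T - t) (r t) - Pi (T - t) (B (B.adjoint (h t))))

/-- `y ∈ W(0,T; V, V')` solves the closed-loop system `y' = 𝒜 y + B K(·, y - z) + f`, `y(0) = y₀`,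
in which the feedback `K` acts on the deviation of the state from the reference `z`. -/
def IsClosedLoop (ι : V →L[ℝ] H) (𝒜 : V →L[ℝ] StrongDual ℝ V) (B : U →L[ℝ] H) (T : ℝ)
    (K : ℝ → H → U) (z f : ℝ → H) (y₀ : H) (y : ℝ → H) : Prop :=
  ∃ (yV : ℝ → V) (dy : ℝ → StrongDual ℝ V), MemW ι T y yV dy ∧ y 0 = y₀ ∧
    ∀ᵐ t ∂timeMeasure T, dy t = 𝒜 (yV t) + toDualV ι (B (K t (y t - z t)) + f t)

/-- The affine feedback `x ↦ -(B*Π)(T - t) x - (B*h)(t)`. -/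
def feedback (T : ℝ) (BPi : ℝ → H →L[ℝ] U) (Bh : ℝ → U) (t : ℝ) (x : H) : U :=
  -(BPi (T - t) x) - Bh t

/-- `B*Π := ∫ B*Π_σ dσ`, as a function of time. -/
def meanBPi [CompleteSpace H] (B : U →L[ℝ] H) (Pi : (ℕ → ℝ) → ℝ → H →L[ℝ] H) (τ : ℝ) :
    H →L[ℝ] U :=
  ∫ σ, B.adjoint ∘L Pi σ τ ∂paramMeasure

/-- `B*h := ∫ B*h_σ dσ`, as a function of time. -/
def meanBh [CompleteSpace H] (B : U →L[ℝ] H) (h : (ℕ → ℝ) → ℝ → H) (t : ℝ) : U :=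
  ∫ σ, B.adjoint (h σ t) ∂paramMeasure

/-- The optimal feedback `K_σ(t, ·) = -B* (Π_σ(T - t) · + h_σ(t))` for one parameter. -/
def optFeedback [CompleteSpace H] (B : U →L[ℝ] H) (T : ℝ) (Pi : ℝ → H →L[ℝ] H) (h : ℝ → H) :
    ℝ → H → U :=
  feedback T (fun τ => B.adjoint ∘L Pi τ) (fun t => B.adjoint (h t))

/-- The mean-based feedback `K(t, ·) = ∫ K_σ(t, ·) dσ`. -/
def meanFeedback [CompleteSpace H] (B : U →L[ℝ] H) (T : ℝ) (Pi : (ℕ → ℝ) → ℝ → H →L[ℝ] H)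
    (h : (ℕ → ℝ) → ℝ → H) : ℝ → H → U :=
  feedback T (meanBPi B Pi) (meanBh B h)

/-- The feedback deviation
`‖B*(Π_σ - Π)(T - t)‖ + ‖B*(h_σ - h)(t)‖` of the parameter `σ` from the mean. -/
def deviation [CompleteSpace H] (B : U →L[ℝ] H) (T : ℝ) (Pi : (ℕ → ℝ) → ℝ → H →L[ℝ] H)
    (h : (ℕ → ℝ) → ℝ → H) (σ : ℕ → ℝ) (t : ℝ) : ℝ :=
  ‖B.adjoint ∘L Pi σ (T - t) - meanBPi B Pi (T - t)‖ + ‖B.adjoint (h σ t) - meanBh B h t‖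

end Spaces

end MeanFeedback

end

/-! The estimate itself is a Grönwall argument: the two closed loops share generator, source and
initial value, and their feedbacks differ by at most `M` in the gain and in the offset. If gains and
offsets are bounded uniformly in σ, the state of the mean-based loop is bounded by a constant that
does not see σ; the difference of the states then solves an equation with a linear feedback term
plus an error of size `M` (`exists_feedback_comparison`). The work lies in the uniform bounds and in
the measurability of σ ↦ Π_σ and σ ↦ h_σ, neither of which is among the hypotheses.

Both come from optimal control. For the state equation y' = A_σ y + B u + r_σ with cost ‖P y(T)‖² +
∫ (‖Q y‖² + ‖u‖²), completing the square (`cost_eq_value_add`) writes the cost as ⟨Π_σ(T - a)x, x⟩ +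
2⟨h_σ(a), x⟩ + const, the value, plus the squared distance of u from the feedback law. The value
therefore lies below every cost, and it is the infimum of the costs, because Picard iteration makes
the squared distance as small as desired (`exists_near_feedback`). Consequences: (1) The value is
nonnegative and is bounded by the cost of u = 0, uniformly in σ. With r = 0 this bounds Π_σ;
comparing the values at x and -x bounds h_σ. (2) For a fixed control the cost is continuous in σ, so
the value, an infimum of such costs, is upper semicontinuous in σ and hence measurable. Polarization
and the difference of the values at x and -x give weak measurability of Π_σ and h_σ. Separability of
H and finite dimension of U turn this into Bochner integrability of B*Π_σ and B*h_σ, together with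
norm continuity in time.

Continuity of the cost in σ is `tendstoUniformlyOn_of_isMild`: a state regularized by a resolvent
takes values in the common domain D(𝒜), where σ ↦ 𝒜_σ x is continuous, and so it is an approximate
solution for neighbouring parameters as well.

The Riccati equation is only tested on D(𝒜), which the states need not reach. All identities are
therefore proved after smoothing by the resolvents J_μ = (1 - μA)⁻¹, which replace A by the bounded
operator A_μ = A J_μ, and μ is then sent to 0. Mild solutions are defined by the same device: y is
mild if each J_μ y is a primitive of A_μ y + J_μ F. -/

noncomputable section

namespace MeanFeedback

open Filter Topology

set_option linter.unusedSectionVars false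

/-! ### Calculus of absolutely continuous Hilbert-space-valued functions, and Grönwall's inequality
-/

section

/-- A function whose increments are, uniformly at small scales, those of the integral of `κ` is a
primitive of `κ`. -/
theorem integral_eq_sub_of_local {φ κ m : ℝ → ℝ} {a b : ℝ} (hab : a ≤ b)
    (hκ : IntervalIntegrable κ volume a b) (hm : IntervalIntegrable m volume a b)
    (h : ∀ ε > 0, ∃ δ > 0, ∀ s t, a ≤ s → s ≤ t → t ≤ b → t - s < δ →
      |φ t - φ s - ∫ q in s..t, κ q| ≤ ε * ∫ q in s..t, m q) :
    φ b - φ a = ∫ q in a..b, κ q := by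
  -- A uniform partition finer than δ: the local errors add up to at most ε ∫ m, since the integrals
  -- of `m` over the pieces telescope.
  have key : ∀ ε > 0, |φ b - φ a - ∫ q in a..b, κ q| ≤ ε * ∫ q in a..b, m q := by
    intro ε hε
    obtain ⟨δ, hδ, H⟩ := h ε hε
    obtain ⟨n, hn⟩ := exists_nat_gt ((b - a) / δ)
    have hn0 : (0 : ℝ) < n := lt_of_le_of_lt (div_nonneg (by linarith) hδ.le) hn
    have hstep : (b - a) / n < δ := by
      rw [div_lt_iff₀ hδ] at hn
      rw [div_lt_iff₀ hn0]; linarith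
    set x : ℕ → ℝ := fun k => a + k * ((b - a) / n) with hx
    have hd : 0 ≤ (b - a) / n := div_nonneg (by linarith) hn0.le
    have hx0 : x 0 = a := by simp [hx]
    have hxn : x n = b := by simp only [hx]; field_simp; ring
    have hmono : Monotone x := by
      intro i j hij
      have : (i : ℝ) ≤ j := by exact_mod_cast hij
      simp only [hx]; gcongr
    have hmem : ∀ k ≤ n, a ≤ x k ∧ x k ≤ b := fun k hk =>
      ⟨hx0 ▸ hmono (Nat.zero_le k), hxn ▸ hmono hk⟩
    have hsub : ∀ (f : ℝ → ℝ), IntervalIntegrable f volume a b → ∀ k < n,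
        IntervalIntegrable f volume (x k) (x (k + 1)) := by
      intro f hf k hk
      refine hf.mono_set ?_
      rw [uIcc_of_le hab, uIcc_of_le (hmono (Nat.le_succ k))]
      exact Icc_subset_Icc (hmem k hk.le).1 (hmem (k + 1) hk).2
    have e1 := intervalIntegral.sum_integral_adjacent_intervals (hsub κ hκ)
    have e2 := intervalIntegral.sum_integral_adjacent_intervals (hsub m hm)
    have e3 := Finset.sum_range_sub (fun k => φ (x k)) n
    rw [hx0, hxn] at e1 e2 e3
    rw [← e1, ← e2, ← e3, ← Finset.sum_sub_distrib, Finset.mul_sum]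
    refine (Finset.abs_sum_le_sum_abs _ _).trans (Finset.sum_le_sum fun k hk => ?_)
    have hk := Finset.mem_range.1 hk
    refine H _ _ (hmem k hk.le).1 (hmono (Nat.le_succ k)) (hmem (k + 1) hk).2 ?_
    simp only [hx]; push_cast; linarith
  have hlim : Tendsto (fun ε : ℝ => ε * ∫ q in a..b, m q) (𝓝[>] 0) (𝓝 (0 * ∫ q in a..b, m q)) :=
    (tendsto_nhdsWithin_of_tendsto_nhds tendsto_id).mul_const _
  rw [zero_mul] at hlim
  have h0 : |φ b - φ a - ∫ q in a..b, κ q| ≤ 0 :=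
    ge_of_tendsto hlim (eventually_nhdsWithin_of_forall fun ε hε => key ε hε)
  linarith [abs_nonpos_iff.1 h0]

/-- `X` is an absolutely continuous function on `[a, b]` with derivative `X'`. -/
structure IsPrimitive {E : Type*} [NormedAddCommGroup E] [NormedSpace ℝ E]
    (X X' : ℝ → E) (a b : ℝ) : Prop where
  integrable : IntervalIntegrable X' volume a b
  eq : ∀ t ∈ Icc a b, X t = X a + ∫ s in a..t, X' s

namespace IsPrimitive

variable {E F : Type*} [NormedAddCommGroup E] [NormedSpace ℝ E]
  [NormedAddCommGroup F] [NormedSpace ℝ F] {X X' Y Y' : ℝ → E} {a b : ℝ}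

theorem integrable_sub (h : IsPrimitive X X' a b) {s t : ℝ} (hs : a ≤ s) (hst : s ≤ t)
    (ht : t ≤ b) : IntervalIntegrable X' volume s t := by
  refine h.integrable.mono_set ?_
  rw [uIcc_of_le (hs.trans (hst.trans ht)), uIcc_of_le hst]
  exact Icc_subset_Icc hs ht

theorem sub_eq (h : IsPrimitive X X' a b) {s t : ℝ} (hs : a ≤ s) (hst : s ≤ t)
    (ht : t ≤ b) : X t - X s = ∫ q in s..t, X' q := by
  rw [h.eq t ⟨hs.trans hst, ht⟩, h.eq s ⟨hs, hst.trans ht⟩, add_sub_add_left_eq_sub]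
  exact intervalIntegral.integral_interval_sub_left
    (h.integrable_sub le_rfl (hs.trans hst) ht) (h.integrable_sub le_rfl hs (hst.trans ht))

theorem mono (h : IsPrimitive X X' a b) {s t : ℝ} (hs : a ≤ s) (hst : s ≤ t) (ht : t ≤ b) :
    IsPrimitive X X' s t :=
  ⟨h.integrable_sub hs hst ht, fun q hq => by
    rw [← h.sub_eq hs hq.1 (hq.2.trans ht)]; abel⟩

theorem continuousOn (h : IsPrimitive X X' a b) : ContinuousOn X (Icc a b) := by
  rcases le_or_gt a b with hab | hab
  · have := intervalIntegral.continuousOn_primitive_interval' h.integrable (left_mem_uIcc)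
    rw [uIcc_of_le hab] at this
    exact (continuousOn_const.add this).congr h.eq
  · simp [Icc_eq_empty_of_lt hab]

theorem clm [CompleteSpace E] [CompleteSpace F] (L : E →L[ℝ] F) (h : IsPrimitive X X' a b) :
    IsPrimitive (fun t => L (X t)) (fun t => L (X' t)) a b :=
  ⟨⟨L.integrable_comp h.integrable.1, L.integrable_comp h.integrable.2⟩, fun t ht => by
    rw [h.eq t ht, map_add,
      L.intervalIntegral_comp_comm (h.integrable_sub le_rfl ht.1 ht.2)]⟩

theorem sub (hX : IsPrimitive X X' a b) (hY : IsPrimitive Y Y' a b) :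
    IsPrimitive (fun t => X t - Y t) (fun t => X' t - Y' t) a b :=
  ⟨hX.integrable.sub hY.integrable, fun t ht => by
    rw [hX.eq t ht, hY.eq t ht, intervalIntegral.integral_sub
      (hX.integrable_sub le_rfl ht.1 ht.2) (hY.integrable_sub le_rfl ht.1 ht.2)]; abel⟩

theorem congr (hab : a ≤ b) (h : IsPrimitive X X' a b) (hY : ∀ t ∈ Icc a b, X t = Y t)
    (hY' : ∀ᵐ t, t ∈ Ioc a b → X' t = Y' t) : IsPrimitive Y Y' a b := by
  refine ⟨h.integrable.congr_ae ?_, fun t ht => ?_⟩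
  · rw [uIoc_of_le hab]
    exact (ae_restrict_iff' measurableSet_Ioc).2 hY'
  · rw [← hY t ht, ← hY a ⟨le_rfl, hab⟩, h.eq t ht]
    congr 1
    refine intervalIntegral.integral_congr_ae ?_
    filter_upwards [hY'] with q hq hqt
    rw [uIoc_of_le ht.1] at hqt
    exact hq ⟨hqt.1, hqt.2.trans ht.2⟩

end IsPrimitive

section Inner

variable {H : Type*} [NormedAddCommGroup H] [InnerProductSpace ℝ H]

theorem _root_.IntervalIntegrable.inner_continuousOn {f g : ℝ → H} {a b : ℝ} (hab : a ≤ b)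
    (hf : IntervalIntegrable f volume a b) (hg : ContinuousOn g (Icc a b)) :
    IntervalIntegrable (fun s => inner ℝ (f s) (g s)) volume a b := by
  rw [intervalIntegrable_iff_integrableOn_Ioc_of_le hab] at hf ⊢
  obtain ⟨C, hC⟩ := isCompact_Icc.exists_bound_of_continuousOn hg
  refine (hf.norm.mul_const C).mono' ?_ ?_
  · exact hf.1.inner ((hg.mono Ioc_subset_Icc_self).aestronglyMeasurable measurableSet_Ioc)
  · refine (ae_restrict_iff' measurableSet_Ioc).2 (ae_of_all _ fun s hs => ?_)
    refine (norm_inner_le_norm _ _).trans ?_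
    exact mul_le_mul_of_nonneg_left (hC s (Ioc_subset_Icc_self hs)) (norm_nonneg _)

theorem _root_.IntervalIntegrable.continuousOn_inner {f g : ℝ → H} {a b : ℝ} (hab : a ≤ b)
    (hf : IntervalIntegrable f volume a b) (hg : ContinuousOn g (Icc a b)) :
    IntervalIntegrable (fun s => inner ℝ (g s) (f s)) volume a b := by
  simpa only [real_inner_comm] using hf.inner_continuousOn hab hg

theorem _root_.ContinuousOn.exists_delta {E : Type*} [NormedAddCommGroup E] {f : ℝ → E} {a b : ℝ}
    (hf : ContinuousOn f (Icc a b)) {ε : ℝ} (hε : 0 < ε) :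
    ∃ δ > 0, ∀ s ∈ Icc a b, ∀ t ∈ Icc a b, |s - t| < δ → ‖f s - f t‖ ≤ ε := by
  have := Metric.uniformContinuousOn_iff.1
    (isCompact_Icc.uniformContinuousOn_of_continuous hf) ε hε
  obtain ⟨δ, hδ, H⟩ := this
  exact ⟨δ, hδ, fun s hs t ht hst => by
    have := H s hs t ht (by rwa [Real.dist_eq]); rw [dist_eq_norm] at this; exact this.le⟩

theorem norm_integral_le_const_mul {κ m : ℝ → ℝ} {s t ε : ℝ} (hst : s ≤ t)
    (hm : IntervalIntegrable m volume s t)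
    (h : ∀ q ∈ Ioc s t, |κ q| ≤ ε * m q) :
    |∫ q in s..t, κ q| ≤ ε * ∫ q in s..t, m q := by
  rw [← intervalIntegral.integral_const_mul, ← Real.norm_eq_abs]
  exact intervalIntegral.norm_integral_le_of_norm_le hst
    (ae_of_all _ fun q hq => h q hq) (hm.const_mul ε)

/-- Product rule for inner products of absolutely continuous functions. -/
theorem IsPrimitive.inner_sub_inner [CompleteSpace H] {X X' Y Y' : ℝ → H} {a b : ℝ} (hab : a ≤ b)
    (hX : IsPrimitive X X' a b) (hY : IsPrimitive Y Y' a b) :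
    inner ℝ (X b) (Y b) - inner ℝ (X a) (Y a)
      = ∫ s in a..b, (inner ℝ (X' s) (Y s) + inner ℝ (X s) (Y' s)) := by
  have i1 := hX.integrable.inner_continuousOn hab hY.continuousOn
  have i2 := hY.integrable.continuousOn_inner hab hX.continuousOn
  refine integral_eq_sub_of_local (φ := fun s => inner ℝ (X s) (Y s))
    (m := fun q => ‖X' q‖ + ‖Y' q‖) hab (i1.add i2)
    (hX.integrable.norm.add hY.integrable.norm) fun ε hε => ?_
  obtain ⟨δ₁, hδ₁, H₁⟩ := hX.continuousOn.exists_delta hε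
  obtain ⟨δ₂, hδ₂, H₂⟩ := hY.continuousOn.exists_delta hε
  refine ⟨min δ₁ δ₂, lt_min hδ₁ hδ₂, fun s t hs hst ht hd => ?_⟩
  have j1 := (hX.integrable_sub hs hst ht)
  have j2 := (hY.integrable_sub hs hst ht)
  have k1 : ∫ q in s..t, inner ℝ (Y t) (X' q) = inner ℝ (Y t) (X t - X s) := by
    rw [hX.sub_eq hs hst ht]
    exact ((innerSL ℝ (Y t)).intervalIntegral_comp_comm j1)
  have k2 : ∫ q in s..t, inner ℝ (X s) (Y' q) = inner ℝ (X s) (Y t - Y s) := by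
    rw [hY.sub_eq hs hst ht]
    exact ((innerSL ℝ (X s)).intervalIntegral_comp_comm j2)
  have hsub : Icc s t ⊆ Icc a b := Icc_subset_Icc hs ht
  have l1 := j1.inner_continuousOn hst (hY.continuousOn.mono hsub)
  have l2 := j2.continuousOn_inner hst (hX.continuousOn.mono hsub)
  have l3 := j1.continuousOn_inner hst (continuousOn_const (c := Y t))
  have l4 := j2.continuousOn_inner hst (continuousOn_const (c := X s))
  -- The increment is exactly the integral of ⟨Y t, X'⟩ + ⟨X s, Y'⟩, with one factor frozen at each
  -- endpoint. Replacing the frozen factors by their values at q costs ε(‖X'‖ + ‖Y'‖) by uniform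
  -- continuity, so differentiability almost everywhere is never needed.
  have e : inner ℝ (X t) (Y t) - inner ℝ (X s) (Y s)
        - ∫ q in s..t, (inner ℝ (X' q) (Y q) + inner ℝ (X q) (Y' q))
      = ∫ q in s..t, (inner ℝ (Y t) (X' q) + inner ℝ (X s) (Y' q)
        - (inner ℝ (X' q) (Y q) + inner ℝ (X q) (Y' q))) := by
    rw [intervalIntegral.integral_sub (l3.add l4) (l1.add l2),
      intervalIntegral.integral_add l3 l4, k1, k2]
    simp only [inner_sub_right, real_inner_comm]; ring
  rw [e]
  refine norm_integral_le_const_mul hst (j1.norm.add j2.norm) fun q hq => ?_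
  have hq' : q ∈ Icc a b := hsub (Ioc_subset_Icc_self hq)
  have hs' : s ∈ Icc a b := ⟨hs, hst.trans ht⟩
  have ht' : t ∈ Icc a b := ⟨hs.trans hst, ht⟩
  have b1 := H₁ s hs' q hq' (by
    rw [abs_sub_comm, abs_of_pos (sub_pos.2 hq.1)]
    linarith [hq.2, min_le_left δ₁ δ₂])
  have b2 := H₂ t ht' q hq' (by
    rw [abs_of_nonneg (sub_nonneg.2 hq.2)]; linarith [hq.1, min_le_right δ₁ δ₂])
  have e2 : inner ℝ (Y t) (X' q) + inner ℝ (X s) (Y' q)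
        - (inner ℝ (X' q) (Y q) + inner ℝ (X q) (Y' q))
      = inner ℝ (Y t - Y q) (X' q) + inner ℝ (X s - X q) (Y' q) := by
    simp only [inner_sub_left, real_inner_comm]; ring
  rw [e2]
  calc |inner ℝ (Y t - Y q) (X' q) + inner ℝ (X s - X q) (Y' q)|
      ≤ ‖Y t - Y q‖ * ‖X' q‖ + ‖X s - X q‖ * ‖Y' q‖ :=
        (abs_add_le _ _).trans (add_le_add (abs_real_inner_le_norm _ _)
          (abs_real_inner_le_norm _ _))
    _ ≤ ε * ‖X' q‖ + ε * ‖Y' q‖ := by gcongr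
    _ = ε * (‖X' q‖ + ‖Y' q‖) := by ring

/-- A family of operators which is strongly continuous on a compact interval is bounded. -/
theorem exists_norm_le_of_strongly_continuousOn {E F : Type*} [NormedAddCommGroup E]
    [NormedSpace ℝ E] [CompleteSpace E] [NormedAddCommGroup F] [NormedSpace ℝ F]
    {M : ℝ → E →L[ℝ] F} {a b : ℝ} (hM : ∀ x, ContinuousOn (fun t => M t x) (Icc a b)) :
    ∃ C, 0 ≤ C ∧ ∀ t ∈ Icc a b, ‖M t‖ ≤ C := by
  obtain ⟨C, hC⟩ := banach_steinhaus (g := fun t : Icc a b => M t) fun x => by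
    obtain ⟨C, hC⟩ := isCompact_Icc.exists_bound_of_continuousOn (hM x)
    exact ⟨C, fun t => hC t t.2⟩
  exact ⟨max C 0, le_max_right _ _, fun t ht => (hC ⟨t, ht⟩).trans (le_max_left _ _)⟩

/-- Split M(t')x' - M(t)x = M(t')(x' - x) + (M(t') - M(t))x: the uniform boundedness principle
controls the first term, strong continuity the second. -/
theorem continuousOn_uncurry_of_strongly_continuousOn {E F : Type*} [NormedAddCommGroup E]
    [NormedSpace ℝ E] [CompleteSpace E] [NormedAddCommGroup F] [NormedSpace ℝ F]
    {M : ℝ → E →L[ℝ] F} {a b : ℝ} (hM : ∀ x, ContinuousOn (fun t => M t x) (Icc a b)) :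
    ContinuousOn (fun p : ℝ × E => M p.1 p.2) (Icc a b ×ˢ univ) := by
  obtain ⟨C, hC0, hC⟩ := exists_norm_le_of_strongly_continuousOn hM
  rintro ⟨t, x⟩ ⟨ht, -⟩
  rw [ContinuousWithinAt, tendsto_iff_norm_sub_tendsto_zero]
  have h0 : Tendsto (fun p : ℝ × E => p.1) (𝓝[Icc a b ×ˢ univ] (t, x)) (𝓝[Icc a b] t) :=
    tendsto_nhdsWithin_iff.2 ⟨(continuous_fst.tendsto (t, x)).mono_left nhdsWithin_le_nhds,
      by filter_upwards [self_mem_nhdsWithin] with p hp using hp.1⟩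
  have h1 : Tendsto (fun p : ℝ × E => M p.1 x) (𝓝[Icc a b ×ˢ univ] (t, x)) (𝓝 (M t x)) :=
    (hM x t ht).tendsto.comp h0
  have h2 : Tendsto (fun p : ℝ × E => C * ‖p.2 - x‖ + ‖M p.1 x - M t x‖)
      (𝓝[Icc a b ×ˢ univ] (t, x)) (𝓝 0) := by
    have a1 : Tendsto (fun p : ℝ × E => C * ‖p.2 - x‖) (𝓝[Icc a b ×ˢ univ] (t, x)) (𝓝 0) := by
      have : Continuous fun p : ℝ × E => C * ‖p.2 - x‖ := by fun_prop
      have := (this.tendsto (t, x)).mono_left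
        (nhdsWithin_le_nhds (s := (Icc a b ×ˢ univ : Set (ℝ × E))))
      simpa using this
    have a2 := (tendsto_iff_norm_sub_tendsto_zero.1 h1)
    simpa using a1.add a2
  refine squeeze_zero' (Eventually.of_forall fun _ => norm_nonneg _) ?_ h2
  filter_upwards [self_mem_nhdsWithin] with p hp
  have : M p.1 p.2 - M t x = M p.1 (p.2 - x) + (M p.1 x - M t x) := by simp
  rw [this]
  refine (norm_add_le _ _).trans (add_le_add_left ?_ _)
  exact (M p.1).le_of_opNorm_le (hC _ hp.1) _

theorem _root_.ContinuousOn.strong_apply {E F α : Type*} [NormedAddCommGroup E]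
    [NormedSpace ℝ E] [CompleteSpace E] [NormedAddCommGroup F] [NormedSpace ℝ F]
    [TopologicalSpace α] {M : ℝ → E →L[ℝ] F} {a b : ℝ} {s : Set α}
    (hM : ∀ x, ContinuousOn (fun t => M t x) (Icc a b))
    {τ : α → ℝ} {X : α → E} (hτ : ContinuousOn τ s) (hτs : MapsTo τ s (Icc a b))
    (hX : ContinuousOn X s) : ContinuousOn (fun p => M (τ p) (X p)) s :=
  (continuousOn_uncurry_of_strongly_continuousOn hM).comp (hτ.prodMk hX) fun _ hp =>
    ⟨hτs hp, mem_univ _⟩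

theorem _root_.MeasureTheory.AEStronglyMeasurable.strong_apply {E F : Type*}
    [NormedAddCommGroup E]
    [NormedSpace ℝ E] [CompleteSpace E] [NormedAddCommGroup F] [NormedSpace ℝ F]
    {M : ℝ → E →L[ℝ] F} {a b : ℝ} (hab : a ≤ b)
    (hM : ∀ x, ContinuousOn (fun t => M t x) (Icc a b)) {X : ℝ → E}
    (hX : AEStronglyMeasurable X (volume.restrict (Ioc a b))) :
    AEStronglyMeasurable (fun t => M t (X t)) (volume.restrict (Ioc a b)) := by
  have hc : Continuous fun p : ℝ × E => M (projIcc a b hab p.1) p.2 := by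
    rw [← continuousOn_univ]
    exact ContinuousOn.strong_apply hM
      (continuous_subtype_val.comp (continuous_projIcc.comp continuous_fst)).continuousOn
      (fun p _ => (projIcc a b hab p.1).2) continuous_snd.continuousOn
  refine (hc.comp_aestronglyMeasurable
    (aestronglyMeasurable_id.prodMk hX)).congr ?_
  refine (ae_restrict_iff' measurableSet_Ioc).2 (ae_of_all _ fun t ht => ?_)
  simp [projIcc_of_mem hab (Ioc_subset_Icc_self ht)]

/-- Product rule for a quadratic form with differentiable coefficients, along an absolutely
continuous function. -/
theorem IsPrimitive.quadratic_sub_quadratic [CompleteSpace H] {X X' : ℝ → H} {a b : ℝ}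
    (hab : a ≤ b) (hX : IsPrimitive X X' a b) {M : ℝ → H →L[ℝ] H}
    (hM : ∀ x, ContinuousOn (fun t => M t x) (Icc a b))
    (hsymm : ∀ t ∈ Icc a b, ∀ x y, inner ℝ (M t x) y = inner ℝ x (M t y))
    {D : ℝ → H → ℝ}
    (hD : ∀ z, ∀ t ∈ Icc a b, HasDerivWithinAt (fun s => inner ℝ (M s z) z) (D t z) (Icc a b) t)
    (hDc : ContinuousOn (fun p : ℝ × ℝ => D p.1 (X p.2)) (Icc a b ×ˢ Icc a b)) :
    inner ℝ (M b (X b)) (X b) - inner ℝ (M a (X a)) (X a)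
      = ∫ s in a..b, (2 * inner ℝ (X' s) (M s (X s)) + D s (X s)) := by
  have hXc := hX.continuousOn
  have hMX : ContinuousOn (fun p : ℝ × ℝ => M p.1 (X p.2)) (Icc a b ×ˢ Icc a b) :=
    ContinuousOn.strong_apply hM continuousOn_fst (fun p hp => hp.1)
      (hXc.comp continuousOn_snd fun p hp => hp.2)
  have hdiag : MapsTo (fun s : ℝ => (s, s)) (Icc a b) (Icc a b ×ˢ Icc a b) := fun s hs => ⟨hs, hs⟩
  have hdc : Continuous fun s : ℝ => (s, s) := by fun_prop
  have hMd : ContinuousOn (fun s => M s (X s)) (Icc a b) := hMX.comp hdc.continuousOn hdiag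
  have hDd : ContinuousOn (fun s => D s (X s)) (Icc a b) := hDc.comp hdc.continuousOn hdiag
  have hcomp : IsCompact (Icc a b ×ˢ Icc a b : Set (ℝ × ℝ)) := isCompact_Icc.prod isCompact_Icc
  have iM := (hX.integrable.inner_continuousOn hab hMd).const_mul 2
  have iD : IntervalIntegrable (fun s => D s (X s)) volume a b :=
    ContinuousOn.intervalIntegrable (by rwa [uIcc_of_le hab])
  refine integral_eq_sub_of_local (φ := fun s => inner ℝ (M s (X s)) (X s))
    (m := fun q => 2 * ‖X' q‖ + 1) hab (iM.add iD)
    ((hX.integrable.norm.const_mul 2).add (_root_.intervalIntegrable_const))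
    fun ε hε => ?_
  obtain ⟨δ₁, hδ₁, H₁⟩ := Metric.uniformContinuousOn_iff.1
    (hcomp.uniformContinuousOn_of_continuous hMX) ε hε
  obtain ⟨δ₂, hδ₂, H₂⟩ := Metric.uniformContinuousOn_iff.1
    (hcomp.uniformContinuousOn_of_continuous hDc) ε hε
  refine ⟨min δ₁ δ₂, lt_min hδ₁ hδ₂, fun s t hs hst ht hd => ?_⟩
  have hsub : Icc s t ⊆ Icc a b := Icc_subset_Icc hs ht
  have hs' : s ∈ Icc a b := ⟨hs, hst.trans ht⟩
  have ht' : t ∈ Icc a b := ⟨hs.trans hst, ht⟩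
  have j1 := hX.integrable_sub hs hst ht
  -- By symmetry, ⟨M_t X_t, X_t⟩ - ⟨M_t X_s, X_s⟩ = ⟨w, X_t - X_s⟩. What is left of the increment is
  -- the change of M in time at the frozen vector X_s, which is the integral of D(·, X_s).
  set w : H := M t (X t) + M t (X s) with hw
  have k1 : ∫ q in s..t, inner ℝ w (X' q) = inner ℝ w (X t - X s) := by
    rw [hX.sub_eq hs hst ht]
    exact (innerSL ℝ w).intervalIntegral_comp_comm j1
  have hDs : ContinuousOn (fun q => D q (X s)) (Icc s t) :=
    hDc.comp (f := fun q : ℝ => (q, s)) (by fun_prop) fun q hq => ⟨hsub hq, hs'⟩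
  have l2 : IntervalIntegrable (fun q => D q (X s)) volume s t :=
    ContinuousOn.intervalIntegrable (by rwa [uIcc_of_le hst])
  have k2 : ∫ q in s..t, D q (X s) = inner ℝ (M t (X s)) (X s) - inner ℝ (M s (X s)) (X s) := by
    refine intervalIntegral.integral_eq_sub_of_hasDerivAt_of_le
      (f := fun q => inner ℝ (M q (X s)) (X s)) hst ?_ (fun q hq => ?_) l2
    · exact ((hM (X s)).mono hsub).inner continuousOn_const
    · have hq' : q ∈ Ioo a b := ⟨hs.trans_lt hq.1, hq.2.trans_le ht⟩
      exact (hD (X s) q (Ioo_subset_Icc_self hq')).hasDerivAt (Icc_mem_nhds hq'.1 hq'.2)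
  have l1 := j1.continuousOn_inner hst (continuousOn_const (c := w))
  have l3 := (j1.inner_continuousOn hst (hMd.mono hsub)).const_mul 2
  have l4 : IntervalIntegrable (fun q => D q (X q)) volume s t :=
    ContinuousOn.intervalIntegrable (by rw [uIcc_of_le hst]; exact hDd.mono hsub)
  have e : inner ℝ (M t (X t)) (X t) - inner ℝ (M s (X s)) (X s)
        - ∫ q in s..t, (2 * inner ℝ (X' q) (M q (X q)) + D q (X q))
      = ∫ q in s..t, (inner ℝ w (X' q) + D q (X s)
        - (2 * inner ℝ (X' q) (M q (X q)) + D q (X q))) := by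
    rw [intervalIntegral.integral_sub (l1.add l2) (l3.add l4),
      intervalIntegral.integral_add l1 l2, k1, k2, hw]
    have := hsymm t ht' (X s) (X t)
    have h2 := hsymm t ht' (X s) (X s)
    simp only [inner_sub_right, inner_add_left]
    rw [this, real_inner_comm (M t (X t)) (X s)]
    ring
  rw [e]
  refine norm_integral_le_const_mul hst ((j1.norm.const_mul 2).add
    _root_.intervalIntegrable_const) fun q hq => ?_
  have hq' : q ∈ Icc a b := hsub (Ioc_subset_Icc_self hq)
  have d1 : dist t q < min δ₁ δ₂ := by
    rw [Real.dist_eq, abs_of_nonneg (sub_nonneg.2 hq.2)]; linarith [hq.1]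
  have d2 : dist s q < min δ₁ δ₂ := by
    rw [Real.dist_eq, abs_sub_comm, abs_of_pos (sub_pos.2 hq.1)]; linarith [hq.2]
  have b1 := (H₁ (t, t) ⟨ht', ht'⟩ (q, q) ⟨hq', hq'⟩
    (by rw [Prod.dist_eq]; exact max_lt (d1.trans_le (min_le_left _ _))
          (d1.trans_le (min_le_left _ _)))).le
  have b2 := (H₁ (t, s) ⟨ht', hs'⟩ (q, q) ⟨hq', hq'⟩
    (by rw [Prod.dist_eq]; exact max_lt (d1.trans_le (min_le_left _ _))
          (d2.trans_le (min_le_left _ _)))).le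
  have b3 := (H₂ (q, s) ⟨hq', hs'⟩ (q, q) ⟨hq', hq'⟩
    (by rw [Prod.dist_eq, dist_self]; exact max_lt (lt_min hδ₁ hδ₂ |>.trans_le (min_le_right _ _))
          (d2.trans_le (min_le_right _ _)))).le
  rw [dist_eq_norm] at b1 b2 b3
  simp only at b1 b2 b3
  have e2 : inner ℝ w (X' q) + D q (X s) - (2 * inner ℝ (X' q) (M q (X q)) + D q (X q))
      = inner ℝ (M t (X t) - M q (X q)) (X' q) + inner ℝ (M t (X s) - M q (X q)) (X' q)
        + (D q (X s) - D q (X q)) := by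
    rw [hw, real_inner_comm (M q (X q)) (X' q)]
    simp only [inner_sub_left, inner_add_left]; ring
  rw [e2]
  calc |inner ℝ (M t (X t) - M q (X q)) (X' q) + inner ℝ (M t (X s) - M q (X q)) (X' q)
        + (D q (X s) - D q (X q))|
      ≤ ‖M t (X t) - M q (X q)‖ * ‖X' q‖ + ‖M t (X s) - M q (X q)‖ * ‖X' q‖
        + ‖D q (X s) - D q (X q)‖ :=
        (abs_add_le _ _).trans (add_le_add ((abs_add_le _ _).trans
          (add_le_add (abs_real_inner_le_norm _ _) (abs_real_inner_le_norm _ _))) le_rfl)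
    _ ≤ ε * ‖X' q‖ + ε * ‖X' q‖ + ε := by gcongr
    _ = ε * (2 * ‖X' q‖ + 1) := by ring

/-- Grönwall's inequality in integral form. -/
theorem le_mul_exp_of_le_add_mul_integral {ψ : ℝ → ℝ} {a b c K : ℝ} (hK : 0 ≤ K) (hab : a ≤ b)
    (hψ : ContinuousOn ψ (Icc a b)) (h : ∀ t ∈ Icc a b, ψ t ≤ c + K * ∫ s in a..t, ψ s) :
    ψ b ≤ c * Real.exp (K * (b - a)) := by
  -- The constant extension beyond [a, b] makes the primitive of ψ differentiable at every point,
  -- endpoints included.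
  set ψ' : ℝ → ℝ := IccExtend hab ((Icc a b).domRestrict ψ) with hψ'
  have hc : Continuous ψ' := hψ.domRestrict.Icc_extend'
  have heq : ∀ t ∈ Icc a b, ψ' t = ψ t := fun t ht => by
    rw [hψ', IccExtend_of_mem hab _ ht]; rfl
  have hint : ∀ t ∈ Icc a b, ∫ s in a..t, ψ s = ∫ s in a..t, ψ' s := fun t ht => by
    refine intervalIntegral.integral_congr fun s hs => (heq s ?_).symm
    rw [uIcc_of_le ht.1] at hs
    exact ⟨hs.1, hs.2.trans ht.2⟩
  set R : ℝ → ℝ := fun t => ∫ s in a..t, ψ' s with hR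
  have hRd : ∀ t, HasDerivAt R (ψ' t) t := fun t => hc.integral_hasStrictDerivAt a t |>.hasDerivAt
  have hb : b ∈ Icc a b := ⟨hab, le_rfl⟩
  have hle : ∀ t ∈ Icc a b, ψ' t ≤ K * R t + c := fun t ht => by
    have := h t ht
    rw [hint t ht] at this; rw [heq t ht]; linarith
  have hg := le_gronwallBound_of_liminf_deriv_right_le (f := R) (f' := ψ') (δ := 0) (K := K)
    (ε := c) (a := a) (b := b) (fun t _ => (hRd t).continuousAt.continuousWithinAt)
    (fun t _ r hr => (hRd t).hasDerivWithinAt.liminf_right_slope_le hr) (by simp [hR])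
    (fun t ht => hle t (Ico_subset_Icc_self ht)) b hb
  have h1 := hle b hb
  rw [heq b hb] at h1
  -- The closed form of the Grönwall bound divides by K.
  rcases hK.eq_or_lt with rfl | hK
  · simpa using h1
  · rw [gronwallBound_of_K_ne_0 hK.ne'] at hg
    have : K * R b ≤ c * (Real.exp (K * (b - a)) - 1) := by
      calc K * R b ≤ K * (0 * Real.exp (K * (b - a)) + c / K * (Real.exp (K * (b - a)) - 1)) :=
            mul_le_mul_of_nonneg_left hg hK.le
        _ = _ := by field_simp; ring
    linarith

/-- Energy estimate for an absolutely continuous function. -/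
theorem IsPrimitive.norm_sq_le [CompleteSpace H] {X X' : ℝ → H} {γ : ℝ → ℝ} {a b K : ℝ}
    (hK : 0 ≤ K) (hab : a ≤ b)
    (hX : IsPrimitive X X' a b) (hγ : IntervalIntegrable γ volume a b)
    (hγ0 : ∀ s, 0 ≤ γ s)
    (h : ∀ᵐ s, s ∈ Ioc a b → 2 * inner ℝ (X' s) (X s) ≤ K * ‖X s‖ ^ 2 + γ s) :
    ‖X b‖ ^ 2 ≤ Real.exp (K * (b - a)) * (‖X a‖ ^ 2 + ∫ s in a..b, γ s) := by
  rw [mul_comm]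
  have hc : ContinuousOn (fun t => ‖X t‖ ^ 2) (Icc a b) := hX.continuousOn.norm.pow 2
  refine le_mul_exp_of_le_add_mul_integral (ψ := fun t => ‖X t‖ ^ 2) hK hab hc fun t ht => ?_
  have hXt := hX.mono le_rfl ht.1 ht.2
  have e := hXt.inner_sub_inner ht.1 hXt
  have hsub : Icc a t ⊆ Icc a b := Icc_subset_Icc le_rfl ht.2
  have i1 : IntervalIntegrable (fun s => ‖X s‖ ^ 2) volume a t :=
    ContinuousOn.intervalIntegrable (by rw [uIcc_of_le ht.1]; exact hc.mono hsub)
  have i2 : IntervalIntegrable γ volume a t := hγ.mono_set (by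
    rw [uIcc_of_le ht.1, uIcc_of_le hab]; exact hsub)
  have i3 : IntervalIntegrable γ volume t b := hγ.mono_set (by
    rw [uIcc_of_le ht.2, uIcc_of_le hab]; exact Icc_subset_Icc ht.1 le_rfl)
  have e2 : ∫ s in a..t, (inner ℝ (X' s) (X s) + inner ℝ (X s) (X' s))
      ≤ ∫ s in a..t, (K * ‖X s‖ ^ 2 + γ s) := by
    refine intervalIntegral.integral_mono_ae_restrict ht.1
      ((hXt.integrable.inner_continuousOn ht.1 hXt.continuousOn).add
        (hXt.integrable.continuousOn_inner ht.1 hXt.continuousOn)) ((i1.const_mul K).add i2) ?_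
    rw [← restrict_Ioc_eq_restrict_Icc]
    refine (ae_restrict_iff' measurableSet_Ioc).2 ?_
    filter_upwards [h] with s hs hst
    have := hs ⟨hst.1, hst.2.trans ht.2⟩
    rw [real_inner_comm (X' s) (X s)]; linarith
  rw [intervalIntegral.integral_add (i1.const_mul K) i2, intervalIntegral.integral_const_mul] at e2
  have e3 : ∫ s in a..b, γ s = (∫ s in a..t, γ s) + ∫ s in t..b, γ s :=
    (intervalIntegral.integral_add_adjacent_intervals i2 i3).symm
  have e4 : 0 ≤ ∫ s in t..b, γ s := intervalIntegral.integral_nonneg ht.2 fun s _ => hγ0 s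
  simp only [real_inner_self_eq_norm_sq] at e
  linarith

end Inner

end

/-! ### Square-integrable functions, resolvent families, mild solutions and their energy estimate -/

section

section SquareIntegrable

variable {E F : Type*} [NormedAddCommGroup E] [NormedAddCommGroup F]

/-- Square integrability on the interval `(a, b]`. -/
abbrev MemL2 (f : ℝ → E) (a b : ℝ) : Prop := MemLp f 2 (volume.restrict (Ioc a b))

theorem MemL2.mono {f : ℝ → E} {a b s t : ℝ} (hf : MemL2 f a b) (hs : a ≤ s) (ht : t ≤ b) :
    MemL2 f s t :=
  hf.mono_measure (Measure.restrict_mono (Ioc_subset_Ioc hs ht) le_rfl)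

theorem MemL2.intervalIntegrable {f : ℝ → E} {a b : ℝ} (hab : a ≤ b) (hf : MemL2 f a b) :
    IntervalIntegrable f volume a b :=
  (intervalIntegrable_iff_integrableOn_Ioc_of_le hab).2 (hf.integrable (by norm_num))

theorem MemL2.intervalIntegrable_norm_sq {f : ℝ → E} {a b : ℝ} (hab : a ≤ b)
    (hf : MemL2 f a b) : IntervalIntegrable (fun s => ‖f s‖ ^ 2) volume a b :=
  (intervalIntegrable_iff_integrableOn_Ioc_of_le hab).2
    ((memLp_two_iff_integrable_sq_norm hf.1).1 hf)

theorem _root_.ContinuousOn.memL2 {f : ℝ → E} {a b : ℝ} (hf : ContinuousOn f (Icc a b)) :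
    MemL2 f a b := by
  obtain ⟨C, hC⟩ := isCompact_Icc.exists_bound_of_continuousOn hf
  refine MemLp.of_bound
    ((hf.mono Ioc_subset_Icc_self).aestronglyMeasurable measurableSet_Ioc) C ?_
  exact (ae_restrict_iff' measurableSet_Ioc).2
    (ae_of_all _ fun s hs => hC s (Ioc_subset_Icc_self hs))

theorem MemL2.sub {f g : ℝ → E} {a b : ℝ} (hf : MemL2 f a b) (hg : MemL2 g a b) :
    MemL2 (fun s => f s - g s) a b := MemLp.sub hf hg

theorem MemL2.add {f g : ℝ → E} {a b : ℝ} (hf : MemL2 f a b) (hg : MemL2 g a b) :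
    MemL2 (fun s => f s + g s) a b := MemLp.add hf hg

theorem MemL2.clm [NormedSpace ℝ E] [NormedSpace ℝ F] {f : ℝ → E} {a b : ℝ} (hf : MemL2 f a b) (L : E →L[ℝ] F) :
    MemL2 (fun s => L (f s)) a b := L.comp_memLp' hf

theorem MemL2.strong_apply [NormedSpace ℝ E] [NormedSpace ℝ F] [CompleteSpace E] {M : ℝ → E →L[ℝ] F} {f : ℝ → E} {a b : ℝ}
    (hab : a ≤ b) (hM : ∀ x, ContinuousOn (fun t => M t x) (Icc a b)) (hf : MemL2 f a b) :
    MemL2 (fun s => M s (f s)) a b := by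
  obtain ⟨C, -, hC⟩ := exists_norm_le_of_strongly_continuousOn hM
  refine MemLp.of_le_mul (c := C) hf (hf.1.strong_apply hab hM) ?_
  exact (ae_restrict_iff' measurableSet_Ioc).2
    (ae_of_all _ fun s hs => (M s).le_of_opNorm_le (hC s (Ioc_subset_Icc_self hs)) _)

theorem integral_norm_sq_mono {f : ℝ → E} {a b t : ℝ} (hf : MemL2 f a b) (ht : t ∈ Icc a b) :
    ∫ s in a..t, ‖f s‖ ^ 2 ≤ ∫ s in a..b, ‖f s‖ ^ 2 :=
  intervalIntegral.integral_mono_interval le_rfl ht.1 ht.2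
    (ae_of_all _ fun _ => by positivity) (hf.intervalIntegrable_norm_sq (ht.1.trans ht.2))

theorem integral_norm_sq_nonneg (f : ℝ → E) {a b : ℝ} (hab : a ≤ b) :
    0 ≤ ∫ s in a..b, ‖f s‖ ^ 2 :=
  intervalIntegral.integral_nonneg hab fun _ _ => by positivity

theorem integral_norm_sq_le_of_norm_le {f : ℝ → E} {g : ℝ → F} {a b c : ℝ} (hab : a ≤ b)
    (hf : MemL2 f a b) (hg : MemL2 g a b)
    (h : ∀ s ∈ Ioc a b, ‖f s‖ ≤ c * ‖g s‖) :
    ∫ s in a..b, ‖f s‖ ^ 2 ≤ c ^ 2 * ∫ s in a..b, ‖g s‖ ^ 2 := by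
  rw [← intervalIntegral.integral_const_mul]
  refine intervalIntegral.integral_mono_on_of_le_Ioo hab (hf.intervalIntegrable_norm_sq hab)
    ((hg.intervalIntegrable_norm_sq hab).const_mul _) fun s hs => ?_
  rw [← mul_pow]
  exact pow_le_pow_left₀ (norm_nonneg _) (h s (Ioo_subset_Ioc_self hs)) 2

theorem integral_norm_sq_sub_le {f g h : ℝ → E} {a b : ℝ} (hab : a ≤ b)
    (hf : MemL2 f a b) (hg : MemL2 g a b) (hh : MemL2 h a b) :
    ∫ s in a..b, ‖f s - g s‖ ^ 2
      ≤ 2 * (∫ s in a..b, ‖f s - h s‖ ^ 2) + 2 * ∫ s in a..b, ‖g s - h s‖ ^ 2 := by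
  have i1 := (hf.sub hh).intervalIntegrable_norm_sq hab
  have i2 := (hg.sub hh).intervalIntegrable_norm_sq hab
  have i3 := (hf.sub hg).intervalIntegrable_norm_sq hab
  rw [← intervalIntegral.integral_const_mul, ← intervalIntegral.integral_const_mul,
    ← intervalIntegral.integral_add (i1.const_mul 2) (i2.const_mul 2)]
  refine intervalIntegral.integral_mono_on hab i3 ((i1.const_mul 2).add (i2.const_mul 2))
    fun s _ => ?_
  have : ‖f s - g s‖ ≤ ‖f s - h s‖ + ‖g s - h s‖ := by
    rw [norm_sub_rev (g s)]; simpa using norm_add_le (f s - h s) (h s - g s)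
  nlinarith [norm_nonneg (f s - g s), sq_nonneg (‖f s - h s‖ - ‖g s - h s‖)]

/-- The Cauchy–Schwarz inequality against constants. -/
theorem sq_integral_le {f : ℝ → ℝ} {a b : ℝ} (hab : a ≤ b) (hf : MemL2 f a b) :
    (∫ s in a..b, f s) ^ 2 ≤ (b - a) * ∫ s in a..b, ‖f s‖ ^ 2 := by
  rcases hab.eq_or_lt with rfl | hlt
  · simp
  set I := ∫ s in a..b, f s with hI
  set L := b - a with hL
  have hLpos : 0 < L := sub_pos.2 hlt
  have i1 := hf.intervalIntegrable hab
  have i2 := hf.intervalIntegrable_norm_sq hab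
  -- The integrand is (L f - I)²; its integral equals L (L ∫ f² - I²).
  have h0 : 0 ≤ ∫ s in a..b, (L ^ 2 * ‖f s‖ ^ 2 - 2 * L * I * f s + I ^ 2) := by
    refine intervalIntegral.integral_nonneg hab fun s _ => ?_
    rw [Real.norm_eq_abs, sq_abs]
    nlinarith [sq_nonneg (L * f s - I)]
  rw [intervalIntegral.integral_add ((i2.const_mul _).sub (i1.const_mul _))
    _root_.intervalIntegrable_const, intervalIntegral.integral_sub (i2.const_mul _)
    (i1.const_mul _), intervalIntegral.integral_const_mul, intervalIntegral.integral_const_mul,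
    intervalIntegral.integral_const, ← hI, ← hL, smul_eq_mul] at h0
  have : 0 ≤ L * (L * (∫ s in a..b, ‖f s‖ ^ 2) - I ^ 2) := by nlinarith
  linarith [nonneg_of_mul_nonneg_right this hLpos]

/-- Energy estimates give convergence in L², whereas limits of primitives require it in L¹; on a
bounded interval Cauchy–Schwarz passes from one to the other. -/
theorem tendsto_integral_norm_of_sq {ι : Type*} {l : Filter ι} {f : ι → ℝ → E} {a b : ℝ}
    (hab : a ≤ b) (hf : ∀ i, MemL2 (f i) a b)
    (h : Tendsto (fun i => ∫ s in a..b, ‖f i s‖ ^ 2) l (𝓝 0)) :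
    Tendsto (fun i => ∫ s in a..b, ‖f i s‖) l (𝓝 0) := by
  have h1 : Tendsto (fun i => Real.sqrt ((b - a) * ∫ s in a..b, ‖f i s‖ ^ 2)) l (𝓝 0) := by
    have := (h.const_mul (b - a)).sqrt
    simpa using this
  refine squeeze_zero (fun i => intervalIntegral.integral_nonneg hab fun _ _ => norm_nonneg _)
    (fun i => ?_) h1
  refine Real.le_sqrt_of_sq_le ?_
  simpa using sq_integral_le hab (hf i).norm

end SquareIntegrable

section Limits

variable {E : Type*} [NormedAddCommGroup E]

theorem IsPrimitive.of_tendsto [NormedSpace ℝ E] [CompleteSpace E] {ι : Type*} {l : Filter ι} [l.NeBot]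
    {X X' : ι → ℝ → E}
    {Y Y' : ℝ → E} {a b : ℝ} (h : ∀ i, IsPrimitive (X i) (X' i) a b)
    (hY' : IntervalIntegrable Y' volume a b)
    (hX : ∀ t ∈ Icc a b, Tendsto (fun i => X i t) l (𝓝 (Y t)))
    (hX' : Tendsto (fun i => ∫ s in a..b, ‖X' i s - Y' s‖) l (𝓝 0)) : IsPrimitive Y Y' a b := by
  refine ⟨hY', fun t ht => ?_⟩
  have hab := ht.1.trans ht.2
  refine tendsto_nhds_unique (hX t ht) ?_
  have : Tendsto (fun i => X i a + ∫ s in a..t, X' i s) l (𝓝 (Y a + ∫ s in a..t, Y' s)) := by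
    refine (hX a ⟨le_rfl, hab⟩).add ?_
    rw [tendsto_iff_norm_sub_tendsto_zero]
    refine squeeze_zero (fun _ => norm_nonneg _) (fun i => ?_) hX'
    have i1 := (h i).integrable_sub le_rfl ht.1 ht.2
    have i2 : IntervalIntegrable Y' volume a t := hY'.mono_set (by
      rw [uIcc_of_le ht.1, uIcc_of_le hab]; exact Icc_subset_Icc le_rfl ht.2)
    rw [← intervalIntegral.integral_sub i1 i2]
    refine (intervalIntegral.norm_integral_le_integral_norm ht.1).trans ?_
    exact intervalIntegral.integral_mono_interval le_rfl ht.1 ht.2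
      (ae_of_all _ fun _ => norm_nonneg _) ((h i).integrable.sub hY').norm
  exact this.congr fun i => ((h i).eq t ht).symm

/-- The form ε_j + ε_k is what the energy estimate yields when two approximations are compared
through a common limit; it is a uniform Cauchy criterion. -/
theorem exists_tendstoUniformlyOn_of_sq_le [CompleteSpace E] {y : ℕ → ℝ → E} {s : Set ℝ}
    {ε : ℕ → ℝ}
    (hε : Tendsto ε atTop (𝓝 0)) (hy : ∀ k, ContinuousOn (y k) s)
    (h : ∀ j k, ∀ t ∈ s, ‖y j t - y k t‖ ^ 2 ≤ ε j + ε k) :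
    ∃ Y : ℝ → E, ContinuousOn Y s ∧ TendstoUniformlyOn y Y atTop s := by
  have hC : UniformCauchySeqOn y atTop s := by
    rw [Metric.uniformCauchySeqOn_iff]
    intro δ hδ
    obtain ⟨N, hN⟩ := (eventually_atTop.1 (hε.eventually_lt_const (show 0 < δ ^ 2 / 2 by positivity)))
    refine ⟨N, fun m hm n hn t ht => ?_⟩
    rw [dist_eq_norm]
    refine lt_of_pow_lt_pow_left₀ 2 hδ.le ?_
    linarith [h m n t ht, hN m hm, hN n hn]
  have hp : ∀ t ∈ s, ∃ x, Tendsto (fun k => y k t) atTop (𝓝 x) := fun t ht =>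
    cauchySeq_tendsto_of_complete (hC.cauchySeq ht)
  choose! Y hY using hp
  have hU : TendstoUniformlyOn y Y atTop s := hC.tendstoUniformlyOn_of_tendsto hY
  exact ⟨Y, hU.continuousOn (Frequently.of_forall hy), hU⟩

theorem tendsto_integral_norm_sq_of_uniform {ι : Type*} {l : Filter ι} {f : ι → ℝ → E}
    {a b : ℝ} (hab : a ≤ b) (h : TendstoUniformlyOn f 0 l (Icc a b)) :
    Tendsto (fun i => ∫ s in a..b, ‖f i s‖ ^ 2) l (𝓝 0) := by
  rw [Metric.tendsto_nhds]
  intro ε hε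
  have hL : 0 < b - a + 1 := by linarith
  set δ := Real.sqrt (ε / (b - a + 1)) with hδ
  have hδ0 : 0 < δ := Real.sqrt_pos.2 (by positivity)
  filter_upwards [Metric.tendstoUniformlyOn_iff.1 h δ hδ0] with i hi
  rw [Real.dist_eq, sub_zero]
  have := intervalIntegral.norm_integral_le_of_norm_le_const (a := a) (b := b)
    (f := fun s => ‖f i s‖ ^ 2) (C := ε / (b - a + 1)) fun s hs => by
      rw [uIoc_of_le hab] at hs
      have := hi s (Ioc_subset_Icc_self hs)
      rw [Pi.zero_apply, dist_zero_left] at this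
      rw [norm_pow, norm_norm, ← Real.sq_sqrt (show 0 ≤ ε / (b - a + 1) by positivity)]
      exact pow_le_pow_left₀ (norm_nonneg _) this.le 2
  rw [Real.norm_eq_abs] at this
  refine this.trans_lt ?_
  rw [abs_of_nonneg (by linarith : (0:ℝ) ≤ b - a), div_mul_eq_mul_div, div_lt_iff₀ hL]
  nlinarith

end Limits

variable {H : Type*} [NormedAddCommGroup H] [InnerProductSpace ℝ H]

/-- The Yosida approximation `A_μ = μ⁻¹ (J_μ - 1)` belonging to the resolvents
`J_μ = (1 - μ A)⁻¹`. -/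
def yosida (J : ℝ → H →L[ℝ] H) (μ : ℝ) : H →L[ℝ] H := μ⁻¹ • (J μ - 1)

theorem yosida_apply (J : ℝ → H →L[ℝ] H) (μ : ℝ) (x : H) :
    yosida J μ x = μ⁻¹ • (J μ x - x) := by simp [yosida]

/-- `J` is the family of resolvents `J_μ = (1 - μ A)⁻¹`, `0 < μ < μ₀`, of a densely defined
operator `A` with `⟨A x, x⟩ ≤ ρ ‖x‖²`. -/
structure IsResolventFamily (J : ℝ → H →L[ℝ] H) (ρ μ₀ : ℝ) : Prop where
  nonneg : 0 ≤ ρ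
  pos : 0 < μ₀
  norm_le : ∀ μ ∈ Ioo 0 μ₀, ‖J μ‖ ≤ 2
  inner_le : ∀ μ ∈ Ioo 0 μ₀, ∀ x, inner ℝ (yosida J μ x) (J μ x) ≤ ρ * ‖J μ x‖ ^ 2
  resolvent : ∀ μ ∈ Ioo 0 μ₀, ∀ τ ∈ Ioo 0 μ₀, ∀ x, J μ (yosida J τ x) = yosida J μ (J τ x)
  tendsto : ∀ x, Tendsto (fun μ => J μ x) (𝓝[>] 0) (𝓝 x)

/-- `y` is a mild solution of `y' = A y + F` on `[a, b]`. -/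
structure IsMild (J : ℝ → H →L[ℝ] H) (μ₀ : ℝ) (F y : ℝ → H) (a b : ℝ) : Prop where
  continuousOn : ContinuousOn y (Icc a b)
  primitive : ∀ μ ∈ Ioo 0 μ₀,
    IsPrimitive (fun t => J μ (y t)) (fun t => yosida J μ (y t) + J μ (F t)) a b

theorem IsMild.mono {J : ℝ → H →L[ℝ] H} {μ₀ : ℝ} {F y : ℝ → H} {a b s t : ℝ}
    (h : IsMild J μ₀ F y a b) (hs : a ≤ s) (hst : s ≤ t) (ht : t ≤ b) : IsMild J μ₀ F y s t :=
  ⟨h.continuousOn.mono (Icc_subset_Icc hs ht), fun μ hμ => (h.primitive μ hμ).mono hs hst ht⟩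

theorem IsMild.sub {J : ℝ → H →L[ℝ] H} {μ₀ : ℝ} {F y G z : ℝ → H} {a b : ℝ} (hab : a ≤ b)
    (h : IsMild J μ₀ F y a b) (h' : IsMild J μ₀ G z a b) :
    IsMild J μ₀ (fun t => F t - G t) (fun t => y t - z t) a b :=
  ⟨h.continuousOn.sub h'.continuousOn, fun μ hμ =>
    ((h.primitive μ hμ).sub (h'.primitive μ hμ)).congr hab (fun t _ => by simp)
      (ae_of_all _ fun t _ => by simp only [map_sub]; abel)⟩

theorem IsMild.congr {J : ℝ → H →L[ℝ] H} {μ₀ : ℝ} {F y G : ℝ → H} {a b : ℝ} (hab : a ≤ b)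
    (h : IsMild J μ₀ F y a b) (hG : ∀ᵐ t, t ∈ Ioc a b → F t = G t) :
    IsMild J μ₀ G y a b :=
  ⟨h.continuousOn, fun μ hμ => (h.primitive μ hμ).congr hab (fun _ _ => rfl) (by
    filter_upwards [hG] with t ht hts
    rw [ht hts])⟩

/-- The constant in the energy estimate for mild solutions. -/
def energyConst (ρ L : ℝ) : ℝ := 4 * Real.exp ((8 * ρ + 1) * L)

theorem energyConst_pos (ρ L : ℝ) : 0 < energyConst ρ L := by unfold energyConst; positivity

namespace IsResolventFamily

variable {J : ℝ → H →L[ℝ] H} {ρ μ₀ : ℝ} (hJ : IsResolventFamily J ρ μ₀)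
include hJ

/-- Expanding J_μ A_τ = A_μ J_τ gives the resolvent identity (τ⁻¹ - μ⁻¹) J_μ J_τ = τ⁻¹ J_μ - μ⁻¹
J_τ. Exchanging μ and τ leads to the same right-hand side for J_τ J_μ. -/
theorem comm {μ τ : ℝ} (hμ : μ ∈ Ioo 0 μ₀) (hτ : τ ∈ Ioo 0 μ₀) (x : H) :
    J μ (J τ x) = J τ (J μ x) := by
  rcases eq_or_ne μ τ with rfl | hne
  · rfl
  have h1 := hJ.resolvent μ hμ τ hτ x
  have h2 := hJ.resolvent τ hτ μ hμ x
  have hμ0 : μ ≠ 0 := hμ.1.ne'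
  have hτ0 : τ ≠ 0 := hτ.1.ne'
  simp only [yosida_apply, map_smul, map_sub] at h1 h2
  have h3 : (τ⁻¹ - μ⁻¹) • (J μ (J τ x)) = (τ⁻¹ - μ⁻¹) • (J τ (J μ x)) := by
    have e1 : (τ⁻¹ - μ⁻¹) • (J μ (J τ x)) = τ⁻¹ • J μ x - μ⁻¹ • J τ x := by
      rw [sub_smul]; rw [smul_sub, smul_sub] at h1
      linear_combination (norm := module) h1
    have e2 : (τ⁻¹ - μ⁻¹) • (J τ (J μ x)) = τ⁻¹ • J μ x - μ⁻¹ • J τ x := by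
      rw [sub_smul]; rw [smul_sub, smul_sub] at h2
      linear_combination (norm := module) (-1 : ℝ) • h2
    rw [e1, e2]
  exact (smul_right_injective H (sub_ne_zero.2 fun h => hne (inv_injective h).symm)) h3

theorem yosida_comm {μ τ : ℝ} (hμ : μ ∈ Ioo 0 μ₀) (hτ : τ ∈ Ioo 0 μ₀) (x : H) :
    yosida J μ (yosida J τ x) = yosida J τ (yosida J μ x) := by
  simp only [yosida_apply, map_smul, map_sub, hJ.comm hμ hτ, smul_sub, smul_smul,
    mul_comm μ⁻¹ τ⁻¹]
  abel

theorem eventually_mem : ∀ᶠ μ in 𝓝[>] (0 : ℝ), μ ∈ Ioo 0 μ₀ := Ioo_mem_nhdsGT hJ.pos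

theorem norm_apply_le {μ : ℝ} (hμ : μ ∈ Ioo 0 μ₀) (x : H) : ‖J μ x‖ ≤ 2 * ‖x‖ :=
  (J μ).le_of_opNorm_le (hJ.norm_le μ hμ) x

/-- From x = J_μ x - μ A_μ x one gets ⟨A_μ x, x⟩ = ⟨A_μ x, J_μ x⟩ - μ‖A_μ x‖², and ‖J_μ x‖ ≤ 2‖x‖
produces the factor 4. The bound does not depend on μ, so neither do the energy estimates for the
Yosida approximations. -/
theorem inner_yosida_le {μ : ℝ} (hμ : μ ∈ Ioo 0 μ₀) (x : H) :
    inner ℝ (yosida J μ x) x ≤ 4 * ρ * ‖x‖ ^ 2 := by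
  have hx : x = J μ x - μ • yosida J μ x := by
    rw [yosida_apply, smul_inv_smul₀ hμ.1.ne']; abel
  have h1 := hJ.inner_le μ hμ x
  have h2 : inner ℝ (yosida J μ x) x
      = inner ℝ (yosida J μ x) (J μ x) - μ * ‖yosida J μ x‖ ^ 2 := by
    conv_lhs => rw [hx]
    rw [inner_sub_right, inner_smul_right]
    rw [← hx, real_inner_self_eq_norm_sq]
  have h3 : ‖J μ x‖ ^ 2 ≤ (2 * ‖x‖) ^ 2 :=
    pow_le_pow_left₀ (norm_nonneg _) (hJ.norm_apply_le hμ x) 2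
  have h4 : 0 ≤ μ * ‖yosida J μ x‖ ^ 2 := mul_nonneg hμ.1.le (by positivity)
  nlinarith [mul_le_mul_of_nonneg_left h3 hJ.nonneg]

theorem tendsto_apply_sub {τ : ℕ → ℝ} (hτ : Tendsto τ atTop (𝓝[>] 0)) (x : H) :
    Tendsto (fun k => J (τ k) x - x) atTop (𝓝 0) := by
  simpa using ((hJ.tendsto x).comp hτ).sub_const x

theorem exists_seq : ∃ τ : ℕ → ℝ, Tendsto τ atTop (𝓝[>] 0) ∧ ∀ k, τ k ∈ Ioo 0 μ₀ := by
  refine ⟨fun k => μ₀ / (k + 2), ?_, fun k => ?_⟩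
  · refine tendsto_nhdsWithin_iff.2 ⟨?_, Eventually.of_forall fun k => ?_⟩
    · have := (tendsto_const_div_atTop_nhds_zero_nat μ₀).comp (tendsto_add_atTop_nat 2)
      refine this.congr fun k => ?_
      simp
    · have := hJ.pos
      simp only [mem_Ioi]; positivity
  · have := hJ.pos
    refine ⟨by positivity, ?_⟩
    rw [div_lt_iff₀ (by positivity)]
    nlinarith [(Nat.cast_nonneg k : (0 : ℝ) ≤ k)]

theorem yosida_resolvent {μ τ : ℝ} (hμ : μ ∈ Ioo 0 μ₀) (hτ : τ ∈ Ioo 0 μ₀) (x : H) :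
    yosida J μ (J τ x) = J μ (yosida J τ x) := (hJ.resolvent μ hμ τ hτ x).symm

/-- Dominated convergence: ‖J_τ - 1‖ ≤ 3 gives the majorant 9‖F‖². -/
theorem tendsto_integral_apply_sub {τ : ℕ → ℝ} (hτ : Tendsto τ atTop (𝓝[>] 0))
    (hτm : ∀ k, τ k ∈ Ioo 0 μ₀) {F : ℝ → H} {a b : ℝ} (hab : a ≤ b) (hF : MemL2 F a b) :
    Tendsto (fun k => ∫ s in a..b, ‖J (τ k) (F s) - F s‖ ^ 2) atTop (𝓝 0) := by
  have := intervalIntegral.tendsto_integral_filter_of_dominated_convergence (μ := volume)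
    (a := a) (b := b) (l := atTop) (F := fun k s => ‖J (τ k) (F s) - F s‖ ^ 2) (f := fun _ => 0)
    (fun s => 9 * ‖F s‖ ^ 2) (Eventually.of_forall fun k => by
      rw [uIoc_of_le hab]
      exact (((hF.clm (J (τ k))).sub hF).1.norm.pow 2))
    (Eventually.of_forall fun k => ae_of_all _ fun s _ => by
      rw [norm_pow, norm_norm]
      have h1 := hJ.norm_apply_le (hτm k) (F s)
      have h2 := norm_sub_le (J (τ k) (F s)) (F s)
      calc _ ≤ (3 * ‖F s‖) ^ 2 := pow_le_pow_left₀ (norm_nonneg _) (by linarith) 2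
        _ = _ := by ring)
    ((hF.intervalIntegrable_norm_sq hab).const_mul 9)
    (ae_of_all _ fun s _ => by simpa using ((hJ.tendsto_apply_sub hτ (F s)).norm.pow 2))
  simpa using this

/-- The energy estimate for mild solutions. -/
theorem norm_sq_le [CompleteSpace H] {F y : ℝ → H} {a b L : ℝ} (hab : a ≤ b) (hL : b - a ≤ L)
    (hy : IsMild J μ₀ F y a b) (hF : MemL2 F a b) :
    ‖y b‖ ^ 2 ≤ energyConst ρ L * (‖y a‖ ^ 2 + ∫ s in a..b, ‖F s‖ ^ 2) := by
  have hρ := hJ.nonneg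
  -- The estimate is proved for J_μ y, which is absolutely continuous and satisfies ⟨A_μ y, J_μ y⟩ ≤
  -- ρ‖J_μ y‖². The bound ‖J_μ‖ ≤ 2 accounts for the factor 4 in `energyConst`, and the bound
  -- obtained is uniform in μ.
  have h1 : ∀ μ ∈ Ioo 0 μ₀, ‖J μ (y b)‖ ^ 2
      ≤ energyConst ρ L * (‖y a‖ ^ 2 + ∫ s in a..b, ‖F s‖ ^ 2) := by
    intro μ hμ
    have i := hF.intervalIntegrable_norm_sq hab
    have := (hy.primitive μ hμ).norm_sq_le (K := 2 * ρ + 1) (γ := fun s => 4 * ‖F s‖ ^ 2)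
      (by linarith) hab (i.const_mul 4) (fun s => by positivity)
      (ae_of_all _ fun s _ => by
        have a1 := hJ.inner_le μ hμ (y s)
        have a2 := real_inner_le_norm (J μ (F s)) (J μ (y s))
        have a3 := hJ.norm_apply_le hμ (F s)
        have a4 : ‖J μ (F s)‖ ^ 2 ≤ (2 * ‖F s‖) ^ 2 := pow_le_pow_left₀ (norm_nonneg _) a3 2
        rw [inner_add_left]
        nlinarith [sq_nonneg (‖J μ (F s)‖ - ‖J μ (y s)‖)])
    rw [intervalIntegral.integral_const_mul] at this
    have b1 : ‖J μ (y a)‖ ^ 2 ≤ (2 * ‖y a‖) ^ 2 :=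
      pow_le_pow_left₀ (norm_nonneg _) (hJ.norm_apply_le hμ (y a)) 2
    have b2 : Real.exp ((2 * ρ + 1) * (b - a)) ≤ Real.exp ((8 * ρ + 1) * L) := by
      refine Real.exp_le_exp.2 (mul_le_mul (by linarith) hL (by linarith) (by linarith))
    have b3 := integral_norm_sq_nonneg F hab
    calc _ ≤ _ := this
      _ ≤ Real.exp ((8 * ρ + 1) * L) * (4 * ‖y a‖ ^ 2 + 4 * ∫ s in a..b, ‖F s‖ ^ 2) :=
        mul_le_mul b2 (by nlinarith) (by positivity) (by positivity)
      _ = _ := by unfold energyConst; ring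
  refine le_of_tendsto ((hJ.tendsto (y b)).norm.pow 2) ?_
  filter_upwards [hJ.eventually_mem] with μ hμ using h1 μ hμ

/-- The set of data for which a mild solution exists is closed. -/
theorem exists_mild_of_tendsto [CompleteSpace H] {F : ℝ → H} {Fk yk : ℕ → ℝ → H} {a b : ℝ} {x : H}
    (hab : a ≤ b) (hF : MemL2 F a b) (hFk : ∀ k, MemL2 (Fk k) a b)
    (hyk : ∀ k, IsMild J μ₀ (Fk k) (yk k) a b)
    (hx : Tendsto (fun k => yk k a) atTop (𝓝 x))
    (hlim : Tendsto (fun k => ∫ s in a..b, ‖Fk k s - F s‖ ^ 2) atTop (𝓝 0)) :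
    ∃ y, IsMild J μ₀ F y a b ∧ y a = x := by
  set c := energyConst ρ (b - a) with hc
  have hc0 : 0 < c := energyConst_pos _ _
  have hε : Tendsto (fun k => 2 * c * (‖yk k a - x‖ ^ 2 + ∫ s in a..b, ‖Fk k s - F s‖ ^ 2)) atTop
      (𝓝 0) := by
    have := (((tendsto_iff_norm_sub_tendsto_zero.1 hx).pow 2).add hlim).const_mul (2 * c)
    simpa using this
  -- Differences of the y_k are mild solutions for differences of the data, so the energy estimate
  -- makes the sequence uniformly Cauchy.
  obtain ⟨y, hyc, hyu⟩ := exists_tendstoUniformlyOn_of_sq_le hε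
    (fun k => (hyk k).continuousOn) fun j k t ht => by
      have e1 := hJ.norm_sq_le (L := b - a) ht.1 (by linarith [ht.2])
        (((hyk j).sub hab (hyk k)).mono le_rfl ht.1 ht.2)
        (((hFk j).sub (hFk k)).mono le_rfl ht.2)
      have e2 := integral_norm_sq_mono ((hFk j).sub (hFk k)) ht
      have e3 := integral_norm_sq_sub_le hab (hFk j) (hFk k) hF
      have e4 : ‖yk j a - yk k a‖ ≤ ‖yk j a - x‖ + ‖yk k a - x‖ := by
        rw [norm_sub_rev (yk k a)]; simpa using norm_add_le (yk j a - x) (x - yk k a)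
      have e5 : ‖yk j a - yk k a‖ ^ 2 ≤ 2 * ‖yk j a - x‖ ^ 2 + 2 * ‖yk k a - x‖ ^ 2 := by
        nlinarith [norm_nonneg (yk j a - yk k a), sq_nonneg (‖yk j a - x‖ - ‖yk k a - x‖)]
      rw [← hc] at e1
      calc _ ≤ _ := e1
        _ ≤ c * ((2 * ‖yk j a - x‖ ^ 2 + 2 * ‖yk k a - x‖ ^ 2) +
          (2 * (∫ s in a..b, ‖Fk j s - F s‖ ^ 2) + 2 * ∫ s in a..b, ‖Fk k s - F s‖ ^ 2)) := by
            gcongr; exact e2.trans e3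
        _ = _ := by ring
  refine ⟨y, ⟨hyc, fun μ hμ => ?_⟩, tendsto_nhds_unique
    (hyu.tendsto_at ⟨le_rfl, hab⟩) hx⟩
  have hyM : MemL2 y a b := hyc.memL2
  refine IsPrimitive.of_tendsto (l := atTop) (fun k => (hyk k).primitive μ hμ)
    (((hyM.clm (yosida J μ)).add (hF.clm (J μ))).intervalIntegrable hab)
    (fun t ht => ((J μ).continuous.tendsto _).comp (hyu.tendsto_at ht)) ?_
  have hykM : ∀ k, MemL2 (fun s => yk k s - y s) a b := fun k =>
    (hyk k).continuousOn.memL2.sub hyM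
  have t1 : Tendsto (fun k => ∫ s in a..b, ‖yk k s - y s‖) atTop (𝓝 0) := by
    refine tendsto_integral_norm_of_sq hab hykM (tendsto_integral_norm_sq_of_uniform hab ?_)
    have := hyu
    rw [Metric.tendstoUniformlyOn_iff] at this ⊢
    intro ε hε
    filter_upwards [this ε hε] with k hk t ht
    have := hk t ht
    rwa [Pi.zero_apply, dist_zero_left, ← dist_eq_norm, dist_comm]
  have t2 := tendsto_integral_norm_of_sq hab (fun k => (hFk k).sub hF) hlim
  have t3 := (t1.const_mul ‖yosida J μ‖).add (t2.const_mul ‖J μ‖)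
  rw [mul_zero, mul_zero, add_zero] at t3
  refine squeeze_zero (fun k => intervalIntegral.integral_nonneg hab fun _ _ => norm_nonneg _)
    (fun k => ?_) t3
  have i1 := ((hykM k).intervalIntegrable hab).norm
  have i2 := (((hFk k).sub hF).intervalIntegrable hab).norm
  rw [← intervalIntegral.integral_const_mul, ← intervalIntegral.integral_const_mul,
    ← intervalIntegral.integral_add (i1.const_mul _) (i2.const_mul _)]
  refine intervalIntegral.integral_mono_on hab ?_ ((i1.const_mul _).add (i2.const_mul _))
    fun s _ => ?_
  · exact (((hyk k).primitive μ hμ).integrable.sub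
      (((hyM.clm (yosida J μ)).add (hF.clm (J μ))).intervalIntegrable hab)).norm
  · have : yosida J μ (yk k s) + J μ (Fk k s) - (yosida J μ (y s) + J μ (F s))
        = yosida J μ (yk k s - y s) + J μ (Fk k s - F s) := by
      simp only [map_sub]; abel
    rw [this]
    exact (norm_add_le _ _).trans (add_le_add (ContinuousLinearMap.le_opNorm _ _)
      (ContinuousLinearMap.le_opNorm _ _))

end IsResolventFamily

end

/-! ### Existence of mild solutions by Yosida approximation -/

section

variable {H : Type*} [NormedAddCommGroup H] [InnerProductSpace ℝ H] [CompleteSpace H]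

/-- Variation of constants for a bounded operator. -/
theorem exists_hasDerivAt_linear (A : H →L[ℝ] H) {F : ℝ → H} (hF : Continuous F) (a : ℝ) (x : H) :
    ∃ z : ℝ → H, z a = x ∧ ∀ t, HasDerivAt z (A (z t) + F t) t := by
  have hE : ∀ (B : H →L[ℝ] H) t, HasDerivAt (fun s : ℝ => NormedSpace.exp ((s - a) • B))
      (B * NormedSpace.exp ((t - a) • B)) t := fun B t =>
    (hasDerivAt_exp_smul_const' (𝕂 := ℝ) B (t - a)).comp_sub_const t a
  have hEc : ∀ B : H →L[ℝ] H, Continuous fun s : ℝ => NormedSpace.exp ((s - a) • B) := fun B =>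
    continuous_iff_continuousAt.2 fun t => (hE B t).continuousAt
  have hc : Continuous fun s => NormedSpace.exp ((s - a) • (-A)) (F s) := (hEc (-A)).clm_apply hF
  refine ⟨fun t => NormedSpace.exp ((t - a) • A)
    (x + ∫ s in a..t, NormedSpace.exp ((s - a) • (-A)) (F s)), by simp, fun t => ?_⟩
  -- The product rule leaves the term exp((t-a)A) exp(-(t-a)A) F(t), which is F(t).
  have h1 := (hE A t).clm_apply ((hc.integral_hasStrictDerivAt a t).hasDerivAt.const_add x)
  have h2 : NormedSpace.exp ((t - a) • A) * NormedSpace.exp ((t - a) • (-A)) = 1 := by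
    let _ : NormedAlgebra ℚ (H →L[ℝ] H) := NormedAlgebra.restrictScalars ℚ ℝ _
    rw [← NormedSpace.exp_add_of_commute]
    · simp
    · exact ((Commute.refl A).neg_right.smul_left _).smul_right _
  have h3 : NormedSpace.exp ((t - a) • A) (NormedSpace.exp ((t - a) • (-A)) (F t)) = F t := by
    rw [← mul_apply_eq_comp, h2]; rfl
  rw [h3] at h1
  simpa only [mul_apply_eq_comp] using h1

theorem IsPrimitive.of_hasDerivAt {X X' : ℝ → H} {a b : ℝ}
    (hX : ∀ t, HasDerivAt X (X' t) t) (hX' : Continuous X') : IsPrimitive X X' a b :=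
  ⟨hX'.intervalIntegrable a b, fun t _ => by
    rw [intervalIntegral.integral_eq_sub_of_hasDerivAt (fun s _ => hX s)
      (hX'.intervalIntegrable a t)]; abel⟩

namespace IsResolventFamily

variable {J : ℝ → H →L[ℝ] H} {ρ μ₀ : ℝ} (hJ : IsResolventFamily J ρ μ₀)
include hJ

/-- Here the exponent 8ρ + 1 is forced: 8ρ is twice the 4ρ of `inner_yosida_le`, and 1 comes from
Young's inequality. `energyConst` is chosen to serve both this problem and mild solutions. -/
theorem norm_sq_le_of_hasDerivAt {μ : ℝ} (hμ : μ ∈ Ioo 0 μ₀) {F z : ℝ → H} (hF : Continuous F)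
    (hz : ∀ t, HasDerivAt z (yosida J μ (z t) + F t) t) {a b L : ℝ} (hab : a ≤ b)
    (hL : b - a ≤ L) :
    ‖z b‖ ^ 2 ≤ energyConst ρ L * (‖z a‖ ^ 2 + ∫ s in a..b, ‖F s‖ ^ 2) := by
  have hρ := hJ.nonneg
  have hzc : Continuous z := continuous_iff_continuousAt.2 fun t => (hz t).continuousAt
  have hp : IsPrimitive z _ a b := IsPrimitive.of_hasDerivAt hz (by fun_prop)
  have := hp.norm_sq_le (K := 8 * ρ + 1) (γ := fun s => ‖F s‖ ^ 2) (by linarith) hab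
    ((hF.norm.pow 2).intervalIntegrable a b) (fun s => by positivity)
    (ae_of_all _ fun s _ => by
      have a1 := hJ.inner_yosida_le hμ (z s)
      have a2 := real_inner_le_norm (F s) (z s)
      rw [inner_add_left]
      nlinarith [sq_nonneg (‖F s‖ - ‖z s‖)])
  have b3 := integral_norm_sq_nonneg F hab
  refine this.trans (mul_le_mul_of_nonneg_right ?_ (by positivity))
  have b2 : Real.exp ((8 * ρ + 1) * (b - a)) ≤ Real.exp ((8 * ρ + 1) * L) :=
    Real.exp_le_exp.2 (mul_le_mul_of_nonneg_left hL (by linarith))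
  unfold energyConst
  linarith [Real.exp_pos ((8 * ρ + 1) * L)]

/-- Existence of mild solutions for data in the range of a resolvent, by convergence of the
Yosida approximations. -/
theorem exists_mild_of_range {ν : ℝ} (hν : ν ∈ Ioo 0 μ₀) {F : ℝ → H} (hF : Continuous F) (x : H)
    {a b : ℝ} (hab : a ≤ b) :
    ∃ y, IsMild J μ₀ (fun s => J ν (F s)) y a b ∧ y a = J ν x := by
  obtain ⟨τ, hτ, hτm⟩ := hJ.exists_seq
  have hF' : Continuous fun s => J ν (F s) := (J ν).continuous.comp hF
  choose y hya hyd using fun k => exists_hasDerivAt_linear (yosida J (τ k)) hF' a (J ν x)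
  have hyc : ∀ k, Continuous (y k) := fun k =>
    continuous_iff_continuousAt.2 fun t => (hyd k t).continuousAt
  set c := energyConst ρ (b - a) with hc
  have hc0 : 0 < c := energyConst_pos _ _
  set w := yosida J ν x
  set G : ℝ → H := fun s => yosida J ν (F s) with hG
  have hGc : Continuous G := (yosida J ν).continuous.comp hF
  have hGM : MemL2 G a b := hGc.continuousOn.memL2
  set η : ℕ → ℝ := fun k => ‖J (τ k) w - w‖ ^ 2 + ∫ s in a..b, ‖J (τ k) (G s) - G s‖ ^ 2 with hη
  have hη0 : Tendsto η atTop (𝓝 0) := by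
    have := ((hJ.tendsto_apply_sub hτ w).norm.pow 2).add
      (hJ.tendsto_integral_apply_sub hτ hτm hab hGM)
    simpa using this
  -- On the range of J_ν the difference of two Yosida approximations is (J_{τ_j} - J_{τ_k}) A_ν,
  -- which tends strongly to 0. This is why the data are first taken in that range.
  have hΔ : ∀ j k (z : H), yosida J (τ j) (J ν z) - yosida J (τ k) (J ν z)
      = J (τ j) (yosida J ν z) - J (τ k) (yosida J ν z) := fun j k z => by
    rw [hJ.yosida_resolvent (hτm j) hν, hJ.yosida_resolvent (hτm k) hν]
  have hε : Tendsto (fun k => c * ((b - a) * (c * (2 * η k)))) atTop (𝓝 0) := by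
    simpa using (((hη0.const_mul 2).const_mul c).const_mul (b - a)).const_mul c
  have hest : ∀ j k, ∀ t ∈ Icc a b, ‖y j t - y k t‖ ^ 2
      ≤ c * ((b - a) * (c * (2 * η j))) + c * ((b - a) * (c * (2 * η k))) := by
    intro j k t ht
    -- The energy estimate is used twice. Since Yosida approximations commute, Δ y_k solves the
    -- equation of y_k with data Δ J_ν F and Δ J_ν x, which are small by `hΔ`. Then y_j - y_k solves
    -- the equation of A_{τ_j} with zero initial value and the small source Δ y_k.
    set Δ : H →L[ℝ] H := yosida J (τ j) - yosida J (τ k) with hΔd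
    have hEc : Continuous fun s => Δ (y k s) := Δ.continuous.comp (hyc k)
    have hED : ∀ s, HasDerivAt (fun s => Δ (y k s))
        (yosida J (τ k) (Δ (y k s)) + Δ (J ν (F s))) s := fun s => by
      have h := Δ.hasFDerivAt.comp_hasDerivAt s (hyd k s)
      have e : Δ (yosida J (τ k) (y k s) + J ν (F s))
          = yosida J (τ k) (Δ (y k s)) + Δ (J ν (F s)) := by
        rw [map_add, hΔd]
        simp only [_root_.sub_apply, map_sub, hJ.yosida_comm (hτm j) (hτm k)]
      rw [e] at h
      exact h
    have hE : ∀ s ∈ Icc a b, ‖Δ (y k s)‖ ^ 2 ≤ c * (2 * η j + 2 * η k) := fun s hs => by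
      have e1 := hJ.norm_sq_le_of_hasDerivAt (hτm k) (Δ.continuous.comp hF') hED
        (L := b - a) hs.1 (by linarith [hs.2])
      have e2 : ∫ q in a..s, ‖Δ (J ν (F q))‖ ^ 2 ≤ ∫ q in a..b, ‖Δ (J ν (F q))‖ ^ 2 :=
        integral_norm_sq_mono (Δ.continuous.comp hF').continuousOn.memL2 hs
      have e3 : ∫ q in a..b, ‖Δ (J ν (F q))‖ ^ 2
          = ∫ q in a..b, ‖J (τ j) (G q) - J (τ k) (G q)‖ ^ 2 := by
        simp only [hΔd, _root_.sub_apply, hΔ, hG]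
      have e4 := integral_norm_sq_sub_le hab (hGM.clm (J (τ j))) (hGM.clm (J (τ k))) hGM
      have e5 : Δ (y k a) = J (τ j) w - J (τ k) w := by
        rw [hya, hΔd, _root_.sub_apply, hΔ]
      have e6 : ‖J (τ j) w - J (τ k) w‖ ≤ ‖J (τ j) w - w‖ + ‖J (τ k) w - w‖ := by
        rw [norm_sub_rev (J (τ k) w)]; simpa using norm_add_le (J (τ j) w - w) (w - J (τ k) w)
      have e7 : ‖J (τ j) w - J (τ k) w‖ ^ 2
          ≤ 2 * ‖J (τ j) w - w‖ ^ 2 + 2 * ‖J (τ k) w - w‖ ^ 2 := by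
        nlinarith [norm_nonneg (J (τ j) w - J (τ k) w),
          sq_nonneg (‖J (τ j) w - w‖ - ‖J (τ k) w - w‖)]
      rw [e5] at e1
      refine e1.trans (mul_le_mul_of_nonneg_left ?_ hc0.le)
      simp only [Function.comp_apply, hη]
      linarith
    have hd : ∀ s, HasDerivAt (fun s => y j s - y k s)
        (yosida J (τ j) (y j s - y k s) + Δ (y k s)) s := fun s => by
      have h := (hyd j s).sub (hyd k s)
      have e : yosida J (τ j) (y j s) + J ν (F s) - (yosida J (τ k) (y k s) + J ν (F s))
          = yosida J (τ j) (y j s - y k s) + Δ (y k s) := by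
        simp only [hΔd, _root_.sub_apply, map_sub]; abel
      rw [e] at h
      exact h
    have e1 := hJ.norm_sq_le_of_hasDerivAt (hτm j) hEc hd (L := b - a) ht.1 (by linarith [ht.2])
    have e2 := integral_norm_sq_mono (f := fun s => Δ (y k s)) (hEc.continuousOn.memL2) ht
    have e3 : ∫ q in a..b, ‖Δ (y k q)‖ ^ 2 ≤ ∫ q in a..b, c * (2 * η j + 2 * η k) :=
      intervalIntegral.integral_mono_on hab ((hEc.norm.pow 2).intervalIntegrable a b)
        _root_.intervalIntegrable_const hE
    rw [intervalIntegral.integral_const, smul_eq_mul] at e3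
    rw [hya, hya, sub_self, norm_zero] at e1
    calc _ ≤ _ := e1
      _ ≤ c * ((b - a) * (c * (2 * η j + 2 * η k))) :=
        mul_le_mul_of_nonneg_left (by simpa using e2.trans e3) hc0.le
      _ = _ := by ring
  obtain ⟨Y, hYc, hYu⟩ := exists_tendstoUniformlyOn_of_sq_le hε
    (fun k => (hyc k).continuousOn) hest
  have ha : a ∈ Icc a b := ⟨le_rfl, hab⟩
  refine ⟨Y, ⟨hYc, fun μ hμ => ?_⟩, tendsto_nhds_unique (hYu.tendsto_at ha) ?_⟩
  swap
  · simp only [hya]; exact tendsto_const_nhds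
  have hprim : ∀ k, IsPrimitive (fun t => J μ (y k t))
      (fun t => J μ (yosida J (τ k) (y k t) + J ν (F t))) a b := fun k =>
    (IsPrimitive.of_hasDerivAt (hyd k)
      (((yosida J (τ k)).continuous.comp (hyc k)).add hF')).clm (J μ)
  have hYM : MemL2 Y a b := hYc.memL2
  refine IsPrimitive.of_tendsto (l := atTop) hprim
    (((hYM.clm (yosida J μ)).add (hF'.continuousOn.memL2.clm (J μ))).intervalIntegrable hab)
    (fun t ht => ((J μ).continuous.tendsto _).comp (hYu.tendsto_at ht)) ?_
  -- J_μ A_{τ_k} = A_μ J_{τ_k} moves the unbounded limit onto the fixed bounded operator A_μ, so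
  -- only J_{τ_k} y_k → Y is required.
  have hrew : ∀ k s, J μ (yosida J (τ k) (y k s) + J ν (F s))
      - (yosida J μ (Y s) + J μ (J ν (F s)))
      = yosida J μ (J (τ k) (y k s) - Y s) := fun k s => by
    rw [map_add, map_sub, hJ.resolvent μ hμ (τ k) (hτm k)]; abel
  simp only [hrew]
  have hd1 : ∀ k, MemL2 (fun s => y k s - Y s) a b := fun k =>
    (hyc k).continuousOn.memL2.sub hYM
  have hd2 : ∀ k, MemL2 (fun s => J (τ k) (y k s) - Y s) a b := fun k =>
    ((hyc k).continuousOn.memL2.clm _).sub hYM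
  refine tendsto_integral_norm_of_sq hab (fun k => (hd2 k).clm (yosida J μ)) ?_
  have t1 : Tendsto (fun k => ∫ s in a..b, ‖y k s - Y s‖ ^ 2) atTop (𝓝 0) := by
    refine tendsto_integral_norm_sq_of_uniform hab ?_
    have := hYu
    rw [Metric.tendstoUniformlyOn_iff] at this ⊢
    intro ε hε
    filter_upwards [this ε hε] with k hk t ht
    have := hk t ht
    rwa [Pi.zero_apply, dist_zero_left, ← dist_eq_norm, dist_comm]
  have t2 := hJ.tendsto_integral_apply_sub hτ hτm hab hYM
  have t3 := ((t1.const_mul (2 * 2 ^ 2)).add (t2.const_mul 2)).const_mul (‖yosida J μ‖ ^ 2)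
  simp only [mul_zero, add_zero] at t3
  refine squeeze_zero (fun k => integral_norm_sq_nonneg _ hab) (fun k => ?_) t3
  refine (integral_norm_sq_le_of_norm_le hab ((hd2 k).clm (yosida J μ)) (hd2 k)
    fun s _ => (yosida J μ).le_opNorm _).trans ?_
  refine mul_le_mul_of_nonneg_left ?_ (by positivity)
  have e1 := integral_norm_sq_sub_le hab ((hyc k).continuousOn.memL2.clm (J (τ k))) hYM
    (hYM.clm (J (τ k)))
  have e2 : ∫ s in a..b, ‖J (τ k) (y k s) - J (τ k) (Y s)‖ ^ 2
      ≤ 2 ^ 2 * ∫ s in a..b, ‖y k s - Y s‖ ^ 2 := by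
    refine integral_norm_sq_le_of_norm_le hab
      (((hyc k).continuousOn.memL2.clm _).sub (hYM.clm _)) (hd1 k) fun s _ => ?_
    rw [← map_sub]; exact hJ.norm_apply_le (hτm k) _
  have e3 : ∫ s in a..b, ‖Y s - J (τ k) (Y s)‖ ^ 2 = ∫ s in a..b, ‖J (τ k) (Y s) - Y s‖ ^ 2 := by
    simp only [norm_sub_rev]
  rw [e3] at e1
  linarith

/-- Existence of mild solutions. -/
theorem exists_mild {F : ℝ → H} {a b : ℝ} (hab : a ≤ b) (hF : MemL2 F a b) (x : H) :
    ∃ y, IsMild J μ₀ F y a b ∧ y a = x := by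
  obtain ⟨τ, hτ, hτm⟩ := hJ.exists_seq
  -- Two closure arguments: J_{τ_k} G → G removes the range condition for continuous sources, and
  -- density of continuous functions in L² then covers F.
  have hcont : ∀ G : ℝ → H, Continuous G → ∃ y, IsMild J μ₀ G y a b ∧ y a = x := by
    intro G hG
    choose y hy hya using fun k => hJ.exists_mild_of_range (hτm k) hG x hab
    refine hJ.exists_mild_of_tendsto hab hG.continuousOn.memL2
      (fun k => hG.continuousOn.memL2.clm (J (τ k))) hy ?_
      (hJ.tendsto_integral_apply_sub hτ hτm hab hG.continuousOn.memL2)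
    simp only [hya]
    exact (hJ.tendsto x).comp hτ
  have happ : ∀ k : ℕ, ∃ G : ℝ → H, Continuous G ∧
      ∫ s in a..b, ‖G s - F s‖ ^ 2 ≤ 1 / ((k : ℝ) + 1) := by
    intro k
    have hF2 : MemLp F (ENNReal.ofReal 2) (volume.restrict (Ioc a b)) := by simpa using hF
    obtain ⟨G, hG, -⟩ := hF2.exists_boundedContinuous_integral_rpow_sub_le (by norm_num)
      (ε := 1 / ((k : ℝ) + 1)) (by positivity)
    refine ⟨G, G.continuous, ?_⟩
    rw [intervalIntegral.integral_of_le hab]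
    simpa [norm_sub_rev] using hG
  choose G hGc hG using happ
  choose y hy hya using fun k => hcont (G k) (hGc k)
  refine hJ.exists_mild_of_tendsto hab hF (fun k => (hGc k).continuousOn.memL2) hy ?_ ?_
  · simp only [hya]; exact tendsto_const_nhds
  · exact squeeze_zero (fun k => integral_norm_sq_nonneg _ hab) hG
      tendsto_one_div_add_atTop_nhds_zero_nat

end IsResolventFamily

end

/-! ### Resolvents of coercive forms, and passage from weak to mild solutions -/

section

section Resolvent

variable {V H : Type*}
  [NormedAddCommGroup V] [InnerProductSpace ℝ V]
  [NormedAddCommGroup H] [InnerProductSpace ℝ H]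

/-- The embedding `H → V'` as a continuous linear map. -/
def toDualVL (ι : V →L[ℝ] H) : H →L[ℝ] StrongDual ℝ V :=
  LinearMap.mkContinuous
    { toFun := toDualV ι
      map_add' := fun x y => by ext; simp [toDualV]
      map_smul' := fun c x => by ext; simp [toDualV] } ‖ι‖ fun x => by
    refine ContinuousLinearMap.opNorm_le_bound _ (by positivity) fun v => ?_
    calc ‖inner ℝ x (ι v)‖ ≤ ‖x‖ * (‖ι‖ * ‖v‖) :=
          (norm_inner_le_norm _ _).trans
            (mul_le_mul_of_nonneg_left (ι.le_opNorm v) (norm_nonneg _))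
      _ = ‖ι‖ * ‖x‖ * ‖v‖ := by ring

/-- The bilinear form `(v, w) ↦ ⟨v, w⟩_H - μ ⟨𝒜 v, w⟩`. -/
def resolventForm (ι : V →L[ℝ] H) (𝒜 : V →L[ℝ] StrongDual ℝ V) (μ : ℝ) :
    V →L[ℝ] V →L[ℝ] ℝ := (toDualVL ι).comp ι - μ • 𝒜

theorem resolventForm_apply (ι : V →L[ℝ] H) (𝒜 : V →L[ℝ] StrongDual ℝ V) (μ : ℝ) (v w : V) :
    resolventForm ι 𝒜 μ v w = inner ℝ (ι v) (ι w) - μ * 𝒜 v w := rfl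

theorem toDualV_apply (ι : V →L[ℝ] H) (x : H) (v : V) :
    toDualV ι x v = inner ℝ x (ι v) := rfl

/-- `a = A x` for the part `A` in `H` of `𝒜`. -/
def IsGenerated (ι : V →L[ℝ] H) (𝒜 : V →L[ℝ] StrongDual ℝ V) (x a : H) : Prop :=
  ∃ v, ι v = x ∧ 𝒜 v = toDualV ι a

/-- The step size below which resolvents are used. -/
def maxStep (ρ : ℝ) : ℝ := 1 / (2 * (ρ + 1))

/-- `V`-`H`-coercivity. -/
def IsVHCoercive (ι : V →L[ℝ] H) (𝒜 : V →L[ℝ] StrongDual ℝ V) (ρ θ : ℝ) : Prop :=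
  0 ≤ ρ ∧ 0 < θ ∧ ∀ v : V, θ * ‖v‖ ^ 2 ≤ -(𝒜 v v) + ρ * ‖ι v‖ ^ 2

variable {ι : V →L[ℝ] H} {𝒜 : V →L[ℝ] StrongDual ℝ V} {ρ θ μ : ℝ}

theorem IsVHCoercive.flip (h : IsVHCoercive ι 𝒜 ρ θ) : IsVHCoercive ι 𝒜.flip ρ θ :=
  ⟨h.1, h.2.1, fun v => h.2.2 v⟩

theorem IsVHCoercive.maxStep_pos (h : IsVHCoercive ι 𝒜 ρ θ) : 0 < maxStep ρ := by
  have := h.1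
  unfold maxStep; positivity

theorem IsVHCoercive.mul_le (h : IsVHCoercive ι 𝒜 ρ θ) (hμ : μ ∈ Ioo 0 (maxStep ρ)) :
    μ * ρ ≤ 1 / 2 := by
  have h0 := h.1
  have h1 := hμ.2
  unfold maxStep at h1
  rw [lt_div_iff₀ (by positivity)] at h1
  nlinarith [hμ.1]

/-- The form dominates μθ‖v‖² + (1 - μρ)‖ιv‖², and μρ ≤ 1/2 below `maxStep`. -/
theorem IsVHCoercive.isCoercive (h : IsVHCoercive ι 𝒜 ρ θ) (hμ : μ ∈ Ioo 0 (maxStep ρ)) :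
    IsCoercive (resolventForm ι 𝒜 μ) := by
  refine ⟨μ * θ, mul_pos hμ.1 h.2.1, fun v => ?_⟩
  rw [resolventForm_apply, real_inner_self_eq_norm_sq]
  nlinarith [mul_le_mul_of_nonneg_left (h.2.2 v) hμ.1.le,
    mul_le_mul_of_nonneg_right (h.mul_le hμ) (sq_nonneg ‖ι v‖), sq_nonneg ‖ι v‖]

theorem IsVHCoercive.inner_le (h : IsVHCoercive ι 𝒜 ρ θ) {x a : H}
    (hxa : IsGenerated ι 𝒜 x a) : inner ℝ a x ≤ ρ * ‖x‖ ^ 2 := by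
  obtain ⟨v, rfl, hv⟩ := hxa
  have h1 := h.2.2 v
  rw [hv, toDualV_apply] at h1
  have := mul_nonneg h.2.1.le (sq_nonneg ‖v‖)
  linarith

theorem toDualV_injective (hι : DenseRange ι) : Function.Injective (toDualV ι) := by
  intro a b hab
  refine ext_inner_right ℝ fun x => ?_
  have : (fun x : H => inner ℝ a x) = fun x => inner ℝ b x :=
    hι.equalizer (by fun_prop) (by fun_prop) (funext fun v => by
      simpa [toDualV_apply] using congrArg (fun l => l v) hab)
  exact congrFun this x

theorem IsGenerated.unique (hinj : Function.Injective ι) (hι : DenseRange ι) {x a b : H}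
    (ha : IsGenerated ι 𝒜 x a)
    (hb : IsGenerated ι 𝒜 x b) : a = b := by
  obtain ⟨v, hv, hva⟩ := ha
  obtain ⟨w, hw, hwb⟩ := hb
  obtain rfl := hinj (hv.trans hw.symm)
  exact toDualV_injective hι (hva.symm.trans hwb)

variable [CompleteSpace V] [CompleteSpace H]

open Classical in
/-- The resolvent `(1 - μ A)⁻¹` of the part `A` in `H` of `𝒜`. -/
def resolvent (ι : V →L[ℝ] H) (𝒜 : V →L[ℝ] StrongDual ℝ V) (μ : ℝ) : H →L[ℝ] H :=
  if h : IsCoercive (resolventForm ι 𝒜 μ) then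
    ι ∘L (h.continuousLinearEquivOfBilin.symm : V →L[ℝ] V) ∘L ι.adjoint
  else 0

/-- The Lax–Milgram solution v of ⟨ιv, ιw⟩ - μ⟨𝒜v, w⟩ = ⟨x, ιw⟩ satisfies 𝒜v = μ⁻¹(ιv - x) in V'.
Hence J_μ x lies in the domain of A and A J_μ = A_μ. -/
theorem IsVHCoercive.resolvent_spec (h : IsVHCoercive ι 𝒜 ρ θ) (hμ : μ ∈ Ioo 0 (maxStep ρ))
    (x : H) : IsGenerated ι 𝒜 (resolvent ι 𝒜 μ x) (yosida (resolvent ι 𝒜) μ x) := by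
  have hc := h.isCoercive hμ
  refine ⟨hc.continuousLinearEquivOfBilin.symm (ι.adjoint x), by simp [resolvent, hc], ?_⟩
  ext w
  set v := hc.continuousLinearEquivOfBilin.symm (ι.adjoint x) with hv
  have e1 : inner ℝ (hc.continuousLinearEquivOfBilin v) w = resolventForm ι 𝒜 μ v w :=
    hc.continuousLinearEquivOfBilin_apply v w
  rw [hv, ContinuousLinearEquiv.apply_symm_apply, ContinuousLinearMap.adjoint_inner_left,
    resolventForm_apply, ← hv] at e1
  have e2 : resolvent ι 𝒜 μ x = ι v := by simp [resolvent, hc, hv]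
  have hμ0 := hμ.1.ne'
  rw [toDualV_apply, yosida_apply, e2, inner_smul_left, inner_sub_left, e1]
  simp only [conj_trivial]
  field_simp
  ring

theorem IsVHCoercive.resolvent_eq (h : IsVHCoercive ι 𝒜 ρ θ) (hμ : μ ∈ Ioo 0 (maxStep ρ))
    {x a : H} (hxa : IsGenerated ι 𝒜 x a) : resolvent ι 𝒜 μ (x - μ • a) = x := by
  have hc := h.isCoercive hμ
  obtain ⟨v, rfl, hv⟩ := hxa
  have : hc.continuousLinearEquivOfBilin v = ι.adjoint (ι v - μ • a) := by
    refine ext_inner_right ℝ fun w => ?_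
    rw [hc.continuousLinearEquivOfBilin_apply, ContinuousLinearMap.adjoint_inner_left,
      resolventForm_apply, hv, toDualV_apply, inner_sub_left, inner_smul_left]
    simp
  simp only [resolvent, hc, dif_pos, ContinuousLinearMap.comp_apply, ← this]
  simp

theorem IsVHCoercive.resolvent_of_isGenerated (h : IsVHCoercive ι 𝒜 ρ θ)
    (hμ : μ ∈ Ioo 0 (maxStep ρ)) {x a : H} (hxa : IsGenerated ι 𝒜 x a) :
    yosida (resolvent ι 𝒜) μ x = resolvent ι 𝒜 μ a := by
  have h1 := h.resolvent_eq hμ hxa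
  rw [map_sub, map_smul, sub_eq_iff_eq_add] at h1
  rw [yosida_apply, h1, add_sub_cancel_left, inv_smul_smul₀ hμ.1.ne']

/-- With y = J_μ x, testing x = y - μAy with y gives ⟨x, y⟩ ≥ (1 - μρ)‖y‖² ≥ ½‖y‖². -/
theorem IsVHCoercive.norm_resolvent_le (h : IsVHCoercive ι 𝒜 ρ θ)
    (hμ : μ ∈ Ioo 0 (maxStep ρ)) : ‖resolvent ι 𝒜 μ‖ ≤ 2 := by
  refine ContinuousLinearMap.opNorm_le_bound _ (by norm_num) fun x => ?_
  have h1 := h.inner_le (h.resolvent_spec hμ x)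
  set y := resolvent ι 𝒜 μ x with hy
  have h2 : x = y - μ • yosida (resolvent ι 𝒜) μ x := by
    rw [yosida_apply, smul_inv_smul₀ hμ.1.ne']; abel
  have h3 : inner ℝ x y = ‖y‖ ^ 2 - μ * inner ℝ (yosida (resolvent ι 𝒜) μ x) y := by
    conv_lhs => rw [h2]
    rw [inner_sub_left, inner_smul_left, real_inner_self_eq_norm_sq]; simp
  have h4 := real_inner_le_norm x y
  have h5 := mul_le_mul_of_nonneg_left h1 hμ.1.le
  have h6 := mul_le_mul_of_nonneg_right (h.mul_le hμ) (sq_nonneg ‖y‖)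
  have h7 : ‖y‖ * ‖y‖ ≤ (2 * ‖x‖) * ‖y‖ := by nlinarith
  rcases (norm_nonneg y).eq_or_lt with h0 | h0
  · rw [← h0]; positivity
  · exact le_of_mul_le_mul_right h7 h0

/-- Evaluate ⟨𝒜v, w⟩ = ⟨𝒜*w, v⟩ at the Lax–Milgram solutions of the two problems; both sides are
inner products in H. -/
theorem IsVHCoercive.adjoint_resolvent (h : IsVHCoercive ι 𝒜 ρ θ) (hμ : μ ∈ Ioo 0 (maxStep ρ)) :
    (resolvent ι 𝒜 μ).adjoint = resolvent ι 𝒜.flip μ := by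
  symm
  rw [ContinuousLinearMap.eq_adjoint_iff]
  intro φ x
  obtain ⟨v, hv, hv'⟩ := h.resolvent_spec hμ x
  obtain ⟨w, hw, hw'⟩ := h.flip.resolvent_spec hμ φ
  have e : 𝒜.flip w v = 𝒜 v w := rfl
  rw [hv', hw', toDualV_apply, toDualV_apply, hv, hw, yosida_apply, yosida_apply,
    inner_smul_left, inner_smul_left, inner_sub_left, inner_sub_left] at e
  have hμ0 := hμ.1.ne'
  have e2 := mul_left_cancel₀ (by simpa using hμ0) e
  rw [real_inner_comm (resolvent ι 𝒜 μ x) (resolvent ι 𝒜.flip μ φ)] at e2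
  rw [real_inner_comm x]; linarith

theorem IsVHCoercive.adjoint_yosida (h : IsVHCoercive ι 𝒜 ρ θ) (hμ : μ ∈ Ioo 0 (maxStep ρ)) :
    (yosida (resolvent ι 𝒜) μ).adjoint = yosida (resolvent ι 𝒜.flip) μ := by
  symm
  rw [ContinuousLinearMap.eq_adjoint_iff]
  intro φ x
  rw [yosida_apply, yosida_apply, inner_smul_left, inner_smul_right, inner_sub_left,
    inner_sub_right, ← h.adjoint_resolvent hμ, ContinuousLinearMap.adjoint_inner_left]
  rfl

/-- A vector orthogonal to the range is annihilated by the adjoint, which is the resolvent of the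
flipped form. If that resolvent maps φ to 0, then its solution in V is 0, and the equation returns φ
= 0. -/
theorem IsVHCoercive.denseRange_resolvent (h : IsVHCoercive ι 𝒜 ρ θ)
    (hinj : Function.Injective ι) (hι : DenseRange ι)
    (hμ : μ ∈ Ioo 0 (maxStep ρ)) : DenseRange (resolvent ι 𝒜 μ) := by
  have : Dense ((resolvent ι 𝒜 μ).range : Set H) := by
    rw [Submodule.dense_iff_topologicalClosure_eq_top, Submodule.topologicalClosure_eq_top_iff,
      Submodule.eq_bot_iff]
    intro φ hφ
    have h0 : resolvent ι 𝒜.flip μ φ = 0 := by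
      rw [← h.adjoint_resolvent hμ]
      refine ext_inner_left ℝ fun x => ?_
      rw [ContinuousLinearMap.adjoint_inner_right, inner_zero_right]
      exact (Submodule.mem_orthogonal _ _).1 hφ _ ⟨x, rfl⟩
    obtain ⟨v, hv, hv'⟩ := h.flip.resolvent_spec hμ φ
    rw [h0] at hv
    have hv0 : v = 0 := hinj (hv.trans (map_zero ι).symm)
    rw [hv0, map_zero, yosida_apply, h0, zero_sub] at hv'
    have h2 : toDualV ι 0 = toDualV ι (μ⁻¹ • -φ) := by
      rw [← hv']; ext; simp [toDualV]
    have h3 := toDualV_injective hι h2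
    have := smul_eq_zero.1 h3.symm
    rcases this with h4 | h4
    · exact absurd h4 (inv_ne_zero hμ.1.ne')
    · simpa using h4
  have e : ((resolvent ι 𝒜 μ).range : Set H) = range (resolvent ι 𝒜 μ) := by ext; simp
  rwa [e] at this

theorem IsVHCoercive.isResolventFamily (h : IsVHCoercive ι 𝒜 ρ θ)
    (hinj : Function.Injective ι) (hι : DenseRange ι) :
    IsResolventFamily (resolvent ι 𝒜) ρ (maxStep ρ) where
  nonneg := h.1
  pos := h.maxStep_pos
  norm_le := fun μ hμ => h.norm_resolvent_le hμ
  inner_le := fun μ hμ x => h.inner_le (h.resolvent_spec hμ x)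
  resolvent := fun μ hμ τ hτ x => (h.resolvent_of_isGenerated hμ (h.resolvent_spec hτ x)).symm
  tendsto := fun x => by
    set ν := maxStep ρ / 2 with hνd
    have hpos := h.maxStep_pos
    have hν : ν ∈ Ioo 0 (maxStep ρ) := ⟨by positivity, by linarith⟩
    -- On y = J_ν z one has J_μ y - y = μ J_μ A y → 0. Density and ‖J_μ‖ ≤ 2 extend this to x:
    -- replacing x by y costs at most 3·ε/6, and the convergence at y at most ε/3.
    rw [Metric.tendsto_nhds]
    intro ε hε
    obtain ⟨z, hz⟩ := (h.denseRange_resolvent hinj hι hν).exists_dist_lt x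
      (show 0 < ε / 6 by positivity)
    set y := resolvent ι 𝒜 ν z with hy
    set a := yosida (resolvent ι 𝒜) ν z with ha
    have hsm : ∀ᶠ μ in 𝓝[>] (0 : ℝ), 2 * μ * ‖a‖ < ε / 3 := by
      have : Tendsto (fun μ : ℝ => 2 * μ * ‖a‖) (𝓝[>] 0) (𝓝 (2 * 0 * ‖a‖)) :=
        (Continuous.tendsto (by fun_prop) 0).mono_left nhdsWithin_le_nhds
      refine this.eventually_lt_const ?_
      simp; positivity
    filter_upwards [hsm, Ioo_mem_nhdsGT hpos] with μ hμa hμ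
    have e1 : resolvent ι 𝒜 μ y - y = μ • resolvent ι 𝒜 μ a := by
      rw [← h.resolvent_of_isGenerated hμ (h.resolvent_spec hν z), yosida_apply,
        smul_inv_smul₀ hμ.1.ne']
    have hb : ∀ w, ‖resolvent ι 𝒜 μ w‖ ≤ 2 * ‖w‖ := fun w =>
      ContinuousLinearMap.le_of_opNorm_le _ (h.norm_resolvent_le hμ) w
    have e2 : ‖resolvent ι 𝒜 μ y - y‖ < ε / 3 := by
      rw [e1, norm_smul, Real.norm_of_nonneg hμ.1.le]
      nlinarith [hb a, hμ.1]
    have e3 : resolvent ι 𝒜 μ x - x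
        = resolvent ι 𝒜 μ (x - y) + (resolvent ι 𝒜 μ y - y) - (x - y) := by
      rw [map_sub]; abel
    rw [dist_eq_norm] at hz ⊢
    rw [e3]
    have := hb (x - y)
    have h5 := norm_sub_le (resolvent ι 𝒜 μ (x - y) + (resolvent ι 𝒜 μ y - y)) (x - y)
    have h6 := norm_add_le (resolvent ι 𝒜 μ (x - y)) (resolvent ι 𝒜 μ y - y)
    linarith

theorem timeMeasure_eq (T : ℝ) : timeMeasure T = volume.restrict (Ioc 0 T) := by
  rw [timeMeasure, restrict_Ioo_eq_restrict_Ioc]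

/-- Elements of `W(0,T; V, V')` which solve an evolution equation, smoothed by a resolvent. -/
theorem MemW.isPrimitive {T : ℝ} (hT : 0 ≤ T) {w : ℝ → H} {wV : ℝ → V} {dw : ℝ → StrongDual ℝ V}
    (hw : MemW ι T w wV dw) {F : ℝ → H} (hF : MemL2 F 0 T)
    (heq : ∀ᵐ t ∂timeMeasure T, dw t = 𝒜 (wV t) + toDualV ι (F t)) {R S : H →L[ℝ] H}
    (hRS : ∀ φ, ∃ v, ι v = R.adjoint φ ∧ 𝒜.flip v = toDualV ι (S.adjoint φ)) :
    IsPrimitive (fun t => R (w t)) (fun t => S (w t) + R (F t)) 0 T := by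
  have hdw : MemL2 dw 0 T := by
    have := hw.memLp_dual; rwa [timeMeasure_eq] at this
  have hcoe := hw.coe_eq
  rw [timeMeasure_eq] at heq hcoe
  have hint : ∀ t ∈ Icc 0 T, IntervalIntegrable (fun s => S (w s) + R (F s)) volume 0 t :=
    fun t ht => (((hw.continuousOn.memL2.clm S).add (hF.clm R)).mono le_rfl
      ht.2).intervalIntegrable ht.1
  refine ⟨hint T ⟨hT, le_rfl⟩, fun t ht => ext_inner_left ℝ fun φ => ?_⟩
  -- `R.adjoint φ` is represented by v ∈ V in the domain of the adjoint operator. The V'-valued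
  -- equation may be tested with v, and 𝒜 is then moved onto v, leaving only inner products in H.
  obtain ⟨v, hv, hv'⟩ := hRS φ
  have h1 := congrArg (fun l : StrongDual ℝ V => l v) (hw.deriv_eq t ht)
  have hdwt : IntervalIntegrable dw volume 0 t := (hdw.mono le_rfl ht.2).intervalIntegrable ht.1
  simp only [_root_.add_apply, toDualV_apply, hv] at h1
  rw [ContinuousLinearMap.intervalIntegral_apply hdwt] at h1
  have h2 : ∫ s in (0 : ℝ)..t, dw s v = ∫ s in (0 : ℝ)..t, inner ℝ φ (S (w s) + R (F s)) := by
    refine intervalIntegral.integral_congr_ae ?_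
    have h3 := (ae_restrict_iff' measurableSet_Ioc).1 (heq.and hcoe)
    filter_upwards [h3] with s hs hst
    rw [uIoc_of_le ht.1] at hst
    obtain ⟨hs1, hs2⟩ := hs ⟨hst.1, hst.2.trans ht.2⟩
    have h4 : 𝒜 (wV s) v = 𝒜.flip v (wV s) := rfl
    rw [hs1, _root_.add_apply, h4, hv', toDualV_apply, toDualV_apply, hv, hs2,
      ContinuousLinearMap.adjoint_inner_left, inner_add_right,
      ContinuousLinearMap.adjoint_inner_right, real_inner_comm φ (R (F s))]
  have h5 : ∫ s in (0 : ℝ)..t, inner ℝ φ (S (w s) + R (F s))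
      = inner ℝ φ (∫ s in (0 : ℝ)..t, (S (w s) + R (F s))) :=
    (innerSL ℝ φ).intervalIntegral_comp_comm (hint t ht)
  rw [h2, h5, ContinuousLinearMap.adjoint_inner_right, ContinuousLinearMap.adjoint_inner_right,
    real_inner_comm, real_inner_comm _ (R (w 0))] at h1
  rw [inner_add_right]
  exact h1

theorem IsVHCoercive.isMild_of_memW (h : IsVHCoercive ι 𝒜 ρ θ) {T : ℝ} (hT : 0 ≤ T) {w : ℝ → H}
    {wV : ℝ → V} {dw : ℝ → StrongDual ℝ V}
    (hw : MemW ι T w wV dw) {F : ℝ → H} (hF : MemL2 F 0 T)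
    (heq : ∀ᵐ t ∂timeMeasure T, dw t = 𝒜 (wV t) + toDualV ι (F t)) :
    IsMild (resolvent ι 𝒜) (maxStep ρ) F w 0 T :=
  ⟨hw.continuousOn, fun μ hμ => hw.isPrimitive hT hF heq fun φ => by
    rw [h.adjoint_resolvent hμ, h.adjoint_yosida hμ]
    exact h.flip.resolvent_spec hμ φ⟩

/-- Solutions of the backward adjoint equation `-w' = 𝒜* w + G`, smoothed by a resolvent. -/
theorem IsVHCoercive.isPrimitive_adjoint (h : IsVHCoercive ι 𝒜 ρ θ) {T : ℝ} (hT : 0 ≤ T)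
    {w : ℝ → H}
    {wV : ℝ → V} {dw : ℝ → StrongDual ℝ V}
    (hw : MemW ι T w wV dw) {G : ℝ → H} (hG : MemL2 G 0 T)
    (heq : ∀ᵐ t ∂timeMeasure T, -dw t = 𝒜.flip (wV t) + toDualV ι (G t))
    (hμ : μ ∈ Ioo 0 (maxStep ρ)) :
    IsPrimitive (fun t => (resolvent ι 𝒜 μ).adjoint (w t))
      (fun t => -((yosida (resolvent ι 𝒜) μ).adjoint (w t)
        + (resolvent ι 𝒜 μ).adjoint (G t))) 0 T := by
  have h1 : IsPrimitive (fun t => (resolvent ι 𝒜 μ).adjoint (w t))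
      (fun t => (-(yosida (resolvent ι 𝒜) μ).adjoint) (w t)
        + (resolvent ι 𝒜 μ).adjoint (-G t)) 0 T := by
    -- Read forward in time, the equation is w' = (-𝒜*)w - G; the flip of -𝒜* is -𝒜, so
    -- `resolvent_spec` for 𝒜 itself supplies the test vectors.
    refine hw.isPrimitive (𝒜 := -𝒜.flip) hT (F := fun t => -G t) hG.neg ?_ fun φ => ?_
    · filter_upwards [heq] with t ht
      rw [← neg_neg (dw t), ht]
      ext v
      simp only [_root_.neg_apply, _root_.add_apply, toDualV_apply, inner_neg_left]
      ring
    · obtain ⟨v, hv, hv'⟩ := h.resolvent_spec hμ φ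
      refine ⟨v, by rw [hv, ContinuousLinearMap.adjoint_adjoint], ?_⟩
      rw [map_neg, ContinuousLinearMap.adjoint_adjoint]
      ext u
      have : (-𝒜.flip).flip v u = -(𝒜 v u) := rfl
      rw [this, hv', toDualV_apply, toDualV_apply, _root_.neg_apply, inner_neg_left]
  refine h1.congr hT (fun _ _ => rfl) (ae_of_all _ fun t _ => ?_)
  simp only [_root_.neg_apply, map_neg]
  abel

end Resolvent

end

/-! ### Riccati and offset identities along mild solutions, and completion of the square -/

section

section

variable {H : Type*} [NormedAddCommGroup H] [InnerProductSpace ℝ H] {J : ℝ → H →L[ℝ] H} {ρ μ₀ : ℝ}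

theorem isSymm_of_isPositive {S : H →L[ℝ] H} (hS : S.IsPositive) (x z : H) :
    inner ℝ (S x) z = inner ℝ x (S z) := hS.1 x z

theorem IsResolventFamily.tendsto_comp (hJ : IsResolventFamily J ρ μ₀) {τ : ℕ → ℝ}
    (hτ : Tendsto τ atTop (𝓝[>] 0)) (hτm : ∀ k, τ k ∈ Ioo 0 μ₀) (x : H) :
    Tendsto (fun k => J (τ k) (J (τ k) x)) atTop (𝓝 x) := by
  rw [tendsto_iff_norm_sub_tendsto_zero]
  have h1 := (hJ.tendsto_apply_sub hτ x).norm.const_mul 3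
  rw [norm_zero, mul_zero] at h1
  refine squeeze_zero (fun _ => norm_nonneg _) (fun k => ?_) h1
  have e : J (τ k) (J (τ k) x) - x = J (τ k) (J (τ k) x - x) + (J (τ k) x - x) := by
    rw [map_sub]; abel
  rw [e]
  have h2 := hJ.norm_apply_le (hτm k) (J (τ k) x - x)
  linarith [norm_add_le (J (τ k) (J (τ k) x - x)) (J (τ k) x - x)]

theorem IsResolventFamily.norm_comp_le (hJ : IsResolventFamily J ρ μ₀) {μ : ℝ}
    (hμ : μ ∈ Ioo 0 μ₀) (x : H) : ‖J μ (J μ x)‖ ≤ 4 * ‖x‖ := by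
  have h1 := hJ.norm_apply_le hμ (J μ x)
  have h2 := hJ.norm_apply_le hμ x
  linarith

end

variable {H U : Type*} [NormedAddCommGroup H] [InnerProductSpace ℝ H] [CompleteSpace H]
  [NormedAddCommGroup U] [InnerProductSpace ℝ U] [CompleteSpace U]

/-- The Riccati equation, tested with pairs of equal elements of the range of a resolvent. -/
structure IsRiccati (J : ℝ → H →L[ℝ] H) (μ₀ : ℝ) (B : U →L[ℝ] H) (Q P : H →L[ℝ] H) (T : ℝ)
    (Pi : ℝ → H →L[ℝ] H) : Prop where
  continuousOn : ∀ x : H, ContinuousOn (fun t => Pi t x) (Icc 0 T)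
  isPositive : ∀ t ∈ Icc 0 T, (Pi t).IsPositive
  initial : Pi 0 = P.adjoint ∘L P
  equation : ∀ μ ∈ Ioo 0 μ₀, ∀ z, ∀ t ∈ Icc 0 T,
    HasDerivWithinAt (fun s => inner ℝ (Pi s (J μ z)) (J μ z))
      (2 * inner ℝ (Pi t (yosida J μ z)) (J μ z) - ‖B.adjoint (Pi t (J μ z))‖ ^ 2
        + ‖Q (J μ z)‖ ^ 2) (Icc 0 T) t

/-- The equation for the offset, smoothed by the adjoints of the resolvents. -/
structure IsOffset (J : ℝ → H →L[ℝ] H) (μ₀ : ℝ) (B : U →L[ℝ] H) (T : ℝ)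
    (Pi : ℝ → H →L[ℝ] H) (r h : ℝ → H) : Prop where
  continuousOn : ContinuousOn h (Icc 0 T)
  terminal : h T = 0
  primitive : ∀ μ ∈ Ioo 0 μ₀, IsPrimitive (fun t => (J μ).adjoint (h t))
    (fun t => -((yosida J μ).adjoint (h t)
      + (J μ).adjoint (Pi (T - t) (r t) - Pi (T - t) (B (B.adjoint (h t)))))) 0 T

variable {J : ℝ → H →L[ℝ] H} {ρ μ₀ T a : ℝ} {B : U →L[ℝ] H} {Q P : H →L[ℝ] H}
  {Pi : ℝ → H →L[ℝ] H} {F y r h : ℝ → H}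

theorem IsRiccati.reversed (hR : IsRiccati J μ₀ B Q P T Pi) (ha : 0 ≤ a) (x : H) :
    ContinuousOn (fun t => Pi (T - t) x) (Icc a T) :=
  (hR.continuousOn x).comp (by fun_prop) fun t ht => ⟨by linarith [ht.2], by linarith [ht.1]⟩

/-- Evolution of the quadratic form of a Riccati solution along a mild solution. -/
theorem IsRiccati.quadratic_identity (hJ : IsResolventFamily J ρ μ₀)
    (hR : IsRiccati J μ₀ B Q P T Pi) (ha : a ∈ Icc 0 T)
    (hy : IsMild J μ₀ F y a T) (hF : MemL2 F a T) :
    ‖P (y T)‖ ^ 2 - inner ℝ (Pi (T - a) (y a)) (y a)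
      = ∫ s in a..T, (2 * inner ℝ (F s) (Pi (T - s) (y s))
          + ‖B.adjoint (Pi (T - s) (y s))‖ ^ 2 - ‖Q (y s)‖ ^ 2) := by
  obtain ⟨τ, hτ, hτm⟩ := hJ.exists_seq
  have hrev := fun x => hR.reversed ha.1 x
  have hmap : ∀ s ∈ Icc a T, T - s ∈ Icc 0 T := fun s hs =>
    ⟨by linarith [hs.2], by linarith [hs.1, ha.1]⟩
  have key : ∀ μ ∈ Ioo 0 μ₀,
      inner ℝ (Pi 0 (J μ (J μ (y T)))) (J μ (J μ (y T)))
        - inner ℝ (Pi (T - a) (J μ (J μ (y a)))) (J μ (J μ (y a)))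
      = ∫ s in a..T, (2 * inner ℝ (J μ (J μ (F s))) (Pi (T - s) (J μ (J μ (y s))))
          + ‖B.adjoint (Pi (T - s) (J μ (J μ (y s))))‖ ^ 2 - ‖Q (J μ (J μ (y s)))‖ ^ 2) := by
    intro μ hμ
    have hX := hy.primitive μ hμ
    have hXc := hX.continuousOn
    -- One factor J_μ makes y absolutely continuous; the second, placed in the coefficient J_μ* Π
    -- J_μ, puts the argument into the domain of A, where the Riccati equation may be tested. Time
    -- is reversed, hence the minus sign in D. The terms with A cancel because J_μ A_μ = A_μ J_μ.
    have hq := hX.quadratic_sub_quadratic ha.2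
      (M := fun s => (J μ).adjoint ∘L Pi (T - s) ∘L J μ)
      (D := fun s z => -(2 * inner ℝ (Pi (T - s) (yosida J μ z)) (J μ z)
        - ‖B.adjoint (Pi (T - s) (J μ z))‖ ^ 2 + ‖Q (J μ z)‖ ^ 2)) ?_ ?_ ?_ ?_
    · simp only [ContinuousLinearMap.comp_apply, ContinuousLinearMap.adjoint_inner_left,
        sub_self] at hq
      rw [hq]
      refine intervalIntegral.integral_congr fun s hs => ?_
      rw [uIcc_of_le ha.2] at hs
      have hs1 := isSymm_of_isPositive (hR.isPositive _ (hmap s hs)) (yosida J μ (J μ (y s)))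
        (J μ (J μ (y s)))
      have hs2 : J μ (yosida J μ (y s)) = yosida J μ (J μ (y s)) := hJ.resolvent μ hμ μ hμ _
      simp only [ContinuousLinearMap.adjoint_inner_right, map_add, inner_add_left, hs1, hs2]
      ring
    · intro x
      exact (J μ).adjoint.continuous.comp_continuousOn (hrev (J μ x))
    · intro t ht x z
      simp only [ContinuousLinearMap.comp_apply, ContinuousLinearMap.adjoint_inner_left,
        ContinuousLinearMap.adjoint_inner_right]
      exact isSymm_of_isPositive (hR.isPositive _ (hmap t ht)) _ _
    · intro z t ht
      have h1 := (hR.equation μ hμ z (T - t) (hmap t ht)).comp t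
        ((hasDerivWithinAt_id t (Icc a T)).const_sub T) hmap
      simp only [ContinuousLinearMap.comp_apply, ContinuousLinearMap.adjoint_inner_left]
      simpa [Function.comp_def] using h1
    · have c1 : ∀ L : H →L[ℝ] H, ContinuousOn (fun p : ℝ × ℝ => L (J μ (y p.2)))
          (Icc a T ×ˢ Icc a T) := fun L =>
        L.continuous.comp_continuousOn (hXc.comp continuousOn_snd fun p hp => hp.2)
      have c2 : ∀ L : H →L[ℝ] H, ContinuousOn (fun p : ℝ × ℝ => Pi (T - p.1) (L (J μ (y p.2))))
          (Icc a T ×ˢ Icc a T) := fun L =>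
        ContinuousOn.strong_apply hR.continuousOn (τ := fun p : ℝ × ℝ => T - p.1)
          (by fun_prop) (fun p hp => hmap _ hp.1) (c1 L)
      have c3 : ContinuousOn (fun p : ℝ × ℝ => 2 * inner ℝ (Pi (T - p.1) (yosida J μ (J μ (y p.2))))
          (J μ (J μ (y p.2)))) (Icc a T ×ˢ Icc a T) := (((c2 (yosida J μ)).inner (c1 (J μ))).const_mul 2)
      have c4 := (B.adjoint.continuous.comp_continuousOn (c2 (J μ))).norm.pow 2
      have c5 := (Q.continuous.comp_continuousOn (c1 (J μ))).norm.pow 2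
      exact ((c3.sub c4).add c5).neg
  obtain ⟨C, hC0, hC⟩ := exists_norm_le_of_strongly_continuousOn hrev
  obtain ⟨Y, hY⟩ := isCompact_Icc.exists_bound_of_continuousOn hy.continuousOn
  have hT : T ∈ Icc a T := ⟨ha.2, le_rfl⟩
  have ha' : a ∈ Icc a T := ⟨le_rfl, ha.2⟩
  have hlim := fun x => hJ.tendsto_comp hτ hτm x
  have hlimPi : ∀ t x, Tendsto (fun k => Pi t (J (τ k) (J (τ k) x))) atTop (𝓝 (Pi t x)) :=
    fun t x => ((Pi t).continuous.tendsto _).comp (hlim x)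
  have hyM : MemL2 y a T := hy.continuousOn.memL2
  have lhs : Tendsto (fun k => inner ℝ (Pi 0 (J (τ k) (J (τ k) (y T)))) (J (τ k) (J (τ k) (y T)))
        - inner ℝ (Pi (T - a) (J (τ k) (J (τ k) (y a)))) (J (τ k) (J (τ k) (y a)))) atTop
      (𝓝 (inner ℝ (Pi 0 (y T)) (y T) - inner ℝ (Pi (T - a) (y a)) (y a))) :=
    ((hlimPi _ _).inner (hlim _)).sub ((hlimPi _ _).inner (hlim _))
  have e0 : inner ℝ (Pi 0 (y T)) (y T) = ‖P (y T)‖ ^ 2 := by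
    rw [hR.initial, ContinuousLinearMap.comp_apply, ContinuousLinearMap.adjoint_inner_left,
      real_inner_self_eq_norm_sq]
  rw [e0] at lhs
  refine tendsto_nhds_unique lhs ?_
  simp only [fun k => key (τ k) (hτm k)]
  have m1 : ∀ {G : ℝ → H}, MemL2 G a T → ∀ k, MemL2 (fun s => J (τ k) (J (τ k) (G s))) a T :=
    fun hG k => (hG.clm (J (τ k))).clm (J (τ k))
  have m2 : ∀ k, MemL2 (fun s => Pi (T - s) (J (τ k) (J (τ k) (y s)))) a T := fun k =>
    (m1 hyM k).strong_apply ha.2 hrev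
  -- Limit μ → 0 along τ: J_μ² → 1 strongly and ‖J_μ²‖ ≤ 4, so the majorant is affine in ‖F‖.
  refine intervalIntegral.tendsto_integral_filter_of_dominated_convergence
    (fun s => 2 * (4 * ‖F s‖ * (C * (4 * Y))) + (‖B.adjoint‖ * (C * (4 * Y))) ^ 2
      + (‖Q‖ * (4 * Y)) ^ 2) (Eventually.of_forall fun k => ?_)
    (Eventually.of_forall fun k => ae_of_all _ fun s hs => ?_) ?_
    (ae_of_all _ fun s _ => ?_)
  · rw [uIoc_of_le ha.2]
    exact (((m1 hF k).1.inner (m2 k).1).const_mul 2).add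
      (((m2 k).clm B.adjoint).1.norm.pow 2) |>.sub (((m1 hyM k).clm Q).1.norm.pow 2)
  · rw [uIoc_of_le ha.2] at hs
    have hs' := Ioc_subset_Icc_self hs
    have b1 := hJ.norm_comp_le (hτm k) (F s)
    have b2 : ‖J (τ k) (J (τ k) (y s))‖ ≤ 4 * Y :=
      (hJ.norm_comp_le (hτm k) (y s)).trans (by linarith [hY s hs'])
    have b3 : ‖Pi (T - s) (J (τ k) (J (τ k) (y s)))‖ ≤ C * (4 * Y) :=
      ((Pi (T - s)).le_of_opNorm_le (hC s hs') _).trans (mul_le_mul_of_nonneg_left b2 hC0)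
    have b4 : ‖B.adjoint (Pi (T - s) (J (τ k) (J (τ k) (y s))))‖ ≤ ‖B.adjoint‖ * (C * (4 * Y)) :=
      (B.adjoint.le_opNorm _).trans (mul_le_mul_of_nonneg_left b3 (norm_nonneg _))
    have b5 : ‖Q (J (τ k) (J (τ k) (y s)))‖ ≤ ‖Q‖ * (4 * Y) :=
      (Q.le_opNorm _).trans (mul_le_mul_of_nonneg_left b2 (norm_nonneg _))
    have b6 : |inner ℝ (J (τ k) (J (τ k) (F s))) (Pi (T - s) (J (τ k) (J (τ k) (y s))))|
        ≤ 4 * ‖F s‖ * (C * (4 * Y)) :=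
      (abs_real_inner_le_norm _ _).trans (mul_le_mul b1 b3 (norm_nonneg _) (by positivity))
    have b7 := pow_le_pow_left₀ (norm_nonneg _) b4 2
    have b8 := pow_le_pow_left₀ (norm_nonneg _) b5 2
    have b9 := abs_le.1 b6
    rw [Real.norm_eq_abs, abs_le]
    constructor
    · nlinarith [sq_nonneg ‖B.adjoint (Pi (T - s) (J (τ k) (J (τ k) (y s))))‖,
        sq_nonneg (‖B.adjoint‖ * (C * (4 * Y)))]
    · nlinarith [sq_nonneg ‖Q (J (τ k) (J (τ k) (y s)))‖, sq_nonneg (‖Q‖ * (4 * Y))]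
  · exact (((((hF.intervalIntegrable ha.2).norm.const_mul 4).mul_const _).const_mul 2).add
      _root_.intervalIntegrable_const).add _root_.intervalIntegrable_const
  · refine (((hlim _).inner (hlimPi _ _)).const_mul 2).add
      (((B.adjoint.continuous.tendsto _).comp (hlimPi _ _)).norm.pow 2) |>.sub
      (((Q.continuous.tendsto _).comp (hlim _)).norm.pow 2)

/-- The inhomogeneity in the equation for the offset. -/
theorem IsOffset.memL2 (hR : IsRiccati J μ₀ B Q P T Pi) (hh : IsOffset J μ₀ B T Pi r h)
    (hr : MemL2 r 0 T) (ha : a ∈ Icc 0 T) :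
    MemL2 (fun t => Pi (T - t) (r t) - Pi (T - t) (B (B.adjoint (h t)))) a T := by
  have h0 : MemL2 (fun t => Pi (T - t) (r t) - Pi (T - t) (B (B.adjoint (h t)))) 0 T := by
    have hT := ha.1.trans ha.2
    refine (hr.strong_apply hT fun x => hR.reversed le_rfl x).sub ?_
    exact ((hh.continuousOn.memL2.clm B.adjoint).clm B).strong_apply hT
      fun x => hR.reversed le_rfl x
  exact h0.mono ha.1 le_rfl

/-- Evolution of the pairing of an offset with a mild solution. -/
theorem IsOffset.pairing_identity (hJ : IsResolventFamily J ρ μ₀)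
    (hR : IsRiccati J μ₀ B Q P T Pi) (hh : IsOffset J μ₀ B T Pi r h)
    (hr : MemL2 r 0 T) (ha : a ∈ Icc 0 T)
    (hy : IsMild J μ₀ F y a T) (hF : MemL2 F a T) :
    -inner ℝ (h a) (y a) = ∫ s in a..T, (inner ℝ (h s) (F s)
      - inner ℝ (Pi (T - s) (r s) - Pi (T - s) (B (B.adjoint (h s)))) (y s)) := by
  obtain ⟨τ, hτ, hτm⟩ := hJ.exists_seq
  have hG := hh.memL2 hR hr ha
  set G : ℝ → H := fun t => Pi (T - t) (r t) - Pi (T - t) (B (B.adjoint (h t))) with hGd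
  -- The pairing ⟨J_μ* h, J_μ y⟩ = ⟨h, J_μ² y⟩ is differentiated; the generator terms of the adjoint
  -- and the forward equation cancel, and h(T) = 0 removes the upper boundary term.
  have key : ∀ μ ∈ Ioo 0 μ₀, -inner ℝ (h a) (J μ (J μ (y a)))
      = ∫ s in a..T, (inner ℝ (h s) (J μ (J μ (F s))) - inner ℝ (G s) (J μ (J μ (y s)))) := by
    intro μ hμ
    have hq := ((hh.primitive μ hμ).mono ha.1 ha.2 le_rfl).inner_sub_inner ha.2 (hy.primitive μ hμ)
    rw [hh.terminal, map_zero, inner_zero_left, zero_sub,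
      ContinuousLinearMap.adjoint_inner_left] at hq
    rw [hq]
    refine intervalIntegral.integral_congr fun s _ => ?_
    have hs2 : J μ (yosida J μ (y s)) = yosida J μ (J μ (y s)) := hJ.resolvent μ hμ μ hμ _
    simp only [inner_neg_left, inner_add_left, inner_add_right,
      ContinuousLinearMap.adjoint_inner_left, hs2, hGd]
    ring
  have hhc : ContinuousOn h (Icc a T) := hh.continuousOn.mono (Icc_subset_Icc ha.1 le_rfl)
  obtain ⟨C, hC⟩ := isCompact_Icc.exists_bound_of_continuousOn hhc
  obtain ⟨Y, hY⟩ := isCompact_Icc.exists_bound_of_continuousOn hy.continuousOn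
  have hlim := fun x => hJ.tendsto_comp hτ hτm x
  have hyM : MemL2 y a T := hy.continuousOn.memL2
  have lhs : Tendsto (fun k => -inner ℝ (h a) (J (τ k) (J (τ k) (y a)))) atTop
      (𝓝 (-inner ℝ (h a) (y a))) := (tendsto_const_nhds.inner (hlim _)).neg
  refine tendsto_nhds_unique lhs ?_
  simp only [fun k => key (τ k) (hτm k)]
  have m1 : ∀ {G : ℝ → H}, MemL2 G a T → ∀ k, MemL2 (fun s => J (τ k) (J (τ k) (G s))) a T :=
    fun hG k => (hG.clm (J (τ k))).clm (J (τ k))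
  refine intervalIntegral.tendsto_integral_filter_of_dominated_convergence
    (fun s => C * (4 * ‖F s‖) + ‖G s‖ * (4 * Y)) (Eventually.of_forall fun k => ?_)
    (Eventually.of_forall fun k => ae_of_all _ fun s hs => ?_) ?_
    (ae_of_all _ fun s _ => ?_)
  · rw [uIoc_of_le ha.2]
    exact (hhc.memL2.1.inner (m1 hF k).1).sub (hG.1.inner (m1 hyM k).1)
  · rw [uIoc_of_le ha.2] at hs
    have hs' := Ioc_subset_Icc_self hs
    have b2 : ‖J (τ k) (J (τ k) (y s))‖ ≤ 4 * Y :=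
      (hJ.norm_comp_le (hτm k) (y s)).trans (by linarith [hY s hs'])
    have b1 := hJ.norm_comp_le (hτm k) (F s)
    have b0 := hC s hs'
    refine (norm_sub_le _ _).trans (add_le_add ?_ ?_)
    · exact (norm_inner_le_norm _ _).trans
        (mul_le_mul b0 b1 (norm_nonneg _) ((norm_nonneg _).trans b0))
    · exact (norm_inner_le_norm _ _).trans (mul_le_mul_of_nonneg_left b2 (norm_nonneg _))
  · exact (((hF.intervalIntegrable ha.2).norm.const_mul 4).const_mul C).add
      ((hG.intervalIntegrable ha.2).norm.mul_const _)
  · exact (tendsto_const_nhds.inner (hlim _)).sub (tendsto_const_nhds.inner (hlim _))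

/-- The cost of the control `u` with state `y` on `[a, T]`. -/
def cost (Q P : H →L[ℝ] H) (T a : ℝ) (u : ℝ → U) (y : ℝ → H) : ℝ :=
  ‖P (y T)‖ ^ 2 + ∫ s in a..T, (‖Q (y s)‖ ^ 2 + ‖u s‖ ^ 2)

/-- The value function of the linear-quadratic problem with inhomogeneity `r`. -/
def value (B : U →L[ℝ] H) (T : ℝ) (Pi : ℝ → H →L[ℝ] H) (r h : ℝ → H) (a : ℝ) (x : H) : ℝ :=
  inner ℝ (Pi (T - a) x) x + 2 * inner ℝ (h a) x
    + ∫ s in a..T, (2 * inner ℝ (h s) (r s) - ‖B.adjoint (h s)‖ ^ 2)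

/-- Completion of the square. -/
theorem cost_eq_value_add (hJ : IsResolventFamily J ρ μ₀)
    (hR : IsRiccati J μ₀ B Q P T Pi) (hh : IsOffset J μ₀ B T Pi r h)
    (hr : MemL2 r 0 T) (ha : a ∈ Icc 0 T) {u : ℝ → U} (hu : ContinuousOn u (Icc a T))
    (hy : IsMild J μ₀ (fun s => B (u s) + r s) y a T) :
    cost Q P T a u y = value B T Pi r h a (y a)
      + ∫ s in a..T, ‖u s + B.adjoint (Pi (T - s) (y s)) + B.adjoint (h s)‖ ^ 2 := by
  have hra : MemL2 r a T := hr.mono ha.1 le_rfl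
  have hF : MemL2 (fun s => B (u s) + r s) a T := (hu.memL2.clm B).add hra
  have i1 := hR.quadratic_identity hJ ha hy hF
  have i2 := hh.pairing_identity hJ hR hr ha hy hF
  have hG := hh.memL2 hR hr ha
  have hrev := fun x => hR.reversed ha.1 x
  have hmap : ∀ s ∈ Icc a T, T - s ∈ Icc 0 T := fun s hs =>
    ⟨by linarith [hs.2], by linarith [hs.1, ha.1]⟩
  have hyc := hy.continuousOn
  have hhc : ContinuousOn h (Icc a T) := hh.continuousOn.mono (Icc_subset_Icc ha.1 le_rfl)
  have hPy : ContinuousOn (fun s => Pi (T - s) (y s)) (Icc a T) :=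
    ContinuousOn.strong_apply (τ := fun s => s) hrev continuousOn_id (fun s hs => hs) hyc
  have cc : ∀ {f : ℝ → ℝ}, ContinuousOn f (Icc a T) → IntervalIntegrable f volume a T :=
    fun hf => ContinuousOn.intervalIntegrable (by rwa [uIcc_of_le ha.2])
  have cBPy := B.adjoint.continuous.comp_continuousOn hPy
  have cBh := B.adjoint.continuous.comp_continuousOn hhc
  have cQ := Q.continuous.comp_continuousOn hyc
  have j1 := ((hF.intervalIntegrable ha.2).inner_continuousOn ha.2 hPy).const_mul 2
  have j2 : IntervalIntegrable (fun s => ‖B.adjoint (Pi (T - s) (y s))‖ ^ 2) volume a T :=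
    cc (cBPy.norm.pow 2)
  have j3 : IntervalIntegrable (fun s => ‖Q (y s)‖ ^ 2) volume a T := cc (cQ.norm.pow 2)
  have j4 := (hF.intervalIntegrable ha.2).continuousOn_inner ha.2 hhc
  have j5 := (hG.intervalIntegrable ha.2).inner_continuousOn ha.2 hyc
  have j6 := ((hra.intervalIntegrable ha.2).continuousOn_inner ha.2 hhc).const_mul 2
  have j7 : IntervalIntegrable (fun s => ‖B.adjoint (h s)‖ ^ 2) volume a T := cc (cBh.norm.pow 2)
  have j8 : IntervalIntegrable (fun s => ‖u s + B.adjoint (Pi (T - s) (y s)) + B.adjoint (h s)‖ ^ 2)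
      volume a T := cc ((hu.add cBPy).add cBh |>.norm.pow 2)
  -- An identity of integrands: expand the square and use self-adjointness of Π. The last two
  -- integrals are the right-hand sides of the quadratic and the pairing identity, and turn into the
  -- boundary terms of the value.
  have e : ∫ s in a..T, (‖Q (y s)‖ ^ 2 + ‖u s‖ ^ 2)
      = (∫ s in a..T, (2 * inner ℝ (h s) (r s) - ‖B.adjoint (h s)‖ ^ 2))
        + (∫ s in a..T, ‖u s + B.adjoint (Pi (T - s) (y s)) + B.adjoint (h s)‖ ^ 2)
        - (∫ s in a..T, (2 * inner ℝ (B (u s) + r s) (Pi (T - s) (y s))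
          + ‖B.adjoint (Pi (T - s) (y s))‖ ^ 2 - ‖Q (y s)‖ ^ 2))
        - 2 * ∫ s in a..T, (inner ℝ (h s) (B (u s) + r s)
      - inner ℝ (Pi (T - s) (r s) - Pi (T - s) (B (B.adjoint (h s)))) (y s)) := by
    rw [← intervalIntegral.integral_const_mul, ← intervalIntegral.integral_add (j6.sub j7) j8,
      ← intervalIntegral.integral_sub ((j6.sub j7).add j8) ((j1.add j2).sub j3),
      ← intervalIntegral.integral_sub (((j6.sub j7).add j8).sub ((j1.add j2).sub j3))
        ((j4.sub j5).const_mul 2)]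
    refine intervalIntegral.integral_congr fun s hs => ?_
    rw [uIcc_of_le ha.2] at hs
    have hsym := isSymm_of_isPositive (hR.isPositive _ (hmap s hs))
    have e1 : ‖u s + B.adjoint (Pi (T - s) (y s)) + B.adjoint (h s)‖ ^ 2
        = ‖u s‖ ^ 2 + ‖B.adjoint (Pi (T - s) (y s))‖ ^ 2 + ‖B.adjoint (h s)‖ ^ 2
          + 2 * inner ℝ (B (u s)) (Pi (T - s) (y s)) + 2 * inner ℝ (h s) (B (u s))
          + 2 * inner ℝ (B (B.adjoint (h s))) (Pi (T - s) (y s)) := by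
      rw [norm_add_sq_real, norm_add_sq_real, inner_add_left,
        ContinuousLinearMap.adjoint_inner_right, ContinuousLinearMap.adjoint_inner_right,
        real_inner_comm (B.adjoint (h s)) (B.adjoint (Pi (T - s) (y s))),
        ContinuousLinearMap.adjoint_inner_right B (B.adjoint (h s)), real_inner_comm (h s)]
      ring
    rw [e1]
    simp only [inner_add_left, inner_add_right, inner_sub_left, hsym]
    ring
  unfold cost value
  rw [e, ← i1, ← i2]
  ring

end

/-! ### The value function as an infimum of costs, and the uniform bounds on Π and h -/

section

variable {H U : Type*} [NormedAddCommGroup H] [InnerProductSpace ℝ H] [CompleteSpace H]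
  [NormedAddCommGroup U] [InnerProductSpace ℝ U] [CompleteSpace U]
  {J : ℝ → H →L[ℝ] H} {ρ μ₀ T a : ℝ} {B : U →L[ℝ] H} {Q P : H →L[ℝ] H}
  {Pi : ℝ → H →L[ℝ] H} {F y r h : ℝ → H}

/-- The iterated Volterra estimate: integrating (K(s - a))^m / m! and multiplying by K produces the
next term. -/
theorem le_pow_div_factorial_of_iterate {d : ℕ → ℝ → ℝ} {D K : ℝ}
    (hK : 0 ≤ K) (hd : ∀ m, ContinuousOn (d m) (Icc a T)) (h0 : ∀ s ∈ Icc a T, d 0 s ≤ D)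
    (hstep : ∀ m, ∀ s ∈ Icc a T, d (m + 1) s ≤ K * ∫ q in a..s, d m q) (m : ℕ) :
    ∀ s ∈ Icc a T, d m s ≤ D * ((K * (s - a)) ^ m / m.factorial) := by
  induction m with
  | zero => simpa using h0
  | succ m ih =>
    intro s hs
    have h1 : ∫ q in a..s, d m q ≤ ∫ q in a..s, D * ((K * (q - a)) ^ m / m.factorial) := by
      refine intervalIntegral.integral_mono_on hs.1 ?_ ?_ fun q hq => ih q ⟨hq.1, hq.2.trans hs.2⟩
      · exact ContinuousOn.intervalIntegrable (by
          rw [uIcc_of_le hs.1]; exact (hd m).mono (Icc_subset_Icc le_rfl hs.2))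
      · exact Continuous.intervalIntegrable (by fun_prop) _ _
    have h2 : ∫ q in a..s, D * ((K * (q - a)) ^ m / m.factorial)
        = D * (K ^ m / m.factorial) * ((s - a) ^ (m + 1) / (m + 1)) := by
      have e : ∀ q, D * ((K * (q - a)) ^ m / m.factorial)
          = D * (K ^ m / m.factorial) * (q - a) ^ m := fun q => by rw [mul_pow]; ring
      simp only [e]
      rw [intervalIntegral.integral_const_mul,
        intervalIntegral.integral_comp_sub_right (fun x => x ^ m) a, integral_pow]
      simp
    have h3 := (hstep m s hs).trans (mul_le_mul_of_nonneg_left (h1.trans h2.le) hK)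
    refine h3.trans (le_of_eq ?_)
    have : ((m + 1).factorial : ℝ) = (m + 1) * m.factorial := by
      push_cast [Nat.factorial_succ]; ring
    have hm : (m.factorial : ℝ) ≠ 0 := by positivity
    have hm' : (m + 1 : ℝ) ≠ 0 := by positivity
    rw [this, mul_pow K]
    field_simp
    ring

/-- Controls that satisfy the optimal feedback law up to an arbitrarily small error. -/
theorem exists_near_feedback (hJ : IsResolventFamily J ρ μ₀)
    (hR : IsRiccati J μ₀ B Q P T Pi) (hh : ContinuousOn h (Icc 0 T))
    (hr : MemL2 r 0 T) (ha : a ∈ Icc 0 T) (x : H) {ε : ℝ} (hε : 0 < ε) :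
    ∃ (u : ℝ → U) (y : ℝ → H), ContinuousOn u (Icc a T) ∧
      IsMild J μ₀ (fun s => B (u s) + r s) y a T ∧ y a = x ∧
      ∫ s in a..T, ‖u s + B.adjoint (Pi (T - s) (y s)) + B.adjoint (h s)‖ ^ 2 < ε := by
  have hra : MemL2 r a T := hr.mono ha.1 le_rfl
  have hrev := fun x => hR.reversed ha.1 x
  have hhc : ContinuousOn h (Icc a T) := hh.mono (Icc_subset_Icc ha.1 le_rfl)
  choose! Y hY hYa using fun (u : ℝ → U) (hu : ContinuousOn u (Icc a T)) =>
    hJ.exists_mild ha.2 ((hu.memL2.clm B).add hra) x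
  -- Φ evaluates the feedback law along the state produced by u. Its Picard iterates satisfy u_m -
  -- Φ(u_m) = u_m - u_{m+1}, so the defect in the feedback law is exactly the gap between
  -- consecutive iterates, and no fixed point has to be constructed.
  set Φ : (ℝ → U) → ℝ → U := fun u s => -(B.adjoint (Pi (T - s) (Y u s)) + B.adjoint (h s))
    with hΦ
  have hΦc : ∀ u, ContinuousOn u (Icc a T) → ContinuousOn (Φ u) (Icc a T) := fun u hu =>
    ((B.adjoint.continuous.comp_continuousOn (ContinuousOn.strong_apply (τ := fun s => s) hrev
      continuousOn_id (fun s hs => hs) (hY u hu).continuousOn)).add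
      (B.adjoint.continuous.comp_continuousOn hhc)).neg
  set u : ℕ → ℝ → U := fun m => Φ^[m] 0 with hu
  have hus : ∀ m, u (m + 1) = Φ (u m) := fun m => Function.iterate_succ_apply' Φ m 0
  have huc : ∀ m, ContinuousOn (u m) (Icc a T) := by
    intro m
    induction m with
    | zero => exact continuousOn_const
    | succ m ih => rw [hus]; exact hΦc _ ih
  obtain ⟨C, hC0, hC⟩ := exists_norm_le_of_strongly_continuousOn hrev
  set c := energyConst ρ (T - a) with hc
  have hc0 : 0 < c := energyConst_pos _ _
  set K := (‖B.adjoint‖ * C) ^ 2 * (c * ‖B‖ ^ 2) with hK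
  have hK0 : 0 ≤ K := by positivity
  set d : ℕ → ℝ → ℝ := fun m s => ‖u m s - u (m + 1) s‖ ^ 2 with hd
  have hdc : ∀ m, ContinuousOn (d m) (Icc a T) := fun m =>
    ((huc m).sub (huc (m + 1))).norm.pow 2
  obtain ⟨D, hD⟩ := isCompact_Icc.exists_bound_of_continuousOn (hdc 0)
  have hstep : ∀ m, ∀ s ∈ Icc a T, d (m + 1) s ≤ K * ∫ q in a..s, d m q := by
    intro m s hs
    have hm := (hY _ (huc m)).sub ha.2 (hY _ (huc (m + 1)))
    have hdm : MemL2 (fun s => u m s - u (m + 1) s) a T := (huc m).memL2.sub (huc (m + 1)).memL2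
    have hm' : IsMild J μ₀ (fun s => B (u m s - u (m + 1) s))
        (fun s => Y (u m) s - Y (u (m + 1)) s) a T :=
      hm.congr ha.2 (ae_of_all _ fun s _ => by rw [map_sub]; abel)
    have e1 := hJ.norm_sq_le (L := T - a) hs.1 (by linarith [hs.2])
      (hm'.mono le_rfl hs.1 hs.2) ((hdm.clm B).mono le_rfl hs.2)
    rw [hYa _ (huc m), hYa _ (huc (m + 1)), sub_self, norm_zero, zero_pow two_ne_zero,
      zero_add] at e1
    have e2 := integral_norm_sq_le_of_norm_le hs.1 ((hdm.clm B).mono le_rfl hs.2)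
      (hdm.mono le_rfl hs.2) (fun q _ => B.le_opNorm (u m q - u (m + 1) q))
    have e3 : u (m + 1) s - u (m + 1 + 1) s
        = -B.adjoint (Pi (T - s) (Y (u m) s - Y (u (m + 1)) s)) := by
      rw [hus, hus (m + 1)]
      simp only [hΦ, map_sub, hus]; abel
    have e4 : ‖u (m + 1) s - u (m + 1 + 1) s‖
        ≤ ‖B.adjoint‖ * C * ‖Y (u m) s - Y (u (m + 1)) s‖ := by
      rw [e3, norm_neg, mul_assoc]
      exact (B.adjoint.le_opNorm _).trans (mul_le_mul_of_nonneg_left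
        ((Pi (T - s)).le_of_opNorm_le (hC s hs) _) (norm_nonneg _))
    have e5 := pow_le_pow_left₀ (norm_nonneg _) e4 2
    rw [mul_pow] at e5
    calc d (m + 1) s ≤ _ := e5
      _ ≤ (‖B.adjoint‖ * C) ^ 2 * (c * (‖B‖ ^ 2 * ∫ q in a..s, d m q)) :=
        mul_le_mul_of_nonneg_left (e1.trans (mul_le_mul_of_nonneg_left e2 hc0.le)) (sq_nonneg _)
      _ = _ := by rw [hK]; ring
  have hbound := le_pow_div_factorial_of_iterate hK0 hdc
    (fun s hs => (le_abs_self _).trans (hD s hs)) hstep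
  have hD0 : 0 ≤ D := (norm_nonneg _).trans (hD a ⟨le_rfl, ha.2⟩)
  have hlim : Tendsto (fun m : ℕ => (T - a) * (D * ((K * (T - a)) ^ m / m.factorial))) atTop
      (𝓝 0) := by
    simpa using ((FloorSemiring.tendsto_pow_div_factorial_atTop
      (K * (T - a))).const_mul D).const_mul (T - a)
  obtain ⟨m, hm⟩ := (hlim.eventually_lt_const hε).exists
  refine ⟨u m, Y (u m), huc m, hY _ (huc m), hYa _ (huc m), lt_of_le_of_lt ?_ hm⟩
  have e : ∀ s, ‖u m s + B.adjoint (Pi (T - s) (Y (u m) s)) + B.adjoint (h s)‖ ^ 2 = d m s := by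
    intro s
    simp only [hd, hus m, hΦ]
    congr 2; abel
  simp only [e]
  have := intervalIntegral.integral_mono_on (μ := volume) (a := a) (b := T) ha.2
    (f := d m) (g := fun _ => D * ((K * (T - a)) ^ m / m.factorial))
    (ContinuousOn.intervalIntegrable (by rw [uIcc_of_le ha.2]; exact hdc m))
    _root_.intervalIntegrable_const fun s hs => (hbound m s hs).trans (by
      have h1 : 0 ≤ K * (s - a) := mul_nonneg hK0 (by linarith [hs.1])
      have h2 : K * (s - a) ≤ K * (T - a) := mul_le_mul_of_nonneg_left (by linarith [hs.2]) hK0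
      gcongr)
  rw [intervalIntegral.integral_const, smul_eq_mul] at this
  exact this

theorem cost_nonneg (u : ℝ → U) (y : ℝ → H) (ha : a ≤ T) : 0 ≤ cost Q P T a u y := by
  unfold cost
  have := intervalIntegral.integral_nonneg (μ := volume) ha
    (f := fun s => ‖Q (y s)‖ ^ 2 + ‖u s‖ ^ 2) fun s _ => by positivity
  positivity

theorem value_le_cost (hJ : IsResolventFamily J ρ μ₀)
    (hR : IsRiccati J μ₀ B Q P T Pi) (hh : IsOffset J μ₀ B T Pi r h)
    (hr : MemL2 r 0 T) (ha : a ∈ Icc 0 T) {u : ℝ → U} (hu : ContinuousOn u (Icc a T))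
    (hy : IsMild J μ₀ (fun s => B (u s) + r s) y a T) :
    value B T Pi r h a (y a) ≤ cost Q P T a u y := by
  rw [cost_eq_value_add hJ hR hh hr ha hu hy]
  have := integral_norm_sq_nonneg
    (fun s => u s + B.adjoint (Pi (T - s) (y s)) + B.adjoint (h s)) ha.2
  linarith

theorem exists_cost_lt (hJ : IsResolventFamily J ρ μ₀)
    (hR : IsRiccati J μ₀ B Q P T Pi) (hh : IsOffset J μ₀ B T Pi r h)
    (hr : MemL2 r 0 T) (ha : a ∈ Icc 0 T) (x : H) {c : ℝ} (hc : value B T Pi r h a x < c) :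
    ∃ (u : ℝ → U) (y : ℝ → H), ContinuousOn u (Icc a T) ∧
      IsMild J μ₀ (fun s => B (u s) + r s) y a T ∧ y a = x ∧ cost Q P T a u y < c := by
  obtain ⟨u, y, hu, hy, hya, hlt⟩ := exists_near_feedback hJ hR hh.continuousOn hr ha x
    (sub_pos.2 hc)
  refine ⟨u, y, hu, hy, hya, ?_⟩
  rw [cost_eq_value_add hJ hR hh hr ha hu hy, hya]
  linarith

theorem value_nonneg (hJ : IsResolventFamily J ρ μ₀)
    (hR : IsRiccati J μ₀ B Q P T Pi) (hh : IsOffset J μ₀ B T Pi r h)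
    (hr : MemL2 r 0 T) (ha : a ∈ Icc 0 T) (x : H) : 0 ≤ value B T Pi r h a x := by
  by_contra! hlt
  obtain ⟨u, y, -, -, -, h1⟩ := exists_cost_lt hJ hR hh hr ha x hlt
  exact absurd (cost_nonneg u y ha.2) (not_le.2 h1)

/-- The constant in the upper bound of the value function. -/
def valueConst (Q P : H →L[ℝ] H) (ρ T : ℝ) : ℝ :=
  (‖P‖ ^ 2 + T * ‖Q‖ ^ 2) * energyConst ρ T

theorem valueConst_nonneg (hT : 0 ≤ T) : 0 ≤ valueConst Q P ρ T :=
  mul_nonneg (by positivity) (energyConst_pos _ _).le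

/-- Compare with the control u = 0, whose state is bounded by the energy estimate with a constant
depending on A only through ρ. -/
theorem value_le (hJ : IsResolventFamily J ρ μ₀)
    (hR : IsRiccati J μ₀ B Q P T Pi) (hh : IsOffset J μ₀ B T Pi r h)
    (hr : MemL2 r 0 T) (ha : a ∈ Icc 0 T) (x : H) :
    value B T Pi r h a x ≤ valueConst Q P ρ T * (‖x‖ ^ 2 + ∫ s in (0 : ℝ)..T, ‖r s‖ ^ 2) := by
  have hra : MemL2 r a T := hr.mono ha.1 le_rfl
  have hT : 0 ≤ T := ha.1.trans ha.2
  obtain ⟨y, hy, rfl⟩ := hJ.exists_mild ha.2 hra x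
  have hy0 : IsMild J μ₀ (fun s => B ((fun _ => (0 : U)) s) + r s) y a T :=
    hy.congr ha.2 (ae_of_all _ fun s _ => by simp)
  refine (value_le_cost hJ hR hh hr ha continuousOn_const hy0).trans ?_
  set R := ‖y a‖ ^ 2 + ∫ s in (0 : ℝ)..T, ‖r s‖ ^ 2 with hRd
  have hR0 : 0 ≤ R := add_nonneg (by positivity) (integral_norm_sq_nonneg r hT)
  have hys : ∀ s ∈ Icc a T, ‖y s‖ ^ 2 ≤ energyConst ρ T * R := fun s hs => by
    refine (hJ.norm_sq_le (L := T) hs.1 (by linarith [hs.2, ha.1]) (hy.mono le_rfl hs.1 hs.2)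
      (hra.mono le_rfl hs.2)).trans (mul_le_mul_of_nonneg_left (add_le_add le_rfl ?_)
        (energyConst_pos _ _).le)
    exact intervalIntegral.integral_mono_interval ha.1 hs.1 hs.2
      (ae_of_all _ fun _ => by positivity) (hr.intervalIntegrable_norm_sq hT)
  have hL : ∀ (L : H →L[ℝ] H), ∀ s ∈ Icc a T, ‖L (y s)‖ ^ 2 ≤ ‖L‖ ^ 2 * (energyConst ρ T * R) :=
    fun L s hs => by
      have := pow_le_pow_left₀ (norm_nonneg _) (L.le_opNorm (y s)) 2
      rw [mul_pow] at this
      exact this.trans (mul_le_mul_of_nonneg_left (hys s hs) (sq_nonneg _))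
  unfold cost
  simp only [norm_zero, ne_eq, OfNat.ofNat_ne_zero, not_false_eq_true, zero_pow, add_zero]
  have h1 := hL P T ⟨ha.2, le_rfl⟩
  have h2 := intervalIntegral.integral_mono_on (μ := volume) ha.2
    (f := fun s => ‖Q (y s)‖ ^ 2) (g := fun _ => ‖Q‖ ^ 2 * (energyConst ρ T * R))
    ((hy.continuousOn.memL2.clm Q).intervalIntegrable_norm_sq ha.2)
    _root_.intervalIntegrable_const (hL Q)
  rw [intervalIntegral.integral_const, smul_eq_mul] at h2
  have h3 : (T - a) * (‖Q‖ ^ 2 * (energyConst ρ T * R))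
      ≤ T * (‖Q‖ ^ 2 * (energyConst ρ T * R)) :=
    mul_le_mul_of_nonneg_right (by linarith [ha.1])
      (mul_nonneg (sq_nonneg _) (mul_nonneg (energyConst_pos _ _).le hR0))
  unfold valueConst
  linarith

/-- With zero source and zero offset the value reduces to the quadratic form of Π, so the statements
about the value apply to Π alone. -/
theorem isOffset_zero : IsOffset J μ₀ B T Pi 0 0 where
  continuousOn := continuousOn_const
  terminal := rfl
  primitive := fun μ _ => by
    refine ⟨?_, fun t _ => ?_⟩ <;> simp

theorem value_zero (x : H) : value B T Pi 0 0 a x = inner ℝ (Pi (T - a) x) x := by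
  simp [value]

/-- Take z parallel to Sx with ‖z‖ = ‖x‖. Polarization and positivity give 4⟨Sx, z⟩ ≤ ⟨S(x+z), x+z⟩
≤ 4K‖x‖², and ⟨Sx, z⟩ = ‖x‖‖Sx‖. -/
theorem norm_le_of_quadratic_le {S : H →L[ℝ] H} (hS : S.IsPositive) {K : ℝ} (hK : 0 ≤ K)
    (h : ∀ x, inner ℝ (S x) x ≤ K * ‖x‖ ^ 2) : ‖S‖ ≤ K := by
  refine S.opNorm_le_bound hK fun x => ?_
  rcases eq_or_ne (S x) 0 with h0 | h0
  · rw [h0, norm_zero]; positivity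
  have hSx : 0 < ‖S x‖ := norm_pos_iff.2 h0
  set z : H := (‖x‖ / ‖S x‖) • S x with hz
  have hzn : ‖z‖ = ‖x‖ := by
    rw [hz, norm_smul, norm_div, norm_norm, norm_norm, div_mul_cancel₀ _ hSx.ne']
  have h1 := h (x + z)
  have h2 : 0 ≤ inner ℝ (S (x - z)) (x - z) := by
    have := hS.2 (x - z)
    simpa [ContinuousLinearMap.reApplyInnerSelf] using this
  have h3 : inner ℝ (S x) z = ‖x‖ * ‖S x‖ := by
    rw [hz, inner_smul_right, real_inner_self_eq_norm_sq]; field_simp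
  have h4 : inner ℝ (S z) x = inner ℝ (S x) z := by
    rw [isSymm_of_isPositive hS, real_inner_comm]
  have h5 : ‖x + z‖ ^ 2 ≤ (2 * ‖x‖) ^ 2 :=
    pow_le_pow_left₀ (norm_nonneg _) ((norm_add_le _ _).trans (by rw [hzn]; linarith)) 2
  simp only [map_add, map_sub, inner_add_left, inner_add_right, inner_sub_left,
    inner_sub_right, h4, h3] at h1 h2
  have h6 := mul_le_mul_of_nonneg_left h5 hK
  have h7 : ‖x‖ * ‖S x‖ ≤ ‖x‖ * (K * ‖x‖) := by nlinarith
  rcases (norm_nonneg x).eq_or_lt with hx | hx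
  · exfalso; apply h0; rw [norm_eq_zero.1 hx.symm, map_zero]
  · exact le_of_mul_le_mul_left h7 hx

theorem IsRiccati.norm_le (hJ : IsResolventFamily J ρ μ₀)
    (hR : IsRiccati J μ₀ B Q P T Pi) {t : ℝ} (ht : t ∈ Icc 0 T) :
    ‖Pi t‖ ≤ valueConst Q P ρ T := by
  refine norm_le_of_quadratic_le (hR.isPositive t ht) (valueConst_nonneg (ht.1.trans ht.2))
    fun x => ?_
  have ha : T - t ∈ Icc 0 T := ⟨by linarith [ht.2], by linarith [ht.1]⟩
  have := value_le (r := 0) (h := 0) hJ hR isOffset_zero (by exact MemLp.zero) ha x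
  rw [value_zero] at this
  simpa using this

/-- The value at x minus the value at -x equals 4⟨h(t), x⟩; the first is bounded above, the second
is nonnegative, and x is the unit vector along h(t). -/
theorem IsOffset.norm_le (hJ : IsResolventFamily J ρ μ₀)
    (hR : IsRiccati J μ₀ B Q P T Pi) (hh : IsOffset J μ₀ B T Pi r h)
    (hr : MemL2 r 0 T) {t : ℝ} (ht : t ∈ Icc 0 T) :
    ‖h t‖ ≤ valueConst Q P ρ T * (1 + ∫ s in (0 : ℝ)..T, ‖r s‖ ^ 2) := by
  have hV := valueConst_nonneg (Q := Q) (P := P) (ρ := ρ) (ht.1.trans ht.2)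
  have hI := integral_norm_sq_nonneg r (ht.1.trans ht.2)
  rcases eq_or_ne (h t) 0 with h0 | h0
  · rw [h0, norm_zero]; positivity
  have hpos : 0 < ‖h t‖ := norm_pos_iff.2 h0
  set x : H := ‖h t‖⁻¹ • h t with hx
  have hxn : ‖x‖ = 1 := by
    rw [hx, norm_smul, norm_inv, norm_norm, inv_mul_cancel₀ hpos.ne']
  have hin : inner ℝ (h t) x = ‖h t‖ := by
    rw [hx, inner_smul_right, real_inner_self_eq_norm_sq]; field_simp
  have h1 := value_le hJ hR hh hr ht x
  have h2 := value_nonneg hJ hR hh hr ht (-x)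
  have h3 : value B T Pi r h t x - value B T Pi r h t (-x) = 4 * ‖h t‖ := by
    unfold value
    rw [map_neg, inner_neg_neg, inner_neg_right, hin]; ring
  rw [hxn, one_pow] at h1
  linarith

end

/-! ### Continuous dependence on the parameter, and semicontinuity of the value -/

section

section Stability

variable {V H U : Type*}
  [NormedAddCommGroup V] [InnerProductSpace ℝ V] [CompleteSpace V]
  [NormedAddCommGroup H] [InnerProductSpace ℝ H] [CompleteSpace H]
  [NormedAddCommGroup U] [InnerProductSpace ℝ U] [CompleteSpace U]
  {ι : V →L[ℝ] H} {ρ θ : ℝ}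

theorem graphDomain_ext {𝒜 : V →L[ℝ] StrongDual ℝ V} (hinj : Function.Injective ι)
    (hι : DenseRange ι) {p q : graphDomain ι 𝒜}
    (h : (p : WithLp 2 (H × H)).fst = (q : WithLp 2 (H × H)).fst) : p = q := by
  have h2 : (p : WithLp 2 (H × H)).snd = (q : WithLp 2 (H × H)).snd :=
    IsGenerated.unique (𝒜 := 𝒜) hinj hι p.2 (h ▸ q.2)
  refine Subtype.ext ?_
  exact (WithLp.ofLp_injective 2) (Prod.ext h h2)

/-- The relation a = Ax is equivalent to J_μ(x - μa) = x, a closed condition on (x, a). -/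
theorem IsVHCoercive.isClosed_graphDomain {𝒜 : V →L[ℝ] StrongDual ℝ V}
    (h : IsVHCoercive ι 𝒜 ρ θ) :
    IsClosed (graphDomain ι 𝒜 : Set (WithLp 2 (H × H))) := by
  have hpos := h.maxStep_pos
  obtain ⟨μ, hμ⟩ : ∃ μ, μ ∈ Ioo 0 (maxStep ρ) := nonempty_Ioo.2 hpos
  have e : (graphDomain ι 𝒜 : Set (WithLp 2 (H × H)))
      = {p | resolvent ι 𝒜 μ (p.fst - μ • p.snd) = p.fst} := by
    ext p
    refine ⟨fun hp => h.resolvent_eq hμ hp, fun hp => ?_⟩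
    have h1 := h.resolvent_spec hμ (p.fst - μ • p.snd)
    rw [yosida_apply, hp, sub_sub_cancel, inv_smul_smul₀ hμ.1.ne'] at h1
    exact h1
  rw [e]
  have c1 : Continuous (@WithLp.fst 2 H H) := WithLp.continuous_fst ..
  have c2 : Continuous (@WithLp.snd 2 H H) := WithLp.continuous_snd ..
  exact isClosed_eq ((resolvent ι 𝒜 μ).continuous.comp (c1.sub (c2.const_smul μ))) c1

/-- By the closed graph theorem, a resolvent is bounded into the domain of another operator with
the same domain. -/
theorem exists_resolvent_into_graphDomain {𝒜₀ 𝒜 : V →L[ℝ] StrongDual ℝ V}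
    (h₀ : IsVHCoercive ι 𝒜₀ ρ θ) (h : IsVHCoercive ι 𝒜 ρ θ)
    (hinj : Function.Injective ι) (hι : DenseRange ι) (hdom : domainH ι 𝒜 = domainH ι 𝒜₀)
    {μ : ℝ} (hμ : μ ∈ Ioo 0 (maxStep ρ)) :
    ∃ p : H →L[ℝ] graphDomain ι 𝒜₀,
      ∀ x, (p x : WithLp 2 (H × H)).fst = resolvent ι 𝒜 μ x := by
  have hex : ∀ x, ∃ q : graphDomain ι 𝒜₀,
      (q : WithLp 2 (H × H)).fst = resolvent ι 𝒜 μ x := fun x => by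
    obtain ⟨v, hv, hv'⟩ := h.resolvent_spec hμ x
    have hmem : v ∈ domainH ι 𝒜₀ := hdom ▸ ⟨_, hv'⟩
    obtain ⟨b, hb⟩ := hmem
    exact ⟨⟨WithLp.toLp 2 (ι v, b), v, rfl, hb⟩, hv⟩
  choose p hp using hex
  have : CompleteSpace (graphDomain ι 𝒜₀) := h₀.isClosed_graphDomain.completeSpace_coe
  let pl : H →ₗ[ℝ] graphDomain ι 𝒜₀ :=
    { toFun := p
      map_add' := fun x y => graphDomain_ext hinj hι (by
        simp only [Submodule.coe_add, WithLp.add_fst, hp, map_add])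
      map_smul' := fun c x => graphDomain_ext hinj hι (by
        simp only [Submodule.coe_smul, WithLp.smul_fst, hp, map_smul, RingHom.id_apply]) }
  refine ⟨ContinuousLinearMap.ofSeqClosedGraph (g := pl) fun u x q hu hq => ?_, fun x => hp x⟩
  have c1 : Continuous (@WithLp.fst 2 H H) := WithLp.continuous_fst ..
  refine graphDomain_ext hinj hι (tendsto_nhds_unique
    ((c1.comp continuous_subtype_val).tendsto q |>.comp hq) ?_)
  have : Tendsto (fun n => resolvent ι 𝒜 μ (u n)) atTop (𝓝 (resolvent ι 𝒜 μ x)) :=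
    ((resolvent ι 𝒜 μ).continuous.tendsto x).comp hu
  have e : (pl x : WithLp 2 (H × H)).fst = resolvent ι 𝒜 μ x := hp x
  rw [e]
  exact this.congr fun n => (hp (u n)).symm

theorem IsRestriction.isGenerated {𝒜₀ 𝒜 : V →L[ℝ] StrongDual ℝ V}
    {L : graphDomain ι 𝒜₀ →L[ℝ] H} (hL : IsRestriction ι 𝒜₀ 𝒜 L) (q : graphDomain ι 𝒜₀) :
    IsGenerated ι 𝒜 (q : WithLp 2 (H × H)).fst (L q) := by
  obtain ⟨v, hv, -⟩ := q.2
  exact ⟨v, hv, hL v q hv⟩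

/-- Absolutely continuous functions with values in the domain of the generator are mild
solutions. -/
theorem IsVHCoercive.isMild_of_isPrimitive {𝒜 : V →L[ℝ] StrongDual ℝ V}
    (h : IsVHCoercive ι 𝒜 ρ θ) {w w' c : ℝ → H} {a b : ℝ} (hab : a ≤ b)
    (hw : IsPrimitive w w' a b) (hc : ∀ s, IsGenerated ι 𝒜 (w s) (c s)) :
    IsMild (resolvent ι 𝒜) (maxStep ρ) (fun s => w' s - c s) w a b :=
  ⟨hw.continuousOn, fun μ hμ => (hw.clm (resolvent ι 𝒜 μ)).congr hab (fun _ _ => rfl)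
    (ae_of_all _ fun s _ => by
      rw [h.resolvent_of_isGenerated hμ (hc s), map_sub]; abel)⟩

theorem integral_norm_sq_add_le {f g : ℝ → H} {a b : ℝ} (hab : a ≤ b)
    (hf : MemL2 f a b) (hg : MemL2 g a b) :
    ∫ s in a..b, ‖f s + g s‖ ^ 2
      ≤ 2 * (∫ s in a..b, ‖f s‖ ^ 2) + 2 * ∫ s in a..b, ‖g s‖ ^ 2 := by
  have := integral_norm_sq_sub_le hab hf (hg.clm (-ContinuousLinearMap.id ℝ H))
    (MemLp.zero : MemL2 (fun _ => (0 : H)) a b)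
  simpa using this

variable {𝒜 : (ℕ → ℝ) → V →L[ℝ] StrongDual ℝ V} {S : Set (ℕ → ℝ)}
  {𝒜₀ : V →L[ℝ] StrongDual ℝ V} {AD : (ℕ → ℝ) → graphDomain ι 𝒜₀ →L[ℝ] H} {C_AD : ℝ}

/-- Mild solutions depend continuously on the parameter. -/
theorem tendstoUniformlyOn_of_isMild
    (hinj : Function.Injective ι) (hι : DenseRange ι)
    (hc₀ : IsVHCoercive ι 𝒜₀ ρ θ)
    (hc : ∀ σ ∈ S, IsVHCoercive ι (𝒜 σ) ρ θ)
    (hdom : ∀ σ ∈ S, domainH ι (𝒜 σ) = domainH ι 𝒜₀)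
    (hAD : ∀ σ ∈ S, IsRestriction ι 𝒜₀ (𝒜 σ) (AD σ))
    (hADb : ∀ σ ∈ S, ‖AD σ‖ ≤ C_AD)
    (hADc : ∀ x, ContinuousOn (fun σ => AD σ x) S)
    {σ : ℕ → ℝ} (hσ : σ ∈ S) {a b : ℝ} (hab : a ≤ b)
    {F : (ℕ → ℝ) → ℝ → H} {F₀ : ℝ → H} (hF : ∀ σ' ∈ S, MemL2 (F σ') a b) (hF₀ : MemL2 F₀ a b)
    (hlim : Tendsto (fun σ' => ∫ s in a..b, ‖F σ' s - F₀ s‖ ^ 2) (𝓝[S] σ) (𝓝 0))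
    {y : (ℕ → ℝ) → ℝ → H} {y₀ : ℝ → H}
    (hy : ∀ σ' ∈ S, IsMild (resolvent ι (𝒜 σ')) (maxStep ρ) (F σ') (y σ') a b)
    (hy₀ : IsMild (resolvent ι (𝒜 σ)) (maxStep ρ) F₀ y₀ a b)
    (hya : ∀ σ' ∈ S, y σ' a = y₀ a) :
    TendstoUniformlyOn y y₀ (𝓝[S] σ) (Icc a b) := by
  have hJ := (hc σ hσ).isResolventFamily hinj hι
  obtain ⟨τ, hτ, hτm⟩ := hJ.exists_seq
  set c := energyConst ρ (b - a) with hcd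
  have hc0 : 0 < c := energyConst_pos _ _
  have hyM : MemL2 y₀ a b := hy₀.continuousOn.memL2
  -- `p k` is the resolvent for σ as a bounded map into D(𝒜), so the operators of all other
  -- parameters can be applied after it with uniform bounds.
  choose p hp using fun k =>
    exists_resolvent_into_graphDomain hc₀ (hc σ hσ) hinj hι (hdom σ hσ) (hτm k)
  have hgen : ∀ k, ∀ σ' ∈ S, ∀ x,
      IsGenerated ι (𝒜 σ') (resolvent ι (𝒜 σ) (τ k) x) (AD σ' (p k x)) := fun k σ' hσ' x => by
    rw [← hp k x]; exact (hAD σ' hσ').isGenerated _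
  have hADy : ∀ k x, AD σ (p k x) = yosida (resolvent ι (𝒜 σ)) (τ k) x := fun k x =>
    (hgen k σ hσ x).unique hinj hι ((hc σ hσ).resolvent_spec (hτm k) x)
  have hest : ∀ k, ∀ σ' ∈ S, ∀ (G z : ℝ → H), MemL2 G a b →
      IsMild (resolvent ι (𝒜 σ')) (maxStep ρ) G z a b → z a = y₀ a → ∀ t ∈ Icc a b,
      ‖z t - resolvent ι (𝒜 σ) (τ k) (y₀ t)‖ ^ 2
        ≤ c * (‖resolvent ι (𝒜 σ) (τ k) (y₀ a) - y₀ a‖ ^ 2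
          + (4 * (∫ s in a..b, ‖G s - F₀ s‖ ^ 2)
            + 4 * (∫ s in a..b, ‖AD σ' (p k (y₀ s)) - AD σ (p k (y₀ s))‖ ^ 2)
            + 2 * ∫ s in a..b, ‖resolvent ι (𝒜 σ) (τ k) (F₀ s) - F₀ s‖ ^ 2)) := by
    intro k σ' hσ' G z hG hz hza t ht
    -- The regularized state J_{τ_k} y₀ solves the equation of σ' with a modified source. Compared
    -- with z, three errors remain: the change of source, the change of operator on D(𝒜), and the
    -- regularization of F₀.
    have hw := (hc σ' hσ').isMild_of_isPrimitive hab (hy₀.primitive (τ k) (hτm k))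
      (c := fun s => AD σ' (p k (y₀ s))) (fun s => hgen k σ' hσ' (y₀ s))
    have hd := hz.sub hab hw
    have m1 : MemL2 (fun s => G s - F₀ s) a b := hG.sub hF₀
    have m2 : MemL2 (fun s => AD σ' (p k (y₀ s)) - AD σ (p k (y₀ s))) a b :=
      ((hyM.clm (p k)).clm (AD σ')).sub ((hyM.clm (p k)).clm (AD σ))
    have m3 : MemL2 (fun s => F₀ s - resolvent ι (𝒜 σ) (τ k) (F₀ s)) a b :=
      hF₀.sub (hF₀.clm _)
    have hd' := hd.congr hab (G := fun s => ((G s - F₀ s)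
        + (AD σ' (p k (y₀ s)) - AD σ (p k (y₀ s))))
        + (F₀ s - resolvent ι (𝒜 σ) (τ k) (F₀ s)))
      (ae_of_all _ fun s _ => by rw [hADy]; abel)
    have hJ' := (hc σ' hσ').isResolventFamily hinj hι
    have e1 := hJ'.norm_sq_le (L := b - a) ht.1 (by linarith [ht.2])
      (hd'.mono le_rfl ht.1 ht.2) (((m1.add m2).add m3).mono le_rfl ht.2)
    have e2 := integral_norm_sq_mono ((m1.add m2).add m3) ht
    have e3 := integral_norm_sq_add_le hab (m1.add m2) m3
    have e4 := integral_norm_sq_add_le hab m1 m2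
    rw [hza, norm_sub_rev (y₀ a)] at e1
    simp only [norm_sub_rev (F₀ _)] at e3
    refine e1.trans (mul_le_mul_of_nonneg_left (add_le_add le_rfl ?_) hc0.le)
    linarith
  have hη : Tendsto (fun k => 4 * c * (‖resolvent ι (𝒜 σ) (τ k) (y₀ a) - y₀ a‖ ^ 2
      + 2 * ∫ s in a..b, ‖resolvent ι (𝒜 σ) (τ k) (F₀ s) - F₀ s‖ ^ 2)) atTop (𝓝 0) := by
    have := (((hJ.tendsto_apply_sub hτ (y₀ a)).norm.pow 2).add
      ((hJ.tendsto_integral_apply_sub hτ hτm hab hF₀).const_mul 2)).const_mul (4 * c)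
    simpa using this
  obtain ⟨Y, hY⟩ := isCompact_Icc.exists_bound_of_continuousOn hy₀.continuousOn
  have hADlim : ∀ k, Tendsto (fun σ' =>
      ∫ s in a..b, ‖AD σ' (p k (y₀ s)) - AD σ (p k (y₀ s))‖ ^ 2) (𝓝[S] σ) (𝓝 0) := by
    intro k
    have := intervalIntegral.tendsto_integral_filter_of_dominated_convergence (μ := volume)
      (a := a) (b := b) (l := 𝓝[S] σ)
      (F := fun σ' s => ‖AD σ' (p k (y₀ s)) - AD σ (p k (y₀ s))‖ ^ 2) (f := fun _ => 0)
      (fun s => (2 * (C_AD * (‖p k‖ * Y))) ^ 2) (Eventually.of_forall fun σ' => by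
        rw [uIoc_of_le hab]
        exact (((hyM.clm (p k)).clm (AD σ')).sub ((hyM.clm (p k)).clm (AD σ))).1.norm.pow 2)
      (by
        filter_upwards [self_mem_nhdsWithin] with σ' hσ'
        refine ae_of_all _ fun s hs => ?_
        rw [uIoc_of_le hab] at hs
        rw [norm_pow, norm_norm]
        have b1 : ‖p k (y₀ s)‖ ≤ ‖p k‖ * Y := ((p k).le_opNorm _).trans
          (mul_le_mul_of_nonneg_left (hY s (Ioc_subset_Icc_self hs)) (p k).opNorm_nonneg)
        have b2 : ∀ σ' ∈ S, ‖AD σ' (p k (y₀ s))‖ ≤ C_AD * (‖p k‖ * Y) := fun σ' hσ' =>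
          ((AD σ').le_of_opNorm_le (hADb σ' hσ') _).trans (mul_le_mul_of_nonneg_left b1
            ((AD σ').opNorm_nonneg.trans (hADb σ' hσ')))
        refine pow_le_pow_left₀ (norm_nonneg _) ((norm_sub_le _ _).trans ?_) 2
        linarith [b2 σ' hσ', b2 σ hσ])
      _root_.intervalIntegrable_const
      (ae_of_all _ fun s _ => by
        have h1 : Tendsto (fun σ' => AD σ' (p k (y₀ s))) (𝓝[S] σ) (𝓝 (AD σ (p k (y₀ s)))) :=
          hADc (p k (y₀ s)) σ hσ
        have := ((tendsto_iff_norm_sub_tendsto_zero.1 h1).pow 2)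
        simpa using this)
    simpa using this
  rw [Metric.tendstoUniformlyOn_iff]
  intro ε hε
  -- The order matters: k is fixed first, making the regularization errors small for all σ' at once;
  -- only then σ' → σ. The factor 4c in `hη` collects those errors from the two uses of `hest`, for
  -- σ' and for σ itself.
  obtain ⟨k, hk⟩ := (hη.eventually_lt_const (show 0 < ε ^ 2 / 2 by positivity)).exists
  have hσlim : Tendsto (fun σ' => 2 * c * (4 * (∫ s in a..b, ‖F σ' s - F₀ s‖ ^ 2)
      + 4 * ∫ s in a..b, ‖AD σ' (p k (y₀ s)) - AD σ (p k (y₀ s))‖ ^ 2)) (𝓝[S] σ) (𝓝 0) := by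
    simpa using ((hlim.const_mul 4).add ((hADlim k).const_mul 4)).const_mul (2 * c)
  filter_upwards [hσlim.eventually_lt_const (show 0 < ε ^ 2 / 2 by positivity),
    self_mem_nhdsWithin] with σ' h1 hσ' t ht
  have e1 := hest k σ' hσ' _ _ (hF σ' hσ') (hy σ' hσ') (hya σ' hσ') t ht
  have e2 := hest k σ hσ _ _ hF₀ hy₀ rfl t ht
  simp only [sub_self, norm_zero, ne_eq, OfNat.ofNat_ne_zero, not_false_eq_true, zero_pow,
    intervalIntegral.integral_zero, mul_zero, zero_add, add_zero] at e2
  rw [dist_comm, dist_eq_norm]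
  have e3 : ‖y σ' t - y₀ t‖ ≤ ‖y σ' t - resolvent ι (𝒜 σ) (τ k) (y₀ t)‖
      + ‖y₀ t - resolvent ι (𝒜 σ) (τ k) (y₀ t)‖ := by
    rw [norm_sub_rev (y₀ t)]
    simpa using norm_add_le (y σ' t - resolvent ι (𝒜 σ) (τ k) (y₀ t))
      (resolvent ι (𝒜 σ) (τ k) (y₀ t) - y₀ t)
  refine lt_of_pow_lt_pow_left₀ 2 hε.le ?_
  have e4 : ‖y σ' t - y₀ t‖ ^ 2 ≤ 2 * ‖y σ' t - resolvent ι (𝒜 σ) (τ k) (y₀ t)‖ ^ 2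
      + 2 * ‖y₀ t - resolvent ι (𝒜 σ) (τ k) (y₀ t)‖ ^ 2 := by
    nlinarith [norm_nonneg (y σ' t - y₀ t),
      sq_nonneg (‖y σ' t - resolvent ι (𝒜 σ) (τ k) (y₀ t)‖
        - ‖y₀ t - resolvent ι (𝒜 σ) (τ k) (y₀ t)‖)]
  linarith

/-- The cost of a fixed control depends continuously on the state. -/
theorem tendsto_cost {T a : ℝ} (hab : a ≤ T) {Q P : H →L[ℝ] H} {u : ℝ → U}
    (hu : ContinuousOn u (Icc a T))
    {l : Filter (ℕ → ℝ)} [l.IsCountablyGenerated] {y : (ℕ → ℝ) → ℝ → H} {y₀ : ℝ → H}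
    (hy : ∀ᶠ σ in l, ContinuousOn (y σ) (Icc a T)) (hy₀ : ContinuousOn y₀ (Icc a T))
    (h : TendstoUniformlyOn y y₀ l (Icc a T)) :
    Tendsto (fun σ => cost Q P T a u (y σ)) l (𝓝 (cost Q P T a u y₀)) := by
  obtain ⟨Y, hY⟩ := isCompact_Icc.exists_bound_of_continuousOn hy₀
  obtain ⟨W, hW⟩ := isCompact_Icc.exists_bound_of_continuousOn hu
  refine (((P.continuous.tendsto _).comp (h.tendsto_at ⟨hab, le_rfl⟩)).norm.pow 2).add ?_
  refine intervalIntegral.tendsto_integral_filter_of_dominated_convergence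
    (fun _ => (‖Q‖ * (Y + 1)) ^ 2 + W ^ 2) ?_ ?_ _root_.intervalIntegrable_const
    (ae_of_all _ fun s hs => ?_)
  · filter_upwards [hy] with σ hσ
    rw [uIoc_of_le hab]
    exact ((hσ.memL2.clm Q).1.norm.pow 2).add (hu.memL2.1.norm.pow 2)
  · filter_upwards [Metric.tendstoUniformlyOn_iff.1 h 1 one_pos] with σ hσ
    refine ae_of_all _ fun s hs => ?_
    rw [uIoc_of_le hab] at hs
    have hs' := Ioc_subset_Icc_self hs
    have h1 := hσ s hs'
    rw [dist_comm, dist_eq_norm] at h1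
    have h2 : ‖y σ s‖ ≤ Y + 1 := by
      have := norm_add_le (y σ s - y₀ s) (y₀ s)
      rw [sub_add_cancel] at this
      linarith [hY s hs']
    have h3 : ‖Q (y σ s)‖ ≤ ‖Q‖ * (Y + 1) :=
      (Q.le_opNorm _).trans (mul_le_mul_of_nonneg_left h2 (norm_nonneg _))
    rw [Real.norm_of_nonneg (by positivity)]
    exact add_le_add (pow_le_pow_left₀ (norm_nonneg _) h3 2)
      (pow_le_pow_left₀ (norm_nonneg _) (hW s hs') 2)
  · rw [uIoc_of_le hab] at hs
    exact (((Q.continuous.tendsto _).comp (h.tendsto_at (Ioc_subset_Icc_self hs))).norm.pow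
      2).add tendsto_const_nhds

/-- The value function is upper semicontinuous with respect to the parameter. -/
theorem eventually_value_lt
    (hinj : Function.Injective ι) (hι : DenseRange ι)
    (hc₀ : IsVHCoercive ι 𝒜₀ ρ θ)
    (hc : ∀ σ ∈ S, IsVHCoercive ι (𝒜 σ) ρ θ)
    (hdom : ∀ σ ∈ S, domainH ι (𝒜 σ) = domainH ι 𝒜₀)
    (hAD : ∀ σ ∈ S, IsRestriction ι 𝒜₀ (𝒜 σ) (AD σ))
    (hADb : ∀ σ ∈ S, ‖AD σ‖ ≤ C_AD)
    (hADc : ∀ x, ContinuousOn (fun σ => AD σ x) S)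
    {T a : ℝ} (ha : a ∈ Icc 0 T) {B : U →L[ℝ] H} {Q P : H →L[ℝ] H}
    {Pi : (ℕ → ℝ) → ℝ → H →L[ℝ] H} {r h : (ℕ → ℝ) → ℝ → H}
    (hR : ∀ σ ∈ S, IsRiccati (resolvent ι (𝒜 σ)) (maxStep ρ) B Q P T (Pi σ))
    (hh : ∀ σ ∈ S, IsOffset (resolvent ι (𝒜 σ)) (maxStep ρ) B T (Pi σ) (r σ) (h σ))
    (hr : ∀ σ ∈ S, MemL2 (r σ) 0 T)
    {σ : ℕ → ℝ} (hσ : σ ∈ S)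
    (hrc : Tendsto (fun σ' => ∫ s in (0 : ℝ)..T, ‖r σ' s - r σ s‖ ^ 2) (𝓝[S] σ) (𝓝 0))
    (x : H) {c : ℝ} (hval : value B T (Pi σ) (r σ) (h σ) a x < c) :
    ∀ᶠ σ' in 𝓝[S] σ, value B T (Pi σ') (r σ') (h σ') a x < c := by
  have hJ := fun σ hσ => (hc σ hσ).isResolventFamily hinj hι
  -- A control that is nearly optimal for σ is kept for the neighbouring parameters; its cost varies
  -- continuously and stays above their values.
  obtain ⟨u, y₀, hu, hy₀, hy₀a, hlt⟩ :=
    exists_cost_lt (hJ σ hσ) (hR σ hσ) (hh σ hσ) (hr σ hσ) ha x hval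
  have hra : ∀ σ ∈ S, MemL2 (r σ) a T := fun σ hσ => (hr σ hσ).mono ha.1 le_rfl
  have hF : ∀ σ ∈ S, MemL2 (fun s => B (u s) + r σ s) a T := fun σ hσ =>
    (hu.memL2.clm B).add (hra σ hσ)
  choose! y hy hya using fun σ' hσ' => (hJ σ' hσ').exists_mild ha.2 (hF σ' hσ') x
  have hunif := tendstoUniformlyOn_of_isMild hinj hι hc₀ hc hdom hAD hADb hADc hσ ha.2
    hF (hF σ hσ) (by
      simp only [add_sub_add_left_eq_sub]
      refine squeeze_zero' (Eventually.of_forall fun σ' => integral_norm_sq_nonneg _ ha.2) ?_ hrc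
      filter_upwards [self_mem_nhdsWithin] with σ' hσ'
      exact intervalIntegral.integral_mono_interval ha.1 ha.2 le_rfl
        (ae_of_all _ fun _ => by positivity)
        (((hr σ' hσ').sub (hr σ hσ)).intervalIntegrable_norm_sq (ha.1.trans ha.2)))
    hy hy₀ (fun σ' hσ' => by rw [hya σ' hσ', hy₀a])
  have hcost := tendsto_cost (Q := Q) (P := P) ha.2 hu (by
    filter_upwards [self_mem_nhdsWithin] with σ' hσ' using (hy σ' hσ').continuousOn)
    hy₀.continuousOn hunif
  filter_upwards [hcost.eventually_lt_const hlt, self_mem_nhdsWithin] with σ' h1 hσ'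
  have := value_le_cost (hJ σ' hσ') (hR σ' hσ') (hh σ' hσ') (hr σ' hσ') ha hu (hy σ' hσ')
  rw [hya σ' hσ'] at this
  exact this.trans_lt h1

end Stability

/-! ### Measurability over the parameter cube -/

theorem measurableSet_paramSet : MeasurableSet paramSet := by
  have : paramSet = ⋂ j, (fun σ : ℕ → ℝ => σ j) ⁻¹' Icc (-1 / 2 : ℝ) (1 / 2) := by
    ext σ; simp [paramSet]
  rw [this]
  exact MeasurableSet.iInter fun j => measurable_pi_apply j measurableSet_Icc

theorem ae_mem_paramSet : ∀ᵐ σ ∂paramMeasure, σ ∈ paramSet := by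
  unfold paramSet
  simp only [mem_ofPred_eq]
  rw [ae_all_iff]
  intro j
  have h1 : ∀ᵐ s ∂unif, s ∈ Icc (-1 / 2 : ℝ) (1 / 2) := by
    unfold unif; exact ae_restrict_mem measurableSet_Icc
  have h2 := (measurePreserving_eval_infinitePi (fun _ : ℕ => unif) j).quasiMeasurePreserving
  exact h2.ae h1

instance : IsProbabilityMeasure paramMeasure := by unfold paramMeasure; infer_instance

/-- Functions that are upper semicontinuous on `paramSet` are almost everywhere measurable. -/
theorem aemeasurable_of_upperSemicontinuous {φ : (ℕ → ℝ) → ℝ}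
    (h : ∀ σ ∈ paramSet, ∀ c, φ σ < c → ∀ᶠ σ' in 𝓝[paramSet] σ, φ σ' < c) :
    AEMeasurable φ paramMeasure := by
  rw [← Measure.restrict_eq_self_of_ae_mem ae_mem_paramSet]
  refine aemeasurable_restrict_of_measurable_subtype measurableSet_paramSet ?_
  refine UpperSemicontinuous.measurable fun σ c hc => ?_
  have := h σ σ.2 c hc
  rw [nhdsWithin_eq_map_subtype_coe σ.2] at this
  exact this

end

/-! ### From the given equations to their smoothed forms; Bochner integrability of the feedbacks -/

section

section Conversion

variable {V H U : Type*}
  [NormedAddCommGroup V] [InnerProductSpace ℝ V] [CompleteSpace V]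
  [NormedAddCommGroup H] [InnerProductSpace ℝ H] [CompleteSpace H]
  [NormedAddCommGroup U] [InnerProductSpace ℝ U] [CompleteSpace U]
  {ι : V →L[ℝ] H} {𝒜 : V →L[ℝ] StrongDual ℝ V} {ρ θ T : ℝ}
  {B : U →L[ℝ] H} {Q P : H →L[ℝ] H} {Pi : ℝ → H →L[ℝ] H} {r h : ℝ → H}

/-- J_μ z lies in the domain and A J_μ z = A_μ z, so the weak equation may be tested with the pair
(J_μ z, J_μ z); self-adjointness of Π merges the two generator terms. -/
theorem IsVHCoercive.isRiccati (hc : IsVHCoercive ι 𝒜 ρ θ)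
    (hR : IsRiccatiSolution ι 𝒜 B Q P T Pi) :
    IsRiccati (resolvent ι 𝒜) (maxStep ρ) B Q P T Pi where
  continuousOn := hR.continuousOn
  isPositive := hR.isPositive
  initial := hR.initial
  equation := fun μ hμ z t ht => by
    obtain ⟨v, hv, hv'⟩ := hc.resolvent_spec hμ z
    have h1 := hR.equation v v _ _ hv' hv' t ht
    simp only [hv] at h1
    convert h1 using 1
    rw [isSymm_of_isPositive (hR.isPositive t ht) (resolvent ι 𝒜 μ z) (yosida _ _ _),
      real_inner_comm _ (resolvent ι 𝒜 μ z), real_inner_self_eq_norm_sq,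
      real_inner_self_eq_norm_sq]
    ring

theorem IsVHCoercive.isOffset (hc : IsVHCoercive ι 𝒜 ρ θ) (hT : 0 ≤ T)
    (hR : IsRiccatiSolution ι 𝒜 B Q P T Pi) (hr : MemL2 r 0 T)
    (hh : IsOffsetSolution ι 𝒜 B T Pi r h) :
    IsOffset (resolvent ι 𝒜) (maxStep ρ) B T Pi r h := by
  obtain ⟨hV, dh, hw, hT0, heq⟩ := hh
  have hrev := fun x => (hc.isRiccati hR).reversed le_rfl x
  refine ⟨hw.continuousOn, hT0, fun μ hμ => hc.isPrimitive_adjoint hT hw ?_ heq hμ⟩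
  exact (hr.strong_apply hT hrev).sub
    (((hw.continuousOn.memL2.clm B.adjoint).clm B).strong_apply hT hrev)

end Conversion

section Measurability

variable {H U : Type*}
  [NormedAddCommGroup H] [InnerProductSpace ℝ H] [CompleteSpace H]
  [NormedAddCommGroup U] [InnerProductSpace ℝ U] [CompleteSpace U]

/-- Distinct orthonormal vectors are √2 apart, so the balls of radius 1/2 around them are disjoint.
-/
theorem _root_.Orthonormal.countable {ι : Type*} [TopologicalSpace.SeparableSpace H] {v : ι → H}
    (hv : Orthonormal ℝ v) : Countable ι := by
  refine Pairwise.countable_of_isOpen_disjoint (s := fun i => Metric.ball (v i) (1 / 2))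
    (fun i j hij => Metric.ball_disjoint_ball ?_) (fun _ => Metric.isOpen_ball)
    fun i => ⟨v i, Metric.mem_ball_self (by norm_num)⟩
  have h1 : ‖v i - v j‖ ^ 2 = 2 := by
    rw [norm_sub_sq_real, hv.1 i, hv.1 j, hv.2 hij]; norm_num
  rw [dist_eq_norm]
  nlinarith [norm_nonneg (v i - v j)]

/-- Weakly measurable functions with values in a separable Hilbert space are measurable. -/
theorem aestronglyMeasurable_of_inner [TopologicalSpace.SeparableSpace H] {α : Type*}
    [MeasurableSpace α] {μ : Measure α} {f : α → H}
    (hf : ∀ x, AEMeasurable (fun a => (inner ℝ (f a) x : ℝ)) μ) : AEStronglyMeasurable f μ := by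
  obtain ⟨w, b, -⟩ := exists_hilbertBasis ℝ H
  -- Countability of the basis makes the filter of finite subsets countably generated, as limits of
  -- measurable functions require.
  have := b.orthonormal.countable
  refine aestronglyMeasurable_of_tendsto_ae atTop
    (f := fun (s : Finset w) a => ∑ i ∈ s, (b.repr (f a) i) • b i) (fun s => ?_)
    (ae_of_all _ fun a => b.hasSum_repr (f a))
  refine Finset.aestronglyMeasurable_fun_sum s fun i _ => ?_
  refine AEStronglyMeasurable.smul_const ?_ _
  exact (hf (b i)).aestronglyMeasurable.congr (ae_of_all _ fun a =>
    (real_inner_comm _ _).trans (b.repr_apply_apply (f a) i).symm)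

theorem adjoint_apply_eq_sum [FiniteDimensional ℝ U] (B : U →L[ℝ] H) (x : H) :
    B.adjoint x = ∑ i, (inner ℝ x (B (stdOrthonormalBasis ℝ U i)) : ℝ)
      • stdOrthonormalBasis ℝ U i := by
  conv_lhs => rw [← (stdOrthonormalBasis ℝ U).sum_repr (B.adjoint x)]
  refine Finset.sum_congr rfl fun i _ => ?_
  rw [OrthonormalBasis.repr_apply_apply, ContinuousLinearMap.adjoint_inner_right, real_inner_comm]

/-- This finite sum upgrades strong continuity and strong measurability of S to the operator norm of
B*S: by self-adjointness, B*S is determined by the vectors S B e_i for a basis of U. -/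
theorem adjoint_comp_eq_sum [FiniteDimensional ℝ U] (B : U →L[ℝ] H) {S : H →L[ℝ] H}
    (hS : S.IsPositive) :
    B.adjoint ∘L S = ∑ i, (innerSL ℝ (S (B (stdOrthonormalBasis ℝ U i)))).smulRight
      (stdOrthonormalBasis ℝ U i) := by
  ext x
  rw [ContinuousLinearMap.comp_apply, adjoint_apply_eq_sum, _root_.sum_apply]
  refine Finset.sum_congr rfl fun i _ => ?_
  rw [ContinuousLinearMap.smulRight_apply, innerSL_apply_apply, isSymm_of_isPositive hS,
    real_inner_comm]

theorem norm_adjoint_comp_le (B : U →L[ℝ] H) (S : H →L[ℝ] H) {c : ℝ} (h : ‖S‖ ≤ c) :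
    ‖B.adjoint ∘L S‖ ≤ ‖B‖ * c := by
  refine (ContinuousLinearMap.opNorm_comp_le _ _).trans ?_
  rw [LinearIsometryEquiv.norm_map]
  exact mul_le_mul_of_nonneg_left h (norm_nonneg _)

theorem norm_adjoint_apply_le (B : U →L[ℝ] H) (x : H) {c : ℝ} (h : ‖x‖ ≤ c) :
    ‖B.adjoint x‖ ≤ ‖B‖ * c := by
  refine (B.adjoint.le_opNorm x).trans ?_
  rw [LinearIsometryEquiv.norm_map]
  exact mul_le_mul_of_nonneg_left h (norm_nonneg _)

/-- In finite dimensions of the control space, `B*Π` is continuous in the operator norm. -/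
theorem continuousOn_adjoint_comp [FiniteDimensional ℝ U] (B : U →L[ℝ] H) {s : Set ℝ}
    {Pi : ℝ → H →L[ℝ] H} (hPi : ∀ x, ContinuousOn (fun t => Pi t x) s)
    (hpos : ∀ t ∈ s, (Pi t).IsPositive) : ContinuousOn (fun t => B.adjoint ∘L Pi t) s := by
  have h1 : ContinuousOn (fun t => ∑ i, (innerSL ℝ (Pi t (B (stdOrthonormalBasis ℝ U i)))).smulRight
      (stdOrthonormalBasis ℝ U i)) s := by
    refine continuousOn_finsetSum _ fun i _ => ?_
    have h2 : ContinuousOn (fun t => innerSL ℝ (Pi t (B (stdOrthonormalBasis ℝ U i)))) s :=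
      (innerSL ℝ).continuous.comp_continuousOn (hPi _)
    exact ((ContinuousLinearMap.smulRightL ℝ H U).flip _).continuous.comp_continuousOn h2
  exact h1.congr fun t ht => adjoint_comp_eq_sum B (hpos t ht)

/-- Families of Riccati operators and offsets over the parameter set which are uniformly bounded
and weakly measurable. -/
structure IsBoundedFamily (T c d : ℝ) (Pi : (ℕ → ℝ) → ℝ → H →L[ℝ] H) (h : (ℕ → ℝ) → ℝ → H) :
    Prop where
  continuousOn : ∀ σ ∈ paramSet, ∀ x, ContinuousOn (fun t => Pi σ t x) (Icc 0 T)
  isPositive : ∀ σ ∈ paramSet, ∀ t ∈ Icc 0 T, (Pi σ t).IsPositive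
  norm_le : ∀ σ ∈ paramSet, ∀ t ∈ Icc 0 T, ‖Pi σ t‖ ≤ c
  aemeasurable : ∀ t ∈ Icc 0 T, ∀ x,
    AEMeasurable (fun σ => (inner ℝ (Pi σ t x) x : ℝ)) paramMeasure
  offset_continuousOn : ∀ σ ∈ paramSet, ContinuousOn (h σ) (Icc 0 T)
  offset_norm_le : ∀ σ ∈ paramSet, ∀ t ∈ Icc 0 T, ‖h σ t‖ ≤ d
  offset_aemeasurable : ∀ t ∈ Icc 0 T, ∀ x,
    AEMeasurable (fun σ => (inner ℝ (h σ t) x : ℝ)) paramMeasure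

variable {T c d t : ℝ} {Pi : (ℕ → ℝ) → ℝ → H →L[ℝ] H} {h : (ℕ → ℝ) → ℝ → H} {B : U →L[ℝ] H}

/-- Polarization of the measurable quadratic forms gives weak measurability, which suffices in a
separable space. -/
theorem IsBoundedFamily.aestronglyMeasurable [TopologicalSpace.SeparableSpace H]
    (hb : IsBoundedFamily T c d Pi h) (ht : t ∈ Icc 0 T)
    (x : H) : AEStronglyMeasurable (fun σ => Pi σ t x) paramMeasure := by
  refine aestronglyMeasurable_of_inner fun y => ?_
  refine (((hb.aemeasurable t ht (x + y)).sub (hb.aemeasurable t ht (x - y))).div_const 4).congr ?_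
  filter_upwards [ae_mem_paramSet] with σ hσ
  have h1 : inner ℝ (Pi σ t y) x = inner ℝ (Pi σ t x) y := by
    rw [isSymm_of_isPositive (hb.isPositive σ hσ t ht), real_inner_comm]
  simp only [_root_.Pi.sub_apply, map_add, map_sub, inner_add_left, inner_add_right,
    inner_sub_left, inner_sub_right, h1]
  ring

variable [FiniteDimensional ℝ U] [TopologicalSpace.SeparableSpace H]

theorem IsBoundedFamily.integrable (hb : IsBoundedFamily T c d Pi h) (ht : t ∈ Icc 0 T) :
    Integrable (fun σ => B.adjoint ∘L Pi σ t) paramMeasure := by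
  refine Integrable.of_bound (C := ‖B‖ * c) ?_ ?_
  · have h1 : AEStronglyMeasurable (fun σ => ∑ i,
        (innerSL ℝ (Pi σ t (B (stdOrthonormalBasis ℝ U i)))).smulRight
          (stdOrthonormalBasis ℝ U i)) paramMeasure := by
      refine Finset.aestronglyMeasurable_fun_sum _ fun i _ => ?_
      have h2 : AEStronglyMeasurable
          (fun σ => innerSL ℝ (Pi σ t (B (stdOrthonormalBasis ℝ U i)))) paramMeasure :=
        (innerSL ℝ).continuous.comp_aestronglyMeasurable (hb.aestronglyMeasurable ht _)
      exact ((ContinuousLinearMap.smulRightL ℝ H U).flip _).continuous.comp_aestronglyMeasurable h2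
    refine h1.congr ?_
    filter_upwards [ae_mem_paramSet] with σ hσ
    exact (adjoint_comp_eq_sum B (hb.isPositive σ hσ t ht)).symm
  · filter_upwards [ae_mem_paramSet] with σ hσ
    exact norm_adjoint_comp_le B _ (hb.norm_le σ hσ t ht)

theorem IsBoundedFamily.integrable_offset (hb : IsBoundedFamily T c d Pi h) (ht : t ∈ Icc 0 T) :
    Integrable (fun σ => B.adjoint (h σ t)) paramMeasure := by
  refine Integrable.of_bound (C := ‖B‖ * d) ?_ ?_
  · exact B.adjoint.continuous.comp_aestronglyMeasurable
      (aestronglyMeasurable_of_inner (hb.offset_aemeasurable t ht))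
  · filter_upwards [ae_mem_paramSet] with σ hσ
    exact norm_adjoint_apply_le B _ (hb.offset_norm_le σ hσ t ht)

theorem IsBoundedFamily.norm_meanBPi_le (hb : IsBoundedFamily T c d Pi h) (ht : t ∈ Icc 0 T) :
    ‖meanBPi B Pi t‖ ≤ ‖B‖ * c := by
  have := norm_integral_le_of_norm_le_const (μ := paramMeasure)
    (f := fun σ => B.adjoint ∘L Pi σ t) (C := ‖B‖ * c) (by
      filter_upwards [ae_mem_paramSet] with σ hσ
      exact norm_adjoint_comp_le B _ (hb.norm_le σ hσ t ht))
  simpa [meanBPi] using this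

theorem IsBoundedFamily.norm_meanBh_le (hb : IsBoundedFamily T c d Pi h) (ht : t ∈ Icc 0 T) :
    ‖meanBh B h t‖ ≤ ‖B‖ * d := by
  have := norm_integral_le_of_norm_le_const (μ := paramMeasure)
    (f := fun σ => B.adjoint (h σ t)) (C := ‖B‖ * d) (by
      filter_upwards [ae_mem_paramSet] with σ hσ
      exact norm_adjoint_apply_le B _ (hb.offset_norm_le σ hσ t ht))
  simpa [meanBh] using this

theorem IsBoundedFamily.continuousOn_meanBPi (hb : IsBoundedFamily T c d Pi h) :
    ContinuousOn (meanBPi B Pi) (Icc 0 T) := by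
  refine continuousOn_of_dominated (bound := fun _ => ‖B‖ * c)
    (fun t ht => (hb.integrable ht).aestronglyMeasurable) (fun t ht => ?_) (integrable_const _) ?_
  · filter_upwards [ae_mem_paramSet] with σ hσ
    exact norm_adjoint_comp_le B _ (hb.norm_le σ hσ t ht)
  · filter_upwards [ae_mem_paramSet] with σ hσ
    exact continuousOn_adjoint_comp B (hb.continuousOn σ hσ) (hb.isPositive σ hσ)

theorem IsBoundedFamily.continuousOn_meanBh (hb : IsBoundedFamily T c d Pi h) :
    ContinuousOn (meanBh B h) (Icc 0 T) := by
  refine continuousOn_of_dominated (bound := fun _ => ‖B‖ * d)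
    (fun t ht => (hb.integrable_offset ht).aestronglyMeasurable) (fun t ht => ?_)
    (integrable_const _) ?_
  · filter_upwards [ae_mem_paramSet] with σ hσ
    exact norm_adjoint_apply_le B _ (hb.offset_norm_le σ hσ t ht)
  · filter_upwards [ae_mem_paramSet] with σ hσ
    exact B.adjoint.continuous.comp_continuousOn (hb.offset_continuousOn σ hσ)

theorem IsBoundedFamily.continuousOn_deviation (hb : IsBoundedFamily T c d Pi h)
    {σ : ℕ → ℝ} (hσ : σ ∈ paramSet) : ContinuousOn (deviation B T Pi h σ) (Icc 0 T) := by
  have hm : MapsTo (fun t => T - t) (Icc 0 T) (Icc 0 T) := fun t ht =>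
    ⟨by linarith [ht.2], by linarith [ht.1]⟩
  have hc : ContinuousOn (fun t => T - t) (Icc 0 T) := by fun_prop
  refine ContinuousOn.add ?_ ?_
  · exact (((continuousOn_adjoint_comp B (hb.continuousOn σ hσ) (hb.isPositive σ hσ)).comp
      hc hm).sub (hb.continuousOn_meanBPi.comp hc hm)).norm
  · exact ((B.adjoint.continuous.comp_continuousOn (hb.offset_continuousOn σ hσ)).sub
      hb.continuousOn_meanBh).norm

end Measurability

end

/-! ### Comparison of two closed-loop systems -/

section

section Comparison

variable {H U : Type*}
  [NormedAddCommGroup H] [InnerProductSpace ℝ H] [CompleteSpace H]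
  [NormedAddCommGroup U] [InnerProductSpace ℝ U] [CompleteSpace U]
  {J : ℝ → H →L[ℝ] H} {ρ μ₀ T : ℝ}

/-- The constant in the estimate for linearly perturbed evolution equations. -/
def perturbConst (ρ T α : ℝ) : ℝ :=
  energyConst ρ T * Real.exp (energyConst ρ T * (2 * α ^ 2) * T)

theorem perturbConst_pos (ρ T α : ℝ) : 0 < perturbConst ρ T α :=
  mul_pos (energyConst_pos _ _) (Real.exp_pos _)

/-- Insert ‖F‖² ≤ 2α²‖y‖² + 2β² into the energy estimate and apply Grönwall's inequality to ‖y‖². -/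
theorem IsResolventFamily.norm_sq_le_of_perturbation (hJ : IsResolventFamily J ρ μ₀)
    {F y : ℝ → H} {β : ℝ → ℝ} {α : ℝ} (hy : IsMild J μ₀ F y 0 T) (hF : MemL2 F 0 T)
    (hβ : MemL2 β 0 T) (h : ∀ s ∈ Ioc 0 T, ‖F s‖ ≤ α * ‖y s‖ + β s) {t : ℝ}
    (ht : t ∈ Icc 0 T) :
    ‖y t‖ ^ 2 ≤ perturbConst ρ T α * (‖y 0‖ ^ 2 + 2 * ∫ s in (0 : ℝ)..T, ‖β s‖ ^ 2) := by
  have hE := energyConst_pos ρ T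
  have hT : 0 ≤ T := ht.1.trans ht.2
  have hI := integral_norm_sq_nonneg β hT
  set c := energyConst ρ T * (‖y 0‖ ^ 2 + 2 * ∫ s in (0 : ℝ)..T, ‖β s‖ ^ 2) with hc
  have hc0 : 0 ≤ c := by positivity
  have key : ∀ q ∈ Icc 0 t, ‖y q‖ ^ 2
      ≤ c + energyConst ρ T * (2 * α ^ 2) * ∫ s in (0 : ℝ)..q, ‖y s‖ ^ 2 := fun q hq => by
    have hqT : q ∈ Icc 0 T := ⟨hq.1, hq.2.trans ht.2⟩
    have h1 := hJ.norm_sq_le (L := T) hq.1 (by linarith [hqT.2]) (hy.mono le_rfl hq.1 hqT.2)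
      (hF.mono le_rfl hqT.2)
    have iy := (hy.continuousOn.memL2.mono le_rfl hqT.2).intervalIntegrable_norm_sq hq.1
    have iβ := (hβ.mono le_rfl hqT.2).intervalIntegrable_norm_sq hq.1
    have h2 : ∫ s in (0 : ℝ)..q, ‖F s‖ ^ 2
        ≤ 2 * α ^ 2 * (∫ s in (0 : ℝ)..q, ‖y s‖ ^ 2) + 2 * ∫ s in (0 : ℝ)..q, ‖β s‖ ^ 2 := by
      rw [← intervalIntegral.integral_const_mul, ← intervalIntegral.integral_const_mul,
        ← intervalIntegral.integral_add (iy.const_mul _) (iβ.const_mul 2)]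
      refine intervalIntegral.integral_mono_on_of_le_Ioo hq.1
        ((hF.mono le_rfl hqT.2).intervalIntegrable_norm_sq hq.1)
        ((iy.const_mul _).add (iβ.const_mul 2)) fun s hs => ?_
      have h3 := pow_le_pow_left₀ (norm_nonneg _) (h s ⟨hs.1, hs.2.le.trans hqT.2⟩) 2
      rw [Real.norm_eq_abs, sq_abs]
      nlinarith [sq_nonneg (α * ‖y s‖ - β s)]
    have h3 := integral_norm_sq_mono hβ hqT
    calc ‖y q‖ ^ 2 ≤ energyConst ρ T * (‖y 0‖ ^ 2 + (2 * α ^ 2 * (∫ s in (0 : ℝ)..q, ‖y s‖ ^ 2)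
          + 2 * ∫ s in (0 : ℝ)..T, ‖β s‖ ^ 2)) :=
          h1.trans (mul_le_mul_of_nonneg_left (by linarith) hE.le)
      _ = _ := by rw [hc]; ring
  have h4 := le_mul_exp_of_le_add_mul_integral (by positivity) ht.1
    ((hy.continuousOn.mono (Icc_subset_Icc le_rfl ht.2)).norm.pow 2) key
  refine h4.trans ?_
  have h5 : Real.exp (energyConst ρ T * (2 * α ^ 2) * (t - 0))
      ≤ Real.exp (energyConst ρ T * (2 * α ^ 2) * T) :=
    Real.exp_le_exp.2 (mul_le_mul_of_nonneg_left (by linarith [ht.2]) (by positivity))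
  refine (mul_le_mul_of_nonneg_left h5 hc0).trans (le_of_eq ?_)
  rw [hc, perturbConst]; ring

/-- The states and controls of two closed-loop systems differ by at most a constant multiple of
the deviation of the feedbacks. -/
theorem exists_feedback_comparison (hT : 0 ≤ T) (ρ : ℝ) (B : U →L[ℝ] H) {f z : ℝ → H}
    (hf : MemL2 f 0 T) (hz : ContinuousOn z (Icc 0 T)) (y₀ : H) (k m : ℝ) :
    ∃ C_y C_u : ℝ, 0 < C_y ∧ 0 < C_u ∧ ∀ (J : ℝ → H →L[ℝ] H) (μ₀ : ℝ),
      IsResolventFamily J ρ μ₀ → ∀ (K₁ K₂ : ℝ → H →L[ℝ] U) (k₁ k₂ : ℝ → U) (M : ℝ),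
      ContinuousOn K₁ (Icc 0 T) → ContinuousOn K₂ (Icc 0 T) →
      ContinuousOn k₁ (Icc 0 T) → ContinuousOn k₂ (Icc 0 T) →
      (∀ t ∈ Icc 0 T, ‖K₁ t‖ ≤ k) → (∀ t ∈ Icc 0 T, ‖K₂ t‖ ≤ k) →
      (∀ t ∈ Icc 0 T, ‖k₂ t‖ ≤ m) →
      (∀ t ∈ Icc 0 T, ‖K₁ (T - t) - K₂ (T - t)‖ + ‖k₁ t - k₂ t‖ ≤ M) →
      ∀ y₁ y₂ : ℝ → H, y₁ 0 = y₀ → y₂ 0 = y₀ → ContinuousOn y₁ (Icc 0 T) →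
      ContinuousOn y₂ (Icc 0 T) →
      (∀ F, MemL2 F 0 T → (∀ t ∈ Icc 0 T, F t = B (feedback T K₁ k₁ t (y₁ t - z t)) + f t) →
        IsMild J μ₀ F y₁ 0 T) →
      (∀ F, MemL2 F 0 T → (∀ t ∈ Icc 0 T, F t = B (feedback T K₂ k₂ t (y₂ t - z t)) + f t) →
        IsMild J μ₀ F y₂ 0 T) →
      ∀ t ∈ Icc 0 T, ‖y₁ t - y₂ t‖ ≤ C_y * M ∧
        ‖feedback T K₁ k₁ t (y₁ t - z t) - feedback T K₂ k₂ t (y₂ t - z t)‖ ≤ C_u * M := by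
  obtain ⟨Z, hZ⟩ := isCompact_Icc.exists_bound_of_continuousOn hz
  have h0T : (0 : ℝ) ∈ Icc 0 T := ⟨le_rfl, hT⟩
  have hZ0 : 0 ≤ Z := (norm_nonneg _).trans (hZ 0 h0T)
  have hrev : MapsTo (fun t => T - t) (Icc 0 T) (Icc 0 T) := fun t ht =>
    ⟨by linarith [ht.2], by linarith [ht.1]⟩
  have hrevc : ContinuousOn (fun t => T - t) (Icc 0 T) := by fun_prop
  set β : ℝ → ℝ := fun s => ‖B‖ * (k * Z + m) + ‖f s‖ with hβd
  have hβ : MemL2 β 0 T := MemL2.add (continuousOn_const.memL2) (MemLp.norm hf)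
  set D := perturbConst ρ T (‖B‖ * k) * (‖y₀‖ ^ 2 + 2 * ∫ s in (0 : ℝ)..T, ‖β s‖ ^ 2) with hD
  have hI := integral_norm_sq_nonneg β hT
  have hD0 : 0 ≤ D := mul_nonneg (perturbConst_pos _ _ _).le (by positivity)
  set W := D + 1 + Z with hW
  set E := perturbConst ρ T (‖B‖ * k) * (2 * (T * (‖B‖ * (W + 1)) ^ 2)) with hE
  have hE0 : 0 ≤ E := mul_nonneg (perturbConst_pos _ _ _).le (by positivity)
  -- W bounds y₂ - z, where ‖y₂‖² ≤ D is weakened to ‖y₂‖ ≤ D + 1; likewise ‖y₁ - y₂‖² ≤ E M² gives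
  -- the constant E + 1. The constants are fixed before the resolvent family and the feedbacks,
  -- hence are independent of σ. The absolute value is needed because k ≥ 0 is only known once a
  -- gain bounded by k is given.
  refine ⟨E + 1, |k| * (E + 1) + W + 1, by positivity, by positivity, ?_⟩
  intro J μ₀ hJ K₁ K₂ k₁ k₂ M hK₁ hK₂ hk₁ hk₂ bK₁ bK₂ bk₂ hM y₁ y₂ h01 h02 hy₁ hy₂ hm₁ hm₂
  have hk : 0 ≤ k := (norm_nonneg _).trans (bK₁ 0 h0T)
  have hM0 : 0 ≤ M := le_trans (by positivity) (hM 0 h0T)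
  have hfb : ∀ (K : ℝ → H →L[ℝ] U) (l : ℝ → U) (y : ℝ → H), ContinuousOn K (Icc 0 T) →
      ContinuousOn l (Icc 0 T) → ContinuousOn y (Icc 0 T) →
      ContinuousOn (fun t => feedback T K l t (y t - z t)) (Icc 0 T) := fun K l y hK hl hy =>
    (((hK.comp hrevc hrev).clm_apply (hy.sub hz)).neg).sub hl
  have hF₁ : MemL2 (fun t => B (feedback T K₁ k₁ t (y₁ t - z t)) + f t) 0 T :=
    ((hfb K₁ k₁ y₁ hK₁ hk₁ hy₁).memL2.clm B).add hf
  have hF₂ : MemL2 (fun t => B (feedback T K₂ k₂ t (y₂ t - z t)) + f t) 0 T :=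
    ((hfb K₂ k₂ y₂ hK₂ hk₂ hy₂).memL2.clm B).add hf
  have mild₁ := hm₁ _ hF₁ fun _ _ => rfl
  have mild₂ := hm₂ _ hF₂ fun _ _ => rfl
  have bnd : ∀ t ∈ Icc 0 T, ‖y₂ t - z t‖ ≤ W := fun t ht => by
    have h1 := hJ.norm_sq_le_of_perturbation (α := ‖B‖ * k) mild₂ hF₂ hβ (fun s hs => ?_) ht
    · rw [h02] at h1
      have h2 : ‖y₂ t‖ ≤ D + 1 := by nlinarith [norm_nonneg (y₂ t)]
      exact (norm_sub_le _ _).trans (add_le_add h2 (hZ t ht))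
    · have hs' := Ioc_subset_Icc_self hs
      have h2 : ‖feedback T K₂ k₂ s (y₂ s - z s)‖ ≤ k * (‖y₂ s‖ + Z) + m := by
        refine (norm_sub_le _ _).trans (add_le_add ?_ (bk₂ s hs'))
        rw [norm_neg]
        refine ((K₂ (T - s)).le_of_opNorm_le (bK₂ _ (hrev hs')) _).trans ?_
        exact mul_le_mul_of_nonneg_left ((norm_sub_le _ _).trans
          (add_le_add le_rfl (hZ s hs'))) hk
      refine (norm_add_le _ _).trans ?_
      have h3 := (B.le_opNorm (feedback T K₂ k₂ s (y₂ s - z s))).trans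
        (mul_le_mul_of_nonneg_left h2 (norm_nonneg B))
      rw [hβd]
      linarith
  have diff : ∀ t ∈ Icc 0 T,
      ‖feedback T K₁ k₁ t (y₁ t - z t) - feedback T K₂ k₂ t (y₂ t - z t)‖
        ≤ k * ‖y₁ t - y₂ t‖ + (W + 1) * M := fun t ht => by
    -- The difference of gains is applied to the second state, whose bound W is known; it
    -- contributes W M and the offsets contribute M.
    have e : feedback T K₁ k₁ t (y₁ t - z t) - feedback T K₂ k₂ t (y₂ t - z t)
        = -(K₁ (T - t) (y₁ t - y₂ t))
          - ((K₁ (T - t) - K₂ (T - t)) (y₂ t - z t) + (k₁ t - k₂ t)) := by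
      simp only [feedback, map_sub, _root_.sub_apply]; abel
    rw [e]
    refine (norm_sub_le _ _).trans (add_le_add ?_ ?_)
    · rw [norm_neg]
      exact (K₁ (T - t)).le_of_opNorm_le (bK₁ _ (hrev ht)) _
    · have h1 := (K₁ (T - t) - K₂ (T - t)).le_opNorm (y₂ t - z t)
      have h2 := hM t ht
      have h3 := mul_le_mul (show ‖K₁ (T - t) - K₂ (T - t)‖ ≤ M by
        linarith [norm_nonneg (k₁ t - k₂ t)]) (bnd t ht) (norm_nonneg _) hM0
      have h4 : ‖k₁ t - k₂ t‖ ≤ M := by linarith [norm_nonneg (K₁ (T - t) - K₂ (T - t))]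
      linarith [norm_add_le ((K₁ (T - t) - K₂ (T - t)) (y₂ t - z t)) (k₁ t - k₂ t)]
  have dist_le : ∀ t ∈ Icc 0 T, ‖y₁ t - y₂ t‖ ≤ (E + 1) * M := fun t ht => by
    have h1 := hJ.norm_sq_le_of_perturbation (α := ‖B‖ * k)
      (β := fun _ => ‖B‖ * (W + 1) * M) (mild₁.sub hT mild₂) (hF₁.sub hF₂)
      continuousOn_const.memL2 (fun s hs => ?_) ht
    · rw [h01, h02, sub_self, norm_zero, intervalIntegral.integral_const, Real.norm_eq_abs,
        sq_abs, sub_zero, smul_eq_mul] at h1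
      refine abs_le_of_sq_le_sq' ?_ (by positivity) |>.2
      refine h1.trans ?_
      calc _ = E * M ^ 2 := by rw [hE]; ring
        _ ≤ ((E + 1) * M) ^ 2 := by rw [mul_pow]; gcongr; nlinarith
    · rw [add_sub_add_right_eq_sub, ← map_sub]
      refine (B.le_opNorm _).trans ?_
      have := mul_le_mul_of_nonneg_left (diff s (Ioc_subset_Icc_self hs)) (norm_nonneg B)
      linarith
  intro t ht
  refine ⟨dist_le t ht, (diff t ht).trans ?_⟩
  rw [abs_of_nonneg hk]
  nlinarith [mul_le_mul_of_nonneg_left (dist_le t ht) hk]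

end Comparison

end

/-! ### The source f + 𝒜_σ g - g', and the family of Riccati solutions and offsets -/

section

section Source

variable {E H : Type*} [NormedAddCommGroup E] [NormedSpace ℝ E]
  [NormedAddCommGroup H] [InnerProductSpace ℝ H]
  {A : (ℕ → ℝ) → E →L[ℝ] H} {S : Set (ℕ → ℝ)} {C T : ℝ} {f dg : ℝ → H} {gD : ℝ → E}

theorem memL2_source (hf : MemL2 f 0 T) (hdg : MemL2 dg 0 T) (hgD : MemL2 gD 0 T)
    (L : E →L[ℝ] H) : MemL2 (fun t => f t + L (gD t) - dg t) 0 T :=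
  (hf.add (hgD.clm L)).sub hdg

/-- The right-hand side involves the operator only through C, which makes the bound on the offsets
uniform in σ. -/
theorem integral_norm_sq_source_le (hT : 0 ≤ T) (hf : MemL2 f 0 T) (hdg : MemL2 dg 0 T)
    (hgD : MemL2 gD 0 T) {L : E →L[ℝ] H} (hL : ‖L‖ ≤ C) :
    ∫ t in (0 : ℝ)..T, ‖f t + L (gD t) - dg t‖ ^ 2
      ≤ ∫ t in (0 : ℝ)..T, ‖‖f t‖ + C * ‖gD t‖ + ‖dg t‖‖ ^ 2 := by
  have hb : MemL2 (fun t => ‖f t‖ + C * ‖gD t‖ + ‖dg t‖) 0 T :=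
    (MemL2.add (MemLp.norm hf) (MemLp.const_mul (MemLp.norm hgD) C)).add (MemLp.norm hdg)
  refine intervalIntegral.integral_mono_on hT
    ((memL2_source hf hdg hgD L).intervalIntegrable_norm_sq hT)
    (hb.intervalIntegrable_norm_sq hT) fun t _ => ?_
  refine pow_le_pow_left₀ (norm_nonneg _) (le_trans ?_ (le_abs_self _)) 2
  refine (norm_sub_le _ _).trans (add_le_add ((norm_add_le _ _).trans
    (add_le_add le_rfl ?_)) le_rfl)
  exact L.le_of_opNorm_le hL _

theorem tendsto_integral_source (hT : 0 ≤ T) (hgD : MemL2 gD 0 T)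
    (hA : ∀ σ ∈ S, ‖A σ‖ ≤ C) (hAc : ∀ x, ContinuousOn (fun σ => A σ x) S)
    {σ : ℕ → ℝ} (hσ : σ ∈ S) :
    Tendsto (fun σ' => ∫ t in (0 : ℝ)..T,
      ‖(f t + A σ' (gD t) - dg t) - (f t + A σ (gD t) - dg t)‖ ^ 2) (𝓝[S] σ) (𝓝 0) := by
  have e : ∀ σ' t, (f t + A σ' (gD t) - dg t) - (f t + A σ (gD t) - dg t)
      = A σ' (gD t) - A σ (gD t) := fun _ _ => by abel
  simp only [e]
  have h1 : Tendsto (fun σ' => ∫ t in (0 : ℝ)..T, ‖A σ' (gD t) - A σ (gD t)‖ ^ 2) (𝓝[S] σ)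
      (𝓝 (∫ _ in (0 : ℝ)..T, (0 : ℝ))) := by
    refine intervalIntegral.tendsto_integral_filter_of_dominated_convergence
      (fun t => (2 * C) ^ 2 * ‖gD t‖ ^ 2) ?_ ?_
      ((hgD.intervalIntegrable_norm_sq hT).const_mul _) (ae_of_all _ fun t _ => ?_)
    · refine Eventually.of_forall fun σ' => ?_
      rw [uIoc_of_le hT]
      exact ((hgD.clm (A σ')).sub (hgD.clm (A σ))).1.norm.pow 2
    · filter_upwards [self_mem_nhdsWithin] with σ' hσ'
      refine ae_of_all _ fun t _ => ?_
      rw [Real.norm_of_nonneg (by positivity), ← mul_pow]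
      refine pow_le_pow_left₀ (norm_nonneg _) ((norm_sub_le _ _).trans ?_) 2
      have h1 := (A σ').le_of_opNorm_le (hA σ' hσ') (gD t)
      have h2 := (A σ).le_of_opNorm_le (hA σ hσ) (gD t)
      linarith
    · have h2 : Tendsto (fun σ' => A σ' (gD t) - A σ (gD t)) (𝓝[S] σ) (𝓝 0) := by
        simpa using (hAc (gD t) σ hσ).tendsto.sub_const (A σ (gD t))
      simpa using h2.norm.pow 2
  simpa using h1

end Source

section Family

variable {V H U : Type*}
  [NormedAddCommGroup V] [InnerProductSpace ℝ V] [CompleteSpace V]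
  [NormedAddCommGroup H] [InnerProductSpace ℝ H] [CompleteSpace H]
  [NormedAddCommGroup U] [InnerProductSpace ℝ U] [CompleteSpace U]
  {ι : V →L[ℝ] H} {ρ θ T C_AD R : ℝ} {𝒜 : (ℕ → ℝ) → V →L[ℝ] StrongDual ℝ V}
  {𝒜₀ : V →L[ℝ] StrongDual ℝ V} {AD : (ℕ → ℝ) → graphDomain ι 𝒜₀ →L[ℝ] H}
  {B : U →L[ℝ] H} {Q P : H →L[ℝ] H}
  {Pi : (ℕ → ℝ) → ℝ → H →L[ℝ] H} {r h : (ℕ → ℝ) → ℝ → H}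

theorem isBoundedFamily (hinj : Function.Injective ι) (hι : DenseRange ι)
    (hc₀ : IsVHCoercive ι 𝒜₀ ρ θ)
    (hc : ∀ σ ∈ paramSet, IsVHCoercive ι (𝒜 σ) ρ θ)
    (hdom : ∀ σ ∈ paramSet, domainH ι (𝒜 σ) = domainH ι 𝒜₀)
    (hAD : ∀ σ ∈ paramSet, IsRestriction ι 𝒜₀ (𝒜 σ) (AD σ))
    (hADb : ∀ σ ∈ paramSet, ‖AD σ‖ ≤ C_AD)
    (hADc : ∀ x, ContinuousOn (fun σ => AD σ x) paramSet) (hT : 0 ≤ T)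
    (hR : ∀ σ ∈ paramSet, IsRiccati (resolvent ι (𝒜 σ)) (maxStep ρ) B Q P T (Pi σ))
    (hh : ∀ σ ∈ paramSet,
      IsOffset (resolvent ι (𝒜 σ)) (maxStep ρ) B T (Pi σ) (r σ) (h σ))
    (hr : ∀ σ ∈ paramSet, MemL2 (r σ) 0 T)
    (hrb : ∀ σ ∈ paramSet, ∫ s in (0 : ℝ)..T, ‖r σ s‖ ^ 2 ≤ R)
    (hrc : ∀ σ ∈ paramSet,
      Tendsto (fun σ' => ∫ s in (0 : ℝ)..T, ‖r σ' s - r σ s‖ ^ 2) (𝓝[paramSet] σ) (𝓝 0)) :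
    IsBoundedFamily T (valueConst Q P ρ T) (valueConst Q P ρ T * (1 + R)) Pi h where
  continuousOn := fun σ hσ => (hR σ hσ).continuousOn
  isPositive := fun σ hσ => (hR σ hσ).isPositive
  norm_le := fun σ hσ t ht =>
    (hR σ hσ).norm_le ((hc σ hσ).isResolventFamily hinj hι) ht
  aemeasurable := fun t ht x => by
    have ha : T - t ∈ Icc 0 T := ⟨by linarith [ht.2], by linarith [ht.1]⟩
    -- With zero source and offset the value at time T - t is ⟨Π_σ(t)x, x⟩.
    have h1 : AEMeasurable (fun σ => value B T (Pi σ) 0 0 (T - t) x) paramMeasure :=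
      aemeasurable_of_upperSemicontinuous fun σ hσ c hlt =>
        eventually_value_lt (r := 0) (h := 0) hinj hι hc₀ hc hdom hAD hADb hADc ha hR
          (fun _ _ => isOffset_zero) (fun _ _ => MemLp.zero) hσ (by simp [tendsto_const_nhds]) x hlt
    simpa only [value_zero, sub_sub_cancel] using h1
  offset_continuousOn := fun σ hσ => (hh σ hσ).continuousOn
  offset_norm_le := fun σ hσ t ht =>
    ((hh σ hσ).norm_le ((hc σ hσ).isResolventFamily hinj hι) (hR σ hσ) (hr σ hσ) ht).trans
      (mul_le_mul_of_nonneg_left (add_le_add le_rfl (hrb σ hσ)) (valueConst_nonneg hT))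
  offset_aemeasurable := fun t ht x => by
    have h1 : ∀ x, AEMeasurable (fun σ => value B T (Pi σ) (r σ) (h σ) t x) paramMeasure :=
      fun x => aemeasurable_of_upperSemicontinuous fun σ hσ c hlt =>
        eventually_value_lt hinj hι hc₀ hc hdom hAD hADb hADc ht hR hh hr hσ (hrc σ hσ) x hlt
    -- The even parts, namely the quadratic form and the constant, cancel; what remains is 4⟨h_σ(t),
    -- x⟩.
    refine (((h1 x).sub (h1 (-x))).div_const 4).congr (ae_of_all _ fun σ => ?_)
    simp only [_root_.Pi.sub_apply, value, map_neg, inner_neg_left, inner_neg_right]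
    ring

theorem IsVHCoercive.isMild_of_isClosedLoop {𝒜 : V →L[ℝ] StrongDual ℝ V}
    (hc : IsVHCoercive ι 𝒜 ρ θ) (hT : 0 ≤ T)
    {K : ℝ → H → U} {z f y F : ℝ → H} {y₀ : H} (hy : IsClosedLoop ι 𝒜 B T K z f y₀ y)
    (hF : MemL2 F 0 T) (hFeq : ∀ t ∈ Icc 0 T, F t = B (K t (y t - z t)) + f t) :
    IsMild (resolvent ι 𝒜) (maxStep ρ) F y 0 T := by
  obtain ⟨yV, dy, hw, -, heq⟩ := hy
  refine hc.isMild_of_memW hT hw hF ?_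
  filter_upwards [heq, ae_restrict_mem measurableSet_Ioo] with t ht hts
  rw [ht, hFeq t (Ioo_subset_Icc_self hts)]

end Family

end

end MeanFeedback

end

/-! ### The main theorem -/

theorem mainTheorem8
    {V H U : Type*}
    [NormedAddCommGroup V] [InnerProductSpace ℝ V] [CompleteSpace V]
    [TopologicalSpace.SeparableSpace V]
    [NormedAddCommGroup H] [InnerProductSpace ℝ H] [CompleteSpace H]
    [TopologicalSpace.SeparableSpace H]
    [NormedAddCommGroup U] [InnerProductSpace ℝ U] [CompleteSpace U] [FiniteDimensional ℝ U]
    -- the Gelfand triple `V ⊂ H ⊂ V'`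
    (ι : V →L[ℝ] H) (hι : Function.Injective ι) (hι_dense : DenseRange ι)
    -- the problem data
    (T : ℝ) (hT : 0 < T) (B : U →L[ℝ] H) (Q P : H →L[ℝ] H) (y₀ : H)
    (𝒜 : (ℕ → ℝ) → V →L[ℝ] StrongDual ℝ V)
    -- `V`-`H`-coercivity of `a(σ; v, w) = -⟨𝒜_σ v, w⟩` and boundedness, uniformly in `σ`
    (ρ θ C_A : ℝ) (hθ : 0 < θ)
    (h_coercive : ∀ σ ∈ MeanFeedback.paramSet, ∀ v : V,
      θ * ‖v‖ ^ 2 ≤ -(𝒜 σ v v) + ρ * ‖ι v‖ ^ 2)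
    (h_bounded : ∀ σ ∈ MeanFeedback.paramSet, ‖𝒜 σ‖ ≤ C_A)
    -- `D(𝒜_σ) = D(𝒜_σ*)` is independent of `σ`
    (h_domain : ∀ σ ∈ MeanFeedback.paramSet,
      MeanFeedback.domainH ι (𝒜 σ) = MeanFeedback.domainH ι (𝒜 0))
    (h_domain_adjoint : ∀ σ ∈ MeanFeedback.paramSet,
      MeanFeedback.domainH ι (𝒜 σ).flip = MeanFeedback.domainH ι (𝒜 σ))
    -- `AD σ` is `𝒜_σ` as an element of `ℒ(D(𝒜), H)`: uniform bound, continuity in `σ`, and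
    -- `p`-summable bounds for all the derivatives `∂^ν 𝒜_σ`
    (AD : (ℕ → ℝ) → MeanFeedback.graphDomain ι (𝒜 0) →L[ℝ] H)
    (h_AD : ∀ σ ∈ MeanFeedback.paramSet, MeanFeedback.IsRestriction ι (𝒜 0) (𝒜 σ) (AD σ))
    (C_AD : ℝ) (h_AD_bounded : ∀ σ ∈ MeanFeedback.paramSet, ‖AD σ‖ ≤ C_AD)
    (h_AD_continuous : ∀ x, ContinuousOn (fun σ => AD σ x) MeanFeedback.paramSet)
    (dAD : (ℕ →₀ ℕ) → (ℕ → ℝ) → MeanFeedback.graphDomain ι (𝒜 0) →L[ℝ] H)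
    (h_dAD : MeanFeedback.IsPartialDerivs AD dAD)
    (p : ℝ) (hp₀ : 0 < p) (hp₁ : p ≤ 1) (b : ℕ → ℝ) (hb : ∀ j, 0 ≤ b j)
    (hb_summable : Summable fun j => b j ^ p)
    (h_dAD_bounded : ∀ ν : ℕ →₀ ℕ, ν ≠ 0 → ∀ σ ∈ MeanFeedback.paramSet,
      ‖dAD ν σ‖ ≤ ν.prod fun j k => b j ^ k)
    -- `f ∈ L²(0,T; H)` and `g ∈ W^{1,2}(0,T; H) ∩ L²(0,T; D(𝒜))`
    (f : ℝ → H) (hf : MemLp f 2 (MeanFeedback.timeMeasure T))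
    (g dg : ℝ → H) (hdg : MemLp dg 2 (MeanFeedback.timeMeasure T))
    (hg : ∀ t ∈ Set.Icc 0 T, g t = g 0 + ∫ s in (0 : ℝ)..t, dg s)
    (gD : ℝ → MeanFeedback.graphDomain ι (𝒜 0))
    (hgD : MemLp gD 2 (MeanFeedback.timeMeasure T))
    (hgD_eq : ∀ᵐ t ∂MeanFeedback.timeMeasure T, (gD t : WithLp 2 (H × H)).fst = g t)
    -- the solutions of the Riccati equations and of the equations for the offsets, where
    -- `r_σ = f + 𝒜_σ g - g'`
    (Pi : (ℕ → ℝ) → ℝ → H →L[ℝ] H)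
    (hPi : ∀ σ ∈ MeanFeedback.paramSet, MeanFeedback.IsRiccatiSolution ι (𝒜 σ) B Q P T (Pi σ))
    (h : (ℕ → ℝ) → ℝ → H)
    (hh : ∀ σ ∈ MeanFeedback.paramSet, MeanFeedback.IsOffsetSolution ι (𝒜 σ) B T (Pi σ)
      (fun t => f t + AD σ (gD t) - dg t) (h σ))
    -- the feedback acts on the state itself or on the tracking error
    (z : ℝ → H) (hz : z = 0 ∨ z = g) :
    -- the mean-based feedback is well defined
    (∀ t ∈ Set.Icc 0 T,
      Integrable (fun σ => B.adjoint ∘L Pi σ (T - t)) MeanFeedback.paramMeasure ∧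
      Integrable (fun σ => B.adjoint (h σ t)) MeanFeedback.paramMeasure) ∧
    ∃ C_y C_u : ℝ, 0 < C_y ∧ 0 < C_u ∧ ∀ σ ∈ MeanFeedback.paramSet,
      ∃ M : ℝ, IsGreatest (MeanFeedback.deviation B T Pi h σ '' Set.Icc 0 T) M ∧
        ∀ y_opt y : ℝ → H,
          MeanFeedback.IsClosedLoop ι (𝒜 σ) B T
            (MeanFeedback.optFeedback B T (Pi σ) (h σ)) z f y₀ y_opt →
          MeanFeedback.IsClosedLoop ι (𝒜 σ) B T
            (MeanFeedback.meanFeedback B T Pi h) z f y₀ y →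
          ∀ t ∈ Set.Icc 0 T,
            ‖y_opt t - y t‖ ≤ C_y * M ∧
            ‖MeanFeedback.optFeedback B T (Pi σ) (h σ) t (y_opt t - z t)
              - MeanFeedback.meanFeedback B T Pi h t (y t - z t)‖ ≤ C_u * M := by
  have hT' := hT.le
  -- The resolvent estimates presuppose a nonnegative shift; enlarging ρ only weakens coercivity.
  have hcoer : ∀ σ ∈ MeanFeedback.paramSet, MeanFeedback.IsVHCoercive ι (𝒜 σ) (max ρ 0) θ := fun σ hσ =>
    ⟨le_max_right _ _, hθ, fun v => (h_coercive σ hσ v).trans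
      (add_le_add le_rfl (mul_le_mul_of_nonneg_right (le_max_left _ _) (sq_nonneg _)))⟩
  have h0 : (0 : ℕ → ℝ) ∈ MeanFeedback.paramSet := fun j => by norm_num
  rw [MeanFeedback.timeMeasure_eq] at hf hdg hgD
  have hr : ∀ σ ∈ MeanFeedback.paramSet, MeanFeedback.MemL2 (fun t => f t + AD σ (gD t) - dg t) 0 T :=
    fun σ _ => MeanFeedback.memL2_source hf hdg hgD (AD σ)
  have hR := fun σ hσ => (hcoer σ hσ).isRiccati (hPi σ hσ)
  have hfam := MeanFeedback.isBoundedFamily (AD := AD) hι hι_dense (hcoer 0 h0) hcoer h_domain h_AD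
    h_AD_bounded h_AD_continuous hT' hR
    (fun σ hσ => (hcoer σ hσ).isOffset hT' (hPi σ hσ) (hr σ hσ) (hh σ hσ)) hr
    (fun σ hσ => MeanFeedback.integral_norm_sq_source_le hT' hf hdg hgD (h_AD_bounded σ hσ))
    (fun σ hσ => MeanFeedback.tendsto_integral_source hT' hgD h_AD_bounded h_AD_continuous hσ)
  have hrev : ∀ t ∈ Icc 0 T, T - t ∈ Icc 0 T := fun t ht =>
    ⟨by linarith [ht.2], by linarith [ht.1]⟩
  refine ⟨fun t ht => ⟨hfam.integrable (hrev t ht), hfam.integrable_offset ht⟩, ?_⟩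
  have hzc : ContinuousOn z (Icc 0 T) := by
    rcases hz with rfl | rfl
    · exact continuousOn_const
    · refine ContinuousOn.congr (continuousOn_const.add ?_) hg
      have h1 := intervalIntegral.continuousOn_primitive_interval (μ := volume) (f := dg)
        (a := 0) (b := T) (by
          rw [uIcc_of_le hT', integrableOn_Icc_iff_integrableOn_Ioc]
          exact hdg.integrable (by norm_num))
      rwa [uIcc_of_le hT'] at h1
  obtain ⟨C_y, C_u, hCy, hCu, key⟩ := MeanFeedback.exists_feedback_comparison hT' (max ρ 0) B hf hzc y₀
    (‖B‖ * MeanFeedback.valueConst Q P (max ρ 0) T) _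
  refine ⟨C_y, C_u, hCy, hCu, fun σ hσ => ?_⟩
  obtain ⟨M, hM⟩ := (isCompact_Icc.image_of_continuousOn
    (hfam.continuousOn_deviation (B := B) hσ)).exists_isGreatest
    ((nonempty_Icc.2 hT').image _)
  refine ⟨M, hM, fun y_opt y hopt hy => ?_⟩
  exact key _ _ ((hcoer σ hσ).isResolventFamily hι hι_dense) _ _ _ _ M
    (MeanFeedback.continuousOn_adjoint_comp B (hfam.continuousOn σ hσ) (hfam.isPositive σ hσ))
    hfam.continuousOn_meanBPi
    (B.adjoint.continuous.comp_continuousOn (hfam.offset_continuousOn σ hσ))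
    hfam.continuousOn_meanBh
    (fun t ht => MeanFeedback.norm_adjoint_comp_le B _ (hfam.norm_le σ hσ t ht))
    (fun t ht => hfam.norm_meanBPi_le ht) (fun t ht => hfam.norm_meanBh_le ht)
    (fun t ht => hM.2 (mem_image_of_mem _ ht))
    y_opt y hopt.choose_spec.choose_spec.2.1 hy.choose_spec.choose_spec.2.1
    hopt.choose_spec.choose_spec.1.continuousOn hy.choose_spec.choose_spec.1.continuousOn
    (fun F hF hFeq => (hcoer σ hσ).isMild_of_isClosedLoop hT' hopt hF hFeq)
    (fun F hF hFeq => (hcoer σ hσ).isMild_of_isClosedLoop hT' hy hF hFeq)
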